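/- **Notation.** Fix $n\ge 1$, $\rho\in\mathbb C$, and a sign: upper signs refer to $\mathfrak g_{2n}=\mathfrak{so}_{2n}$ (where $n\ge2$), lower signs to $\mathfrak g_{2n}=\mathfrak{sp}_{2n}$. Put $\kappa=n\mp1$ and $\tilde x=\kappa-x-\rho$. Let $\theta_i=1$ for $\mathfrak{so}_{2n}$, and $\theta_i=-1$ ($i\le n$), $\theta_i=1$ ($i>n$) for $\mathfrak{sp}_{2n}$; put $\theta_{ij}=\theta_i\theta_j$. On $\mathbb C^{2n}$ let $e_{ij}^t=\theta_{ij}e_{2n-j+1,2n-i+1}$. Rational functions of $v$ are expanded in $\mathbb C((v^{-1}))$. An ordered product $\prod_{i=1}^s X_i$ is $X_1\cdots X_s$, and $\prod_{i=s}^1X_i$ is $X_s\cdots X_1$. *Bulk spaces.* Let $\widetilde R(z)=I-\frac1z\sum_{i,j} e_{ij}\otimes e_{ji}+\frac1{z-\kappa}\sum_{i,j}\theta_{ij}e_{ij}\otimes e_{2n-i+1,2n-j+1}$ on $\mathbb C^{2n}\otimes\mathbb C^{2n}$. For $k\ge1$ (and $k\le n$ for $\mathfrak{sp}_{2n}$)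 let $\Pi_k=\frac1{k!}\prod_{i=2}^k\big(\widetilde R_{1i}(\mp(i-1))\cdots\widetilde R_{i-1,i}(\mp1)\big)$ on $(\mathbb C^{2n})^{\otimes k}$, $L_k=\Pi_k(\mathbb C^{2n})^{\otimes k}$, and $\mathcal L(z)=\widetilde R_{01}(z)\widetilde R_{02}(z\mp1)\cdots\widetilde R_{0k}(z\mp k\pm1)$, where $0$ is an auxiliary space $\mathbb C^{2n}$; $\mathcal L^t$ is its transpose in the space $0$. For $c\in\mathbb C$ let $L^0_{k,c}\subset L_k$ be the subspace annihilated by the entries $(n+p,l)$, $1\le p,l\le n$, of $\mathcal L(v-c)$. Let $\lambda=(k,0,\dots,0)$ for $\mathfrak{so}_{2n}$, and $\lambda=(1,\dots,1,0,\dots,0)$ with $k$ ones for $\mathfrak{sp}_{2n}$. *Boundary.* Let $G$ be one of the following diagonal matrices of size $2n$: for CI ($\mathfrak{sp}_{2n}$, $n\ge1$) and DIII ($\mathfrak{so}_{2n}$, $n\ge2$), $G=\sum_{i\le n}(e_{ii}-e_{n+i,n+i})$; for CII ($\mathfrak{sp}_{2n}$) and DI ($\mathfrak{so}_{2n}$),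 with $p\ge q>0$ even and $p+q=2n$, $g_{ii}=-1$ if $i\le\frac q2$ or $i>2n-\frac q2$, and $g_{ii}=1$ otherwise; for CD0 (either algebra), $G=I$. Put $r=\frac q2=n-\frac p2$ for CII, DI and $r=0$ for CI, DIII, CD0; $d=\frac14\operatorname{tr}G$; $G(u)=\frac{dI-uG}{d-u}$; $x=v+\frac\rho2$. For $a,b\in\mathbb C$ the boundary matrix is - $K(v)=G-\frac axI$ for CI, DIII; - $K(v)=-(1-\frac bx)\big((1-\frac ax)e_{11}-(1+\frac ax)e_{22}\big)+(1+\frac bx)\big((1-\frac ax)e_{33}-(1+\frac ax)e_{44}\big)$ for DI with $n=p=q=2$; - $K(v)=\frac{(x-a)(x+a-2d)}{(x-d)^2}\big(I-\frac{2x}{x-a}e_{11}-\frac{2x}{x+a-2d}e_{2n,2n}\big)$ for DI with $n>2$, $q=2$; - $K(v)=G(v+\frac\rho2)$ for CII, for DI with $q\ge4$, and for CD0. Let $\mu_i(v)$ be the $i$-th diagonal entry of $K(v)$, $1\le i\le n$. Let $g(v)=1$ for CI, DIII; $g(v)=2v-\kappa\pm1+\rho$ for CII, DI with $p=q$; and $g(v)=\frac{v-\tilde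 v-\kappa}{\operatorname{tr}G(v+\rho/2)}$ for CD0 and for CII, DI with $p>q$. *Monodromy matrices.* Given $k_1,\dots,k_\ell$ as above and $c_1,\dots,c_\ell\in\mathbb C$, put $S(v)=g(v)\big(\prod_{i=1}^\ell\mathcal L_i(v-c_i-\frac\kappa2)\big)K(v)\big(\prod_{i=\ell}^1\mathcal L_i^t(\tilde v-c_i-\frac\kappa2)\big)$ on $M=L_{k_1}\otimes\cdots\otimes L_{k_\ell}$ and let $A(v)$ be its upper left $n\times n$ block. Given $m\ge0$ and $\boldsymbol u,\boldsymbol w\in\mathbb C^m$, let $W=\bigotimes_{i=1}^m(V_{\tilde a_i}\otimes V_{a_i})$ with all factors $\mathbb C^n$, $M^0=\bigotimes_iL^0_{k_i,c_i}$, $M^{(1)}=W\otimes M^0$, and $$S^{(1)}_a(v;\boldsymbol w,\boldsymbol u)=\prod_{i=1}^mR^t_{\tilde a_ia}(u_i-v)\prod_{i=1}^mR^t_{a_ia}(w_i-v)\;A_a(v)\prod_{i=m}^1R^t_{a_ia}(\tilde w_i-v\pm1)\prod_{i=m}^1R^t_{\tilde a_ia}(\tilde u_i-v\pm1),$$ where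 $R^t(z)=I-\frac1z\sum_{i,j=1}^ne_{ij}\otimes e_{n-i+1,n-j+1}$ on $\mathbb C^n\otimes\mathbb C^n$. *Reflection algebra.* $\mathcal B^{\rm ex}_\rho(n,r)$ is the unital associative $\mathbb C$-algebra generated by the coefficients of $b^\circ_{ij}(v)=g^\circ_{ij}+\sum_{s\ge1}b_{ij}^{\circ(s)}v^{-s}$, $1\le i,j\le n$, where $G^\circ=\sum_{i>r}e_{ii}-\sum_{i\le r}e_{ii}$, subject to $R(u-v)B^\circ_1(u)R(u+v+\rho)B^\circ_2(v)=B^\circ_2(v)R(u+v+\rho)B^\circ_1(u)R(u-v)$ with $R(z)=I-\frac1zP$ on $\mathbb C^n\otimes\mathbb C^n$. A lowest vector of weight $(\gamma_i(v))_{1\le i\le n}$, $\gamma_i(v)\in g^\circ_{ii}+v^{-1}\mathbb C[[v^{-1}]]$, is a vector $\xi\ne0$ with $b^\circ_{ij}(v)\xi=0$ for $i>j$ and $b^\circ_{ii}(v)\xi=\gamma_i(v)\xi$; a lowest weight module is a module generated by a lowest vector. For an $n$-tuple $f$ of elements of $\mathbb C((v^{-1}))$ put $\tilde f_i(v)=(2v+\rho-i+1)f_i(v)+\sum_{j<i}f_j(v)$.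 **Proposition.** For all $\boldsymbol c=(c_1,\dots,c_\ell)$, $\boldsymbol u$, $\boldsymbol w$, the space $M^{(1)}$ is stable under $S^{(1)}_a(v;\boldsymbol w,\boldsymbol u)$, and the mapping $B^\circ_a(v)\mapsto g(v)^{-1}S^{(1)}_a(v;\boldsymbol w,\boldsymbol u)$ defines a $\mathcal B^{\rm ex}_\rho(n,r)$-module structure on $M^{(1)}$. This module has a lowest vector $\xi$, of weight $(g(v)^{-1}\gamma_j(v))_j$ say, so that $\gamma_j(v)$ is the eigenvalue of $[S^{(1)}_a(v;\boldsymbol w,\boldsymbol u)]_{jj}$ on $\xi$, and for $1\le j\le n$ $$\tilde\gamma_j(v)=g(v)\,\tilde\mu_j(v)\,E_j(v)\prod_{i=1}^\ell\lambda_j^{(i)}(v-\tfrac\kappa2)\,\bar\lambda_j^{(i)}(\tilde v-\tfrac\kappa2),$$ where $\lambda_j^{(i)}(v)=1-\frac{\lambda_j^{(i)}}{v-c_i}$, $\bar\lambda_j^{(i)}(v)=1+\frac{\lambda_j^{(i)}}{v-c_i\mp k_i\pm1-\kappa}$, $E_j(v)=1$ for $j<n$, and $$E_n(v)=\prod_{i=1}^m\frac{v-u_i+1}{v-u_i}\cdot\frac{v-w_i+1}{v-w_i}\cdot\frac{v-\tilde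 w_i\mp1+1}{v-\tilde w_i\mp1}\cdot\frac{v-\tilde u_i\mp1+1}{v-\tilde u_i\mp1}.$$ For generic $(\boldsymbol c,\boldsymbol u,\boldsymbol w)$ (outside the zero set of some non-zero polynomial, which depends only on the remaining data) $\xi$ generates $M^{(1)}$, so that $M^{(1)}$ is a lowest weight module of this weight. -/

import Mathlib

open scoped Kronecker

noncomputable section

namespace NestedChain

/-! ### The extended reflection algebra -/

section ReflectionAlgebra

/-- The diagonal entries of `G°`: the first `r` of them are `-1`, the remaining ones are `1`. -/
def gCirc (n r : ℕ) (i : Fin n) : ℂ := if (i : ℕ) < r then -1 else 1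

/-- The permutation operator on `ℂⁿ ⊗ ℂⁿ` as a matrix with entries in a ring. -/
def permMat (n : ℕ) (A : Type*) [Zero A] [One A] : Matrix (Fin n × Fin n) (Fin n × Fin n) A :=
  Matrix.of fun p q => if p.1 = q.2 ∧ p.2 = q.1 then 1 else 0

/-- The power series `∑ₛ β i j s • Xₜˢ` in the variable `Xₜ`; here `X₀ = u⁻¹` and `X₁ = v⁻¹`. -/
def genMat {n : ℕ} {A : Type*} [Zero A] (β : Fin n → Fin n → ℕ → A) (t : Fin 2) :
    Matrix (Fin n) (Fin n) (MvPowerSeries (Fin 2) A) :=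
  Matrix.of fun i j => fun d => if d = Finsupp.single t (d t) then β i j (d t) else 0

/-- `u⁻¹ v⁻¹ (u - v) R(u - v) = (v⁻¹ - u⁻¹) I - u⁻¹ v⁻¹ P`, where `R(z) = I - z⁻¹ P`. -/
def yangDiff (n : ℕ) (A : Type*) [Ring A] :
    Matrix (Fin n × Fin n) (Fin n × Fin n) (MvPowerSeries (Fin 2) A) :=
  ((MvPowerSeries.X 1 - MvPowerSeries.X 0 : MvPowerSeries (Fin 2) A)) • 1
    - ((MvPowerSeries.X 0 * MvPowerSeries.X 1 : MvPowerSeries (Fin 2) A)) • permMat n _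

/-- `u⁻¹ v⁻¹ (u + v + ρ) R(u + v + ρ) = (u⁻¹ + v⁻¹ + ρ u⁻¹ v⁻¹) I - u⁻¹ v⁻¹ P`. -/
def yangSum (n : ℕ) (A : Type*) [Ring A] [Algebra ℂ A] (ρ : ℂ) :
    Matrix (Fin n × Fin n) (Fin n × Fin n) (MvPowerSeries (Fin 2) A) :=
  ((MvPowerSeries.X 0 + MvPowerSeries.X 1
      + MvPowerSeries.C (algebraMap ℂ A ρ) * (MvPowerSeries.X 0 * MvPowerSeries.X 1) :
        MvPowerSeries (Fin 2) A)) • 1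
    - ((MvPowerSeries.X 0 * MvPowerSeries.X 1 : MvPowerSeries (Fin 2) A)) • permMat n _

/-- `R(u - v) B₁(u) R(u + v + ρ) B₂(v)`, multiplied by `u⁻² v⁻² (u - v) (u + v + ρ)`. -/
def reflLeft {n : ℕ} {A : Type*} [Ring A] [Algebra ℂ A] (ρ : ℂ) (β : Fin n → Fin n → ℕ → A) :
    Matrix (Fin n × Fin n) (Fin n × Fin n) (MvPowerSeries (Fin 2) A) :=
  yangDiff n A * (genMat β 0 ⊗ₖ 1) * yangSum n A ρ * (1 ⊗ₖ genMat β 1)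

/-- `B₂(v) R(u + v + ρ) B₁(u) R(u - v)`, multiplied by `u⁻² v⁻² (u - v) (u + v + ρ)`. -/
def reflRight {n : ℕ} {A : Type*} [Ring A] [Algebra ℂ A] (ρ : ℂ) (β : Fin n → Fin n → ℕ → A) :
    Matrix (Fin n × Fin n) (Fin n × Fin n) (MvPowerSeries (Fin 2) A) :=
  (1 ⊗ₖ genMat β 1) * yangSum n A ρ * (genMat β 0 ⊗ₖ 1) * yangDiff n A

/-- The free algebra on symbols `b_{ij}^{(s)}`, `s ≥ 0`. -/
abbrev FreeGen (n : ℕ) : Type := FreeAlgebra ℂ (Fin n × Fin n × ℕ)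

/-- The defining relations of the extended reflection algebra: `b_{ij}^{(0)} = δ_{ij} g°_{ii}`,
and all the coefficients of the reflection equation. -/
inductive ReflRel (n r : ℕ) (ρ : ℂ) : FreeGen n → FreeGen n → Prop
  | const (i j : Fin n) :
      ReflRel n r ρ (FreeAlgebra.ι ℂ (i, j, 0))
        (algebraMap ℂ (FreeGen n) (if i = j then gCirc n r i else 0))
  | refl (p q : Fin n × Fin n) (d : Fin 2 →₀ ℕ) :
      ReflRel n r ρ
        (MvPowerSeries.coeff d (reflLeft ρ (fun i j s => FreeAlgebra.ι ℂ (i, j, s)) p q))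
        (MvPowerSeries.coeff d (reflRight ρ (fun i j s => FreeAlgebra.ι ℂ (i, j, s)) p q))

/-- The extended `ρ`-shifted reflection algebra of `𝔤𝔩ₙ` with parameter `r`. -/
abbrev ExtReflAlg (n r : ℕ) (ρ : ℂ) : Type := RingQuot (ReflRel n r ρ)

/-- The generator `b_{ij}^{(s)}`. -/
def bGen (n r : ℕ) (ρ : ℂ) (i j : Fin n) (s : ℕ) : ExtReflAlg n r ρ :=
  RingQuot.mkAlgHom ℂ (ReflRel n r ρ) (FreeAlgebra.ι ℂ (i, j, s))

variable {n r : ℕ} {ρ : ℂ} {V : Type*} [AddCommGroup V] [Module ℂ V]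

/-- `ξ` is a lowest vector of weight `γ`, the `γ i` being power series in `v⁻¹`. -/
structure IsLowestVector (Φ : ExtReflAlg n r ρ →ₐ[ℂ] Module.End ℂ V) (ξ : V)
    (γ : Fin n → PowerSeries ℂ) : Prop where
  ne_zero : ξ ≠ 0
  lower : ∀ i j : Fin n, j < i → ∀ s : ℕ, Φ (bGen n r ρ i j s) ξ = 0
  diag : ∀ (i : Fin n) (s : ℕ), Φ (bGen n r ρ i i s) ξ = PowerSeries.coeff s (γ i) • ξ
  const : ∀ i : Fin n, PowerSeries.constantCoeff (γ i) = gCirc n r i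

/-- `V` is generated by `ξ`. -/
def IsCyclicVector (Φ : ExtReflAlg n r ρ →ₐ[ℂ] Module.End ℂ V) (ξ : V) : Prop :=
  ∀ x : V, ∃ a : ExtReflAlg n r ρ, Φ a ξ = x

end ReflectionAlgebra

/-! ### Formal series in `v⁻¹` -/

/-- The field `ℂ((v⁻¹))`; rational functions of `v` are expanded at `v = ∞`. -/
abbrev Ser : Type := LaurentSeries ℂ

/-- Constant series. -/
def cst : ℂ →+* Ser := HahnSeries.C

/-- The spectral parameter `v`. -/
def vv : Ser := HahnSeries.single (-1 : ℤ) (1 : ℂ)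

/-! ### Symmetric pairs and boundary matrices -/

/-- The symmetric pairs, with the parameters of the boundary matrix `K`.
`DIs` is DI with `n = p = q = 2`, `DIt` is DI with `n > 2`, `q = 2`, `p = 2n - 2`; in `CII s` and
`DI s` one has `q = 2s`, `p = 2n - 2s`; `C0` and `D0` are the symplectic and the orthogonal case of
CD0. -/
inductive Boundary : Type
  | CI (a : ℂ)
  | DIII (a : ℂ)
  | DIs (a b : ℂ)
  | DIt (a : ℂ)
  | CII (s : ℕ)
  | DI (s : ℕ)
  | C0
  | D0

namespace Boundary

/-- `true` for `𝔰𝔬₂ₙ` (upper signs), `false` for `𝔰𝔭₂ₙ` (lower signs). -/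
def orth : Boundary → Bool
  | CI _ => false
  | DIII _ => true
  | DIs _ _ => true
  | DIt _ => true
  | CII _ => false
  | DI _ => true
  | C0 => false
  | D0 => true

/-- The number `r`, equal to `q / 2 = n - p / 2` for CII and DI, and to `0` otherwise. -/
def r : Boundary → ℕ
  | CI _ => 0
  | DIII _ => 0
  | DIs _ _ => 1
  | DIt _ => 1
  | CII s => s
  | DI s => s
  | C0 => 0
  | D0 => 0

/-- The admissible values of `n` for each type. -/
def Valid (n : ℕ) : Boundary → Prop
  | CI _ => 1 ≤ n
  | DIII _ => 2 ≤ n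
  | DIs _ _ => n = 2
  | DIt _ => 2 < n
  | CII s => 1 ≤ s ∧ 2 * s ≤ n
  | DI s => 2 ≤ s ∧ 2 * s ≤ n
  | C0 => 1 ≤ n
  | D0 => 2 ≤ n

/-- The sign `±1`: `1` for `𝔰𝔬₂ₙ` and `-1` for `𝔰𝔭₂ₙ`. -/
def eps (bd : Boundary) : ℂ := if bd.orth then 1 else -1

/-- `κ = n ∓ 1`. -/
def kappa (n : ℕ) (bd : Boundary) : ℂ := n - bd.eps

end Boundary

/-- The index set `{1, …, 2n}`: `inl i` stands for `i` and `inr i` for `n + i`. -/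
abbrev Idx (n : ℕ) : Type := Fin n ⊕ Fin n

/-- The involution `i ↦ 2n - i + 1`. -/
def bar {n : ℕ} : Idx n → Idx n
  | .inl i => .inr i.rev
  | .inr i => .inl i.rev

namespace Boundary

variable (n : ℕ) (bd : Boundary)

/-- `θᵢ`. -/
def theta : Idx n → ℤ
  | .inl _ => if bd.orth then 1 else -1
  | .inr _ => 1

/-- The diagonal entries of `G`. -/
def gDiag : Idx n → ℂ :=
  match bd with
  | CI _ => Sum.elim (fun _ => 1) (fun _ => -1)
  | DIII _ => Sum.elim (fun _ => 1) (fun _ => -1)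
  | _ => Sum.elim (fun i => if (i : ℕ) < bd.r then -1 else 1)
      (fun i => if (i.rev : ℕ) < bd.r then -1 else 1)

/-- `d = (tr G) / 4`. -/
def dPar : ℂ := (∑ i, bd.gDiag n i) / 4

/-- The diagonal entries of `G(v + ρ/2)`, where `G(u) = (d I - u G) / (d - u)`. -/
def gFun (ρ : ℂ) (i : Idx n) : Ser :=
  (cst (bd.dPar n) - (vv + cst (ρ / 2)) * cst (bd.gDiag n i))
    / (cst (bd.dPar n) - (vv + cst (ρ / 2)))

/-- `ṽ = κ - v - ρ`. -/
def vTilde (ρ : ℂ) : Ser := cst (bd.kappa n) - vv - cst ρ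

/-- The scalar function `g(v)`. -/
def gScal (ρ : ℂ) : Ser :=
  match bd with
  | CI _ => 1
  | DIII _ => 1
  | _ => if 2 * bd.r = n then 2 * vv - cst (bd.kappa n) + cst bd.eps + cst ρ
      else (vv - bd.vTilde n ρ - cst (bd.kappa n)) / ∑ i, bd.gFun n ρ i

/-- The diagonal entries of the boundary matrix `K(v)`; all the matrices `K(v)` are diagonal. -/
def kDiag (ρ : ℂ) (i : Idx n) : Ser :=
  let x : Ser := vv + cst (ρ / 2)
  match bd with
  | CI a => cst (bd.gDiag n i) - cst a / x
  | DIII a => cst (bd.gDiag n i) - cst a / x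
  | DIs a b =>
      match i with
      | .inl j => if (j : ℕ) = 0 then -(1 - cst b / x) * (1 - cst a / x)
          else (1 - cst b / x) * (1 + cst a / x)
      | .inr j => if (j : ℕ) = 0 then (1 + cst b / x) * (1 - cst a / x)
          else -(1 + cst b / x) * (1 + cst a / x)
  | DIt a =>
      let y : Ser := x + cst (a - 2 * bd.dPar n)
      (x - cst a) * y / (x - cst (bd.dPar n)) ^ 2 *
        match i with
        | .inl j => if (j : ℕ) = 0 then 1 - 2 * x / (x - cst a) else 1
        | .inr j => if (j : ℕ) + 1 = n then 1 - 2 * x / y else 1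
  | _ => bd.gFun n ρ i

end Boundary

/-! ### Operators on tensor powers -/

/-- The matrix unit `e_{ab}` acting on the tensor factor `s` of `(ℂ^α)^{⊗ S}`. The basis of this
tensor power is indexed by the functions `S → α`. -/
def siteUnit {S α : Type*} [Fintype S] [DecidableEq S] [DecidableEq α] (R : Type*) [Zero R] [One R]
    (s : S) (a b : α) : Matrix (S → α) (S → α) R :=
  Matrix.of fun f g => if g s = b ∧ f = Function.update g s a then 1 else 0

section Bulk

variable (n : ℕ) (bd : Boundary)

/-- Zamolodchikov's `R_{ab}(z)`, `z ∈ ℂ`, on two factors of `(ℂ²ⁿ)^{⊗ k}`. -/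
def zamR {k : ℕ} (a b : Fin k) (z : ℂ) : Matrix (Fin k → Idx n) (Fin k → Idx n) ℂ :=
  1 - z⁻¹ • (∑ i : Idx n, ∑ j : Idx n, siteUnit ℂ a i j * siteUnit ℂ b j i)
    + (z - bd.kappa n)⁻¹ • (∑ i : Idx n, ∑ j : Idx n,
        (bd.theta n i * bd.theta n j) •
          (siteUnit ℂ a i j * siteUnit ℂ b (bar i) (bar j)))

/-- The fusion operator
`Π_k = (1/k!) ∏_{b = 2}^{k} (R_{1b}(∓(b-1)) R_{2b}(∓(b-2)) ⋯ R_{b-1,b}(∓1))`. -/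
def fusion (k : ℕ) : Matrix (Fin k → Idx n) (Fin k → Idx n) ℂ :=
  ((k.factorial : ℂ)⁻¹) •
    (List.ofFn fun b : Fin k =>
      (List.ofFn fun a : Fin (b : ℕ) =>
        zamR n bd (Fin.castLE b.isLt.le a) b (-bd.eps * ((b : ℂ) - (a : ℂ)))).prod).prod

/-- Zamolodchikov's `R_{0s}(z)` as a matrix in the auxiliary space `0`, its entries being operators
acting on the factor `s`. -/
def zamAux {S : Type*} [Fintype S] [DecidableEq S] (s : S) (z : Ser) :
    Matrix (Idx n) (Idx n) (Matrix (S → Idx n) (S → Idx n) Ser) :=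
  Matrix.of fun i j => (if i = j then 1 else 0) - z⁻¹ • siteUnit Ser s j i
    + (z - cst (bd.kappa n))⁻¹ • (bd.theta n i * bd.theta n j) •
        siteUnit Ser s (bar i) (bar j)

/-- The fused Lax operator `R_{01}(z) R_{02}(z ∓ 1) ⋯ R_{0k}(z ∓ (k-1))`, the factors `1, …, k`
being embedded in the family of all factors by `e`. -/
def fusedLax {S : Type*} [Fintype S] [DecidableEq S] (k : ℕ) (e : Fin k → S) (z : Ser) :
    Matrix (Idx n) (Idx n) (Matrix (S → Idx n) (S → Idx n) Ser) :=
  (List.ofFn fun j : Fin k => zamAux n bd (e j) (z - cst (bd.eps * (j : ℂ)))).prod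

/-- The transposition `(e_{ij})^t = θᵢθⱼ e_{2n-j+1, 2n-i+1}` of the auxiliary space. -/
def transp {A : Type*} [AddCommGroup A] (X : Matrix (Idx n) (Idx n) A) :
    Matrix (Idx n) (Idx n) A :=
  Matrix.of fun i j => (bd.theta n i * bd.theta n j) • X (bar j) (bar i)

/-- The subspace `L⁰ ⊂ L = Π_k (ℂ²ⁿ)^{⊗ k}` of vectors annihilated by `t_{n+p,l}(v)`, `1 ≤ p,l ≤ n`. -/
def vacuum (k : ℕ) (c : ℂ) : Set ((Fin k → Idx n) → ℂ) :=
  {ζ | ζ ∈ Set.range (fusion n bd k).mulVec ∧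
    ∀ p l : Fin n, (fusedLax n bd k id (vv - cst c) (Sum.inr p) (Sum.inl l)).mulVec
      (fun f => cst (ζ f)) = 0}

variable (ρ : ℂ) {ℓ : ℕ} (k : Fin ℓ → ℕ) (c : Fin ℓ → ℂ)

/-- Basis of `(ℂ²ⁿ)^{⊗ k₁} ⊗ ⋯ ⊗ (ℂ²ⁿ)^{⊗ k_ℓ}`. -/
abbrev BulkIdx : Type := (Σ i : Fin ℓ, Fin (k i)) → Idx n

/-- The monodromy matrix
`S(v) = g(v) ∏_{i=1}^{ℓ} 𝓛ᵢ(v - cᵢ - κ/2) K(v) ∏_{i=ℓ}^{1} 𝓛ᵢᵗ(ṽ - cᵢ - κ/2)`. -/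
def monodromy : Matrix (Idx n) (Idx n) (Matrix (BulkIdx n k) (BulkIdx n k) Ser) :=
  bd.gScal n ρ •
    ((List.ofFn fun i : Fin ℓ =>
        fusedLax n bd (k i) (fun j => (⟨i, j⟩ : Σ i : Fin ℓ, Fin (k i)))
          (vv - cst (c i) - cst (bd.kappa n / 2))).prod
      * Matrix.diagonal (fun a => bd.kDiag n ρ a • 1)
      * (List.ofFn fun i : Fin ℓ =>
          transp n bd (fusedLax n bd (k i) (fun j => (⟨i, j⟩ : Σ i : Fin ℓ, Fin (k i)))
            (bd.vTilde n ρ - cst (c i) - cst (bd.kappa n / 2)))).reverse.prod)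

end Bulk

section Nested

variable (n : ℕ) (bd : Boundary) (ρ : ℂ) {ℓ : ℕ} (k : Fin ℓ → ℕ) (c : Fin ℓ → ℂ)
  {m : ℕ} (u w : Fin m → ℂ)

/-- Basis of `W = ⨂_{i=1}^{m} (V_{ãᵢ} ⊗ V_{aᵢ})`, all the factors being `ℂⁿ`; the factor `ãᵢ` is
labelled by `inl i` and the factor `aᵢ` by `inr i`. -/
abbrev WIdx (m : ℕ) : Type := (Fin m ⊕ Fin m) → Fin n

/-- Basis of the ambient space of `M⁽¹⁾`. -/
abbrev TotIdx (m : ℕ) : Type := WIdx n m × BulkIdx n k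

/-- `Rᵗ_{sa}(z) = I - z⁻¹ Q` with `Q = ∑ e_{ij} ⊗ e_{n-i+1,n-j+1}`, as a matrix in the space `a`. -/
def yangT (s : Fin m ⊕ Fin m) (z : Ser) :
    Matrix (Fin n) (Fin n) (Matrix (TotIdx n k m) (TotIdx n k m) Ser) :=
  Matrix.of fun i j => (if i = j then 1 else 0)
    - z⁻¹ • (siteUnit Ser s i.rev j.rev ⊗ₖ (1 : Matrix (BulkIdx n k) (BulkIdx n k) Ser))

/-- The upper left block `A(v)` of `S(v)`, acting on `W ⊗ M` as the identity on `W`. -/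
def blockA (m : ℕ) : Matrix (Fin n) (Fin n) (Matrix (TotIdx n k m) (TotIdx n k m) Ser) :=
  Matrix.of fun i j => (1 : Matrix (WIdx n m) (WIdx n m) Ser) ⊗ₖ
    monodromy n bd ρ k c (Sum.inl i) (Sum.inl j)

/-- The generalised nested monodromy matrix `S⁽¹⁾(v; w, u)`; here `x̃ = κ - x - ρ`. -/
def nestedMonodromy : Matrix (Fin n) (Fin n) (Matrix (TotIdx n k m) (TotIdx n k m) Ser) :=
  (List.ofFn fun i : Fin m => yangT n k (Sum.inl i) (cst (u i) - vv)).prod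
    * (List.ofFn fun i : Fin m => yangT n k (Sum.inr i) (cst (w i) - vv)).prod
    * blockA n bd ρ k c m
    * (List.ofFn fun i : Fin m => yangT n k (Sum.inr i)
        (cst (bd.kappa n - w i - ρ) - vv + cst bd.eps)).reverse.prod
    * (List.ofFn fun i : Fin m => yangT n k (Sum.inl i)
        (cst (bd.kappa n - u i - ρ) - vv + cst bd.eps)).reverse.prod

/-- The nested vacuum sector `M⁽¹⁾ = W ⊗ L⁰₁ ⊗ ⋯ ⊗ L⁰_ℓ` (the one-dimensional boundary space is
omitted), as the span of the decomposable tensors. -/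
def nestedVacuum (m : ℕ) : Submodule ℂ (TotIdx n k m → ℂ) :=
  Submodule.span ℂ {x | ∃ (ω : WIdx n m → ℂ) (ζ : ∀ i : Fin ℓ, (Fin (k i) → Idx n) → ℂ),
    (∀ i, ζ i ∈ vacuum n bd (k i) (c i)) ∧
    x = fun q => ω q.1 * ∏ i, ζ i (fun j => q.2 ⟨i, j⟩)}

/-- `Φ` is the representation `B°(v) ↦ g(v)⁻¹ S⁽¹⁾(v; w, u)`, that is,
`S⁽¹⁾_{ij}(v; w, u) x = g(v) ∑ₛ v⁻ˢ Φ(b_{ij}^{(s)}) x` on `M⁽¹⁾`. -/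
def IsNestedAction
    (Φ : ExtReflAlg n bd.r ρ →ₐ[ℂ] Module.End ℂ (nestedVacuum n bd k c m)) : Prop :=
  ∀ (i j : Fin n) (x : nestedVacuum n bd k c m),
    (nestedMonodromy n bd ρ k c u w i j).mulVec (fun q => cst (x.1 q)) =
      fun q => bd.gScal n ρ * HahnSeries.ofPowerSeries ℤ ℂ
        (PowerSeries.mk fun s => (Φ (bGen n bd.r ρ i j s) x).1 q)

/-- `μ̃ᵢ(v) = (2v + ρ - i + 1) μᵢ(v) + ∑_{j<i} μⱼ(v)`; indices start at `0` here. -/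
def tildeW {n : ℕ} (ρ : ℂ) (μ : Fin n → Ser) (i : Fin n) : Ser :=
  (2 * vv + cst ρ - ((i : ℕ) : Ser)) * μ i + ∑ j ∈ Finset.univ.filter (· < i), μ j

/-- The components of the bulk weight: `(k, 0, …, 0)` for `𝔰𝔬₂ₙ` and `(1, …, 1, 0, …, 0)` with `k`
ones for `𝔰𝔭₂ₙ`; indices start at `0` here. -/
def bulkWt (k : ℕ) (j : ℕ) : ℂ :=
  if bd.orth then (if j = 0 then k else 0) else (if j < k then 1 else 0)

/-- `λⱼ(x) λ̄ⱼ(y)` for one bulk space. -/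
def bulkFactor (k : ℕ) (c : ℂ) (j : Fin n) (x y : Ser) : Ser :=
  (1 - cst (bulkWt bd k j) / (x - cst c)) *
    (1 + cst (bulkWt bd k j) / (y - cst c - cst (bd.eps * ((k : ℂ) - 1)) - cst (bd.kappa n)))

/-- `(v - z + 1) / (v - z)`. -/
def auxFactor (z : ℂ) : Ser := (vv - cst z + 1) / (vv - cst z)

/-- The lowest weight component `γ̃ⱼ(v; w, u)`. -/
def nestedWeight (j : Fin n) : Ser :=
  bd.gScal n ρ * tildeW ρ (fun i => bd.kDiag n ρ (Sum.inl i)) j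
    * (if (j : ℕ) + 1 = n then
        ∏ i, (auxFactor (u i) * auxFactor (w i)
          * auxFactor (bd.kappa n - w i - ρ + bd.eps)
          * auxFactor (bd.kappa n - u i - ρ + bd.eps))
      else 1)
    * ∏ i, bulkFactor n bd (k i) (c i) j (vv - cst (bd.kappa n / 2))
        (bd.vTilde n ρ - cst (bd.kappa n / 2))

end Nested

end NestedChain

end

/-! The nested monodromy matrix is, on the vacuum sector, a chain of Lax matrices for `𝔤𝔩ₙ` around a
diagonal boundary matrix. Everything then follows from three properties of a single site: its
generators `x` satisfy the `𝔤𝔩ₙ` commutation relations, satisfy a quadratic equation `x² = e x + q`,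
and have a common lowest vector.

Reduction to a chain. By `mem_vacuum_iff` the vacuum space of a bulk factor is `Symᵏ ℂⁿ` (orthogonal
case) or `Λᵏ ℂⁿ` (symplectic case), built on the upper half of the basis; it does not depend on `c`.
One inclusion uses the fact that the image of the fusion operator is traceless and symmetric up to
sign (Yang–Baxter, `fusion_adjacent`) and that the leading coefficient of the lower left entries is
the action of lower left Lie algebra elements. On such tensors the product of `k` one-site Lax
matrices collapses to one matrix `1 - x/(v - a)` (`lax_prod_mul_of_symm`), and its transpose to `1 -
x/(v + h)`. Each `Rᵗ` on `W` is already a Lax matrix for the dual of `ℂⁿ`. These facts are assembled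
in `nestedGen_mul` and `nestedMonodromy_mulVec`.

Reflection equation. The upper block of every boundary matrix is a scalar series times `x G° + α`
with `x = v + ρ/2`, and this solves the reflection equation because `(G°)² = 1`. A site dresses a
solution to a solution (`reflection_dress`): the commutation relations give the RTT relations, and
the quadratic equation gives the crossing relation between the left and the right Lax matrix,
provided `h = ρ + a + e` (`crossing_of_quadratic`). The shifts produced by the monodromy matrix are
exactly these.

Lowest weight. Dressing preserves the lowest vector and changes the diagonal eigenvalues by a
triangular transformation. The transform `γ ↦ γ̃` makes this transformation diagonal, with factor
`(1 - α wt)(1 - β wt)`; the cancellation is the quadratic equation evaluated on the lowest vector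
(`tildeGen_dress`, `laxProd_lowest`).

Generic cyclicity. Being a cyclic vector is the non-vanishing of a determinant
(`exists_ne_zero_cyclicFam`), so one good choice of parameters suffices. Letting the parameters tend
to infinity is the same as multiplying the generators by a small number. To first order the chain is
then a sum over the sites with coefficients given by powers of the parameters, and a Vandermonde
argument isolates every individual site operator (`exists_params_cyclicFam`). The site operators
together generate the whole tensor product from the lowest vector (`symTensors_le_of_stable`). -/

open scoped Kronecker

noncomputable section

namespace NestedChain

/-! ### RTT, crossing and reflection relations in an abstract algebra. -/

section AbstractReflection

variable {Z 𝓜 : Type*} [CommRing Z] [Ring 𝓜] [Algebra Z 𝓜]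

/-- The relation `R(u - v) L₁(u) L₂(v) = L₂(v) L₁(u) R(u - v)` for `L = 1 - α x`. -/
theorem rtt_of_comm {P x y : 𝓜} {D N α α' : Z} (hPx : P * x = y * P) (hPy : P * y = x * P)
    (hxy : y * x = x * y + (x - y) * P) (h : N * (α - α') = -(D * (α * α'))) :
    (D • (1 : 𝓜) - N • P) * ((1 - α • x) * (1 - α' • y)) =
      ((1 - α' • y) * (1 - α • x)) * (D • (1 : 𝓜) - N • P) := by
  have e1 : P * (x * y) = y * x * P := by rw [← mul_assoc, hPx, mul_assoc, hPy, mul_assoc]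
  simp only [sub_mul, mul_sub, smul_mul_assoc, mul_smul_comm, one_mul, mul_one, smul_sub,
    smul_smul, hPx, hPy, e1, hxy, smul_add, add_mul]
  -- With every `P` moved to the right, the two sides differ only in the coefficients of `x * P` and
  -- `y * P`, and `h` is the equality of these coefficients.
  linear_combination (norm := module) h • (y * P) - h • (x * P)

/-- The relation `L̃₁(u) R(u + v + ρ) L₂(v) = L₂(v) R(u + v + ρ) L̃₁(u)` for `L = 1 - α x`,
`L̃ = 1 - β x`, where `x` satisfies a quadratic equation. -/
theorem crossing_of_quadratic {P x y : 𝓜} {E N α β e k : Z} (hPx : P * x = y * P)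
    (hPy : P * y = x * P) (hxy : y * x = x * y + (x - y) * P)
    (hx : x * x = e • x + k • 1) (hy : y * y = e • y + k • 1)
    (h : N * (α + β - e * (α * β)) = E * (α * β)) :
    (1 - β • x) * (E • (1 : 𝓜) - N • P) * (1 - α • y) =
      (1 - α • y) * (E • (1 : 𝓜) - N • P) * (1 - β • x) := by
  -- The terms with `P` between two generators are `x P y = x² P` and `y P x = y² P`. The quadratic
  -- equation brings them back to `x P`, `y P` and `P`, and the two multiples of `P` cancel.
  have e1 : x * P * y = e • (x * P) + k • P := by
    rw [mul_assoc, hPy, ← mul_assoc, hx, add_mul, smul_mul_assoc, smul_mul_assoc, one_mul]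
  have e2 : y * P * x = e • (y * P) + k • P := by
    rw [mul_assoc, hPx, ← mul_assoc, hy, add_mul, smul_mul_assoc, smul_mul_assoc, one_mul]
  simp only [sub_mul, mul_sub, smul_mul_assoc, mul_smul_comm, one_mul, mul_one, smul_sub,
    smul_smul, hPx, hPy, e1, e2, hxy, smul_add]
  linear_combination (norm := module) h • (x * P) - h • (y * P)

/-- Dressing a solution of the reflection equation. -/
theorem reflection_dress {R₁ R₂ B B' L L' M M' : 𝓜}
    (hB : R₁ * B * R₂ * B' = B' * R₂ * B * R₁)
    (hL : R₁ * (L * L') = (L' * L) * R₁) (hM : R₁ * (M * M') = (M' * M) * R₁)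
    (h1 : M * R₂ * L' = L' * R₂ * M) (h2 : L * R₂ * M' = M' * R₂ * L)
    (c1 : Commute B L') (c2 : Commute M B') (c3 : Commute L B') (c4 : Commute B M') :
    R₁ * (L * B * M) * R₂ * (L' * B' * M') = (L' * B' * M') * R₂ * (L * B * M) * R₁ := by
  -- The crossing relation `h1` exchanges `M` and `L'`; then the RTT relations apply to the outer
  -- pairs and the equation for `B` to the middle, and `h2` restores the order.
  calc R₁ * (L * B * M) * R₂ * (L' * B' * M')
      = R₁ * L * B * (M * R₂ * L') * B' * M' := by noncomm_ring
    _ = R₁ * L * (B * L') * R₂ * (M * B') * M' := by rw [h1]; noncomm_ring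
    _ = (R₁ * (L * L')) * B * R₂ * B' * (M * M') := by rw [c1.eq, c2.eq]; noncomm_ring
    _ = L' * L * (R₁ * B * R₂ * B') * (M * M') := by rw [hL]; noncomm_ring
    _ = L' * (L * B') * R₂ * B * (R₁ * (M * M')) := by rw [hB]; noncomm_ring
    _ = L' * B' * L * R₂ * (B * M') * M * R₁ := by rw [c3.eq, hM]; noncomm_ring
    _ = L' * B' * (L * R₂ * M') * B * M * R₁ := by rw [c4.eq]; noncomm_ring
    _ = _ := by rw [h2]; noncomm_ring

end AbstractReflection

/-! ### The two embeddings of matrices over a noncommutative ring into the tensor square. -/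

section TensorSquare

variable {n : ℕ} {A : Type*} [Ring A]

/-- `X₁ = X ⊗ 1` for a matrix over a not necessarily commutative ring. -/
def inFst (X : Matrix (Fin n) (Fin n) A) : Matrix (Fin n × Fin n) (Fin n × Fin n) A := X ⊗ₖ 1

/-- `X₂ = 1 ⊗ X` for a matrix over a not necessarily commutative ring. -/
def inSnd (X : Matrix (Fin n) (Fin n) A) : Matrix (Fin n × Fin n) (Fin n × Fin n) A := 1 ⊗ₖ X

theorem inFst_apply (X : Matrix (Fin n) (Fin n) A) (p q : Fin n × Fin n) :
    inFst X p q = if p.2 = q.2 then X p.1 q.1 else 0 := by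
  simp [inFst, Matrix.kroneckerMap_apply, Matrix.one_apply]

theorem inSnd_apply (X : Matrix (Fin n) (Fin n) A) (p q : Fin n × Fin n) :
    inSnd X p q = if p.1 = q.1 then X p.2 q.2 else 0 := by
  simp [inSnd, Matrix.kroneckerMap_apply, Matrix.one_apply]

/-- The mixed product rule for Kronecker products fails over a noncommutative ring; it survives here
because the second factor is the identity. -/
theorem inFst_mul (X Y : Matrix (Fin n) (Fin n) A) : inFst (X * Y) = inFst X * inFst Y := by
  ext ⟨i, k⟩ ⟨j, l⟩
  simp only [inFst_apply, Matrix.mul_apply, Fintype.sum_prod_type, ite_mul, mul_ite, zero_mul,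
    mul_zero]
  by_cases h : k = l <;> simp [h]

theorem inSnd_mul (X Y : Matrix (Fin n) (Fin n) A) : inSnd (X * Y) = inSnd X * inSnd Y := by
  ext ⟨i, k⟩ ⟨j, l⟩
  simp only [inSnd_apply, Matrix.mul_apply, Fintype.sum_prod_type_right, ite_mul, mul_ite,
    zero_mul, mul_zero]
  by_cases h : i = j <;> simp [h]

theorem inFst_one : inFst (1 : Matrix (Fin n) (Fin n) A) = 1 := by
  ext ⟨i, k⟩ ⟨j, l⟩
  simp only [inFst_apply, Matrix.one_apply, Prod.mk.injEq, ite_and]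
  split_ifs <;> rfl

theorem inSnd_one : inSnd (1 : Matrix (Fin n) (Fin n) A) = 1 := by
  ext ⟨i, k⟩ ⟨j, l⟩
  simp only [inSnd_apply, Matrix.one_apply, Prod.mk.injEq, ite_and]

theorem inFst_sub (X Y : Matrix (Fin n) (Fin n) A) : inFst (X - Y) = inFst X - inFst Y := by
  ext; simp only [inFst_apply, Matrix.sub_apply]; split_ifs <;> simp

theorem inSnd_sub (X Y : Matrix (Fin n) (Fin n) A) : inSnd (X - Y) = inSnd X - inSnd Y := by
  ext; simp only [inSnd_apply, Matrix.sub_apply]; split_ifs <;> simp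

theorem inFst_add (X Y : Matrix (Fin n) (Fin n) A) : inFst (X + Y) = inFst X + inFst Y := by
  ext; simp only [inFst_apply, Matrix.add_apply]; split_ifs <;> simp

theorem inSnd_add (X Y : Matrix (Fin n) (Fin n) A) : inSnd (X + Y) = inSnd X + inSnd Y := by
  ext; simp only [inSnd_apply, Matrix.add_apply]; split_ifs <;> simp

theorem inFst_smul {Z : Type*} [CommRing Z] [Algebra Z A] (c : Z) (X : Matrix (Fin n) (Fin n) A) :
    inFst (c • X) = c • inFst X := by
  ext; simp only [inFst_apply, Matrix.smul_apply]; split_ifs <;> simp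

theorem inSnd_smul {Z : Type*} [CommRing Z] [Algebra Z A] (c : Z) (X : Matrix (Fin n) (Fin n) A) :
    inSnd (c • X) = c • inSnd X := by
  ext; simp only [inSnd_apply, Matrix.smul_apply]; split_ifs <;> simp

theorem permMat_mul_apply (Y : Matrix (Fin n × Fin n) (Fin n × Fin n) A) (p q : Fin n × Fin n) :
    (permMat n A * Y) p q = Y p.swap q := by
  rw [Matrix.mul_apply, Finset.sum_eq_single p.swap]
  · simp [permMat]
  · rintro b - hb
    rw [permMat, Matrix.of_apply, if_neg, zero_mul]
    rintro ⟨h1, h2⟩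
    exact hb (Prod.ext h2.symm h1.symm)
  · simp

theorem mul_permMat_apply (Y : Matrix (Fin n × Fin n) (Fin n × Fin n) A) (p q : Fin n × Fin n) :
    (Y * permMat n A) p q = Y p q.swap := by
  rw [Matrix.mul_apply, Finset.sum_eq_single q.swap]
  · simp [permMat]
  · rintro b - hb
    rw [permMat, Matrix.of_apply, if_neg, mul_zero]
    rintro ⟨h1, h2⟩
    exact hb (Prod.ext h1 h2)
  · simp

theorem permMat_inFst (X : Matrix (Fin n) (Fin n) A) :
    permMat n A * inFst X = inSnd X * permMat n A := by
  ext p q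
  simp [permMat_mul_apply, mul_permMat_apply, inFst_apply, inSnd_apply]

theorem permMat_inSnd (X : Matrix (Fin n) (Fin n) A) :
    permMat n A * inSnd X = inFst X * permMat n A := by
  ext p q
  simp [permMat_mul_apply, mul_permMat_apply, inFst_apply, inSnd_apply]

/-- All the entries of `X` commute with all the entries of `Y`. -/
def EntryComm (X Y : Matrix (Fin n) (Fin n) A) : Prop := ∀ i j k l, Commute (X i j) (Y k l)

namespace EntryComm

variable {X Y X' : Matrix (Fin n) (Fin n) A}

theorem symm (h : EntryComm X Y) : EntryComm Y X := fun i j k l => (h k l i j).symm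

/-- The entries are themselves operators, so acting on different auxiliary spaces is not enough for
commutation. -/
theorem commute (h : EntryComm X Y) : Commute (inFst X) (inSnd Y) := by
  ext ⟨i, k⟩ ⟨j, l⟩
  simp only [inFst_apply, inSnd_apply, Matrix.mul_apply, Fintype.sum_prod_type, ite_mul, mul_ite,
    zero_mul, mul_zero]
  simp [(h i j k l).eq]

theorem mul_left (h : EntryComm X Y) (h' : EntryComm X' Y) : EntryComm (X * X') Y := by
  intro i j k l
  rw [Matrix.mul_apply]
  exact Commute.sum_left _ _ _ fun a _ => (h i a k l).mul_left (h' a j k l)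

theorem one_left : EntryComm 1 Y := by
  intro i j k l
  rw [Matrix.one_apply]
  split_ifs
  · exact Commute.one_left _
  · exact Commute.zero_left _

theorem sub_left (h : EntryComm X Y) (h' : EntryComm X' Y) : EntryComm (X - X') Y :=
  fun i j k l => (h i j k l).sub_left (h' i j k l)

theorem smul_left {Z : Type*} [CommRing Z] [Algebra Z A] (c : Z) (h : EntryComm X Y) :
    EntryComm (c • X) Y := fun i j k l => (h i j k l).smul_left c

theorem diagonal_left {Z : Type*} [CommRing Z] [Algebra Z A] (c : Fin n → Z) :
    EntryComm (Matrix.diagonal fun i => c i • (1 : A)) Y := by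
  intro i j k l
  rw [Matrix.diagonal_apply]
  split_ifs
  · exact (Commute.one_left _).smul_left _
  · exact Commute.zero_left _

theorem list_prod_left {l : List (Matrix (Fin n) (Fin n) A)} (h : ∀ X ∈ l, EntryComm X Y) :
    EntryComm l.prod Y := by
  induction l with
  | nil => exact one_left
  | cons a l ih =>
    rw [List.prod_cons]
    exact (h a (by simp)).mul_left (ih fun X hX => h X (by simp [hX]))

end EntryComm

end TensorSquare

/-! ### Chains of Lax matrices and the reflection equation. -/

section Chain

variable {n : ℕ}

/-- The product `∏ L · K · ∏ L̃`, the last product being in the opposite order. -/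
def chain {ι A : Type*} [Ring A] (l : List ι) (L M : ι → Matrix (Fin n) (Fin n) A)
    (K : Matrix (Fin n) (Fin n) A) : Matrix (Fin n) (Fin n) A :=
  (l.map L).prod * K * (l.map M).reverse.prod

theorem chain_cons {ι A : Type*} [Ring A] (s : ι) (l : List ι)
    (L M : ι → Matrix (Fin n) (Fin n) A) (K : Matrix (Fin n) (Fin n) A) :
    chain (s :: l) L M K = L s * chain l L M K * M s := by
  simp [chain, mul_assoc]

/-- The matrix `1 - α x`. -/
def lax {Z A : Type*} [CommRing Z] [Ring A] [Algebra Z A] (α : Z) (x : Matrix (Fin n) (Fin n) A) :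
    Matrix (Fin n) (Fin n) A := 1 - α • x

/-- The defining relations of `𝔤𝔩ₙ`, in the convention `x_{ij} = E_{ji}`, together with a quadratic
equation for the matrix of generators. -/
structure IsSite {Z A : Type*} [CommRing Z] [Ring A] [Algebra Z A]
    (x : Matrix (Fin n) (Fin n) A) (e q : Z) : Prop where
  comm : ∀ i j k l, x k l * x i j =
    x i j * x k l + ((if k = j then x i l else 0) - if i = l then x k j else 0)
  quad : x * x = e • x + q • 1

section Reflection

variable {Z A : Type*} [CommRing Z] [Ring A] [Algebra Z A]

/-- The `𝔤𝔩ₙ` brackets in the matrix form that the abstract RTT and crossing relations take as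
input. -/
theorem IsSite.inSnd_mul_inFst {x : Matrix (Fin n) (Fin n) A} {e q : Z} (h : IsSite x e q) :
    inSnd x * inFst x = inFst x * inSnd x + (inFst x - inSnd x) * permMat n A := by
  ext ⟨i, k⟩ ⟨j, l⟩
  rw [Matrix.add_apply, mul_permMat_apply]
  simp only [Matrix.sub_apply, inFst_apply, inSnd_apply,
    Matrix.mul_apply, Fintype.sum_prod_type, ite_mul, mul_ite, zero_mul, mul_zero, Prod.swap]
  simpa using h.comm i j k l

theorem IsSite.inFst_quad {x : Matrix (Fin n) (Fin n) A} {e q : Z} (h : IsSite x e q) :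
    inFst x * inFst x = e • inFst x + q • 1 := by
  rw [← inFst_mul, h.quad, inFst_add, inFst_smul, inFst_smul, inFst_one]

theorem IsSite.inSnd_quad {x : Matrix (Fin n) (Fin n) A} {e q : Z} (h : IsSite x e q) :
    inSnd x * inSnd x = e • inSnd x + q • 1 := by
  rw [← inSnd_mul, h.quad, inSnd_add, inSnd_smul, inSnd_smul, inSnd_one]

theorem inFst_lax (α : Z) (x : Matrix (Fin n) (Fin n) A) : inFst (lax α x) = 1 - α • inFst x := by
  rw [lax, inFst_sub, inFst_one, inFst_smul]

theorem inSnd_lax (α : Z) (x : Matrix (Fin n) (Fin n) A) : inSnd (lax α x) = 1 - α • inSnd x := by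
  rw [lax, inSnd_sub, inSnd_one, inSnd_smul]

theorem EntryComm.lax {x y : Matrix (Fin n) (Fin n) A} (h : EntryComm x y) (α β : Z) :
    EntryComm (lax α x) (NestedChain.lax β y) :=
  one_left.sub_left (smul_left _ (one_left.sub_left (smul_left _ h.symm)).symm)

/-- A chain of Lax matrices dressing a solution of the reflection equation is again a solution. -/
theorem reflection_chain {ι : Type*} {l : List ι} (hl : l.Nodup)
    (x : ι → Matrix (Fin n) (Fin n) A) (e q α α' β β' : ι → Z) (D E N : Z)
    (hx : ∀ s, IsSite (x s) (e s) (q s))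
    (hxx : ∀ s t, s ≠ t → EntryComm (x s) (x t))
    (hα : ∀ s, N * (α s - α' s) = -(D * (α s * α' s)))
    (hβ : ∀ s, N * (β s - β' s) = -(D * (β s * β' s)))
    (hαβ : ∀ s, N * (α' s + β s - e s * (α' s * β s)) = E * (α' s * β s))
    (hβα : ∀ s, N * (β' s + α s - e s * (β' s * α s)) = E * (β' s * α s))
    (k k' : Fin n → Z)
    (hk : ∀ i j, D * (k i * k' i - k j * k' j) + E * (k j * k' i - k' j * k i) = 0) :
    (D • 1 - N • permMat n A) *
        inFst (chain l (fun s => lax (α s) (x s)) (fun s => lax (β s) (x s))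
          (Matrix.diagonal fun i => k i • (1 : A))) *
        (E • 1 - N • permMat n A) *
        inSnd (chain l (fun s => lax (α' s) (x s)) (fun s => lax (β' s) (x s))
          (Matrix.diagonal fun i => k' i • (1 : A))) =
      inSnd (chain l (fun s => lax (α' s) (x s)) (fun s => lax (β' s) (x s))
          (Matrix.diagonal fun i => k' i • (1 : A))) *
        (E • 1 - N • permMat n A) *
        inFst (chain l (fun s => lax (α s) (x s)) (fun s => lax (β s) (x s))
          (Matrix.diagonal fun i => k i • (1 : A))) *
        (D • 1 - N • permMat n A) := by
  induction l with
  | nil =>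
    simp only [chain, List.map_nil, List.prod_nil, List.reverse_nil, one_mul, mul_one]
    set K := Matrix.diagonal fun i => k i • (1 : A)
    set K' := Matrix.diagonal fun i => k' i • (1 : A)
    have c1 : inFst K * inSnd K' = inSnd K' * inFst K := (EntryComm.diagonal_left _).commute
    have c2 : inSnd K * inSnd K' = inSnd K' * inSnd K := by
      rw [← inSnd_mul, ← inSnd_mul]; congr 1
      simp [K, K', Matrix.diagonal_mul_diagonal, smul_smul, mul_comm]
    -- In the expanded equation the terms free of `N` and those with `N²` agree. The terms linear in
    -- `N` are diagonal matrices times `P`; equating the diagonal matrices gives this identity,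
    -- which is `hk` entry by entry.
    have e0 : (D • inFst K * inFst K' + E • inSnd K * inFst K') =
        E • inSnd K' * inFst K + D • inSnd K' * inSnd K := by
      ext ⟨i, a⟩ ⟨j, b⟩
      simp only [Matrix.add_apply, smul_mul_assoc, Matrix.smul_apply, inFst_apply, inSnd_apply,
        Matrix.mul_apply, Fintype.sum_prod_type, ite_mul, mul_ite, zero_mul, mul_zero, K, K',
        Matrix.diagonal_apply]
      by_cases hij : i = j <;> by_cases hab : a = b <;>
        simp [hij, hab, smul_smul]
      linear_combination (norm := module) hk j b • (1 : A)
    have p1 := permMat_inFst (A := A) (n := n)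
    have p2 := permMat_inSnd (A := A) (n := n)
    have e1 : inFst K * (permMat n A * inSnd K') = inFst K * inFst K' * permMat n A := by
      rw [p2, mul_assoc]
    have e2 : permMat n A * inFst K * inSnd K' = inSnd K * inFst K' * permMat n A := by
      rw [p1, mul_assoc, p2, mul_assoc]
    have e3 : permMat n A * inFst K * (permMat n A * inSnd K') =
        inSnd K' * permMat n A * inFst K * permMat n A := by
      rw [p1, p2, mul_assoc, ← mul_assoc (permMat n A) (inFst K'), p1, mul_assoc (inSnd K'),
        mul_assoc (inSnd K'), p1, ← mul_assoc, ← mul_assoc, c2]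
      simp only [mul_assoc]
    have e4 : inSnd K' * permMat n A * inFst K = inSnd K' * inSnd K * permMat n A := by
      rw [mul_assoc, p1, mul_assoc]
    have f : ((D • inFst K * inFst K' + E • inSnd K * inFst K') * permMat n A) =
        (E • inSnd K' * inFst K + D • inSnd K' * inSnd K) * permMat n A := by rw [e0]
    simp only [add_mul, smul_mul_assoc, mul_assoc, c1] at f e1 e2 e3 e4
    rw [e1] at e3
    simp only [sub_mul, mul_sub, smul_mul_assoc, mul_smul_comm, one_mul, mul_one, smul_sub,
      smul_smul, mul_assoc]
    simp only [e1, e2, e3, e4, c1]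
    linear_combination (norm := module) (-N) • f
  | cons s l ih =>
    have hs : s ∉ l := (List.nodup_cons.1 hl).1
    have hP := permMat_inFst (x s)
    have hP' := permMat_inSnd (x s)
    have hxy := (hx s).inSnd_mul_inFst
    -- As `s` does not occur in `l`, the inner chain involves only generators of other sites.
    have key : ∀ (a : Z) (b c : ι → Z) (k : Fin n → Z), EntryComm
        (chain l (fun s => lax (b s) (x s)) (fun s => lax (c s) (x s))
          (Matrix.diagonal fun i => k i • (1 : A))) (lax a (x s)) := by
      intro a b c k
      have : ∀ t ∈ l, s ≠ t := fun t ht h => hs (h ▸ ht)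
      refine ((EntryComm.list_prod_left ?_).mul_left (EntryComm.diagonal_left _)).mul_left
        (EntryComm.list_prod_left ?_)
      · simp only [List.mem_map]
        rintro _ ⟨t, ht, rfl⟩
        exact ((hxx s t (this t ht)).symm.lax _ _)
      · simp only [List.mem_reverse, List.mem_map]
        rintro _ ⟨t, ht, rfl⟩
        exact ((hxx s t (this t ht)).symm.lax _ _)
    simp only [chain_cons, inFst_mul, inSnd_mul]
    refine reflection_dress (ih (List.nodup_cons.1 hl).2) ?_ ?_ ?_ ?_ (key _ _ _ _).commute
      (key _ _ _ _).symm.commute (key _ _ _ _).symm.commute (key _ _ _ _).commute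
    · simp only [inFst_lax, inSnd_lax]
      exact rtt_of_comm hP hP' hxy (hα s)
    · simp only [inFst_lax, inSnd_lax]
      exact rtt_of_comm hP hP' hxy (hβ s)
    · simp only [inFst_lax, inSnd_lax]
      exact crossing_of_quadratic hP hP' hxy (hx s).inFst_quad (hx s).inSnd_quad (hαβ s)
    · simp only [inFst_lax, inSnd_lax]
      exact crossing_of_quadratic hP hP' hxy (hx s).inFst_quad (hx s).inSnd_quad (hβα s)

end Reflection

end Chain

/-! ### Chains as power series in `v⁻¹`, and the reflection equation for their coefficients. -/

section PowerSeriesChain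

open PowerSeries

/-- The expansion of `1 / (v - a)` in `X = v⁻¹`. -/
def geo {R : Type*} [CommRing R] (a : R) : R⟦X⟧ := X * mk fun s => a ^ s

theorem mk_pow_mul {R : Type*} [CommRing R] (a : R) :
    (mk fun s => a ^ s) * (1 - C a * X) = 1 := by
  ext s
  rw [mul_sub, mul_one, ← mul_assoc, map_sub]
  cases s with
  | zero => simp
  | succ s => simp [coeff_succ_mul_X, coeff_mul_C, pow_succ, coeff_one]

theorem geo_mul {R : Type*} [CommRing R] (a : R) : geo a * (1 - C a * X) = X := by
  rw [geo, mul_assoc, mk_pow_mul, mul_one]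

theorem map_geo {R R' : Type*} [CommRing R] [CommRing R'] (f : R →+* R') (a : R) :
    PowerSeries.map f (geo a) = geo (f a) := by
  rw [geo, geo, map_mul, map_X]
  congr 1
  ext s
  simp

theorem coeff_zero_geo {R : Type*} [CommRing R] (a : R) : coeff 0 (geo a) = 0 := by
  simp [geo]

theorem coeff_succ_geo {R : Type*} [CommRing R] (a : R) (s : ℕ) :
    coeff (s + 1) (geo a) = a ^ s := by
  rw [geo, coeff_succ_X_mul, coeff_mk]

variable {n : ℕ} {D : Type*} [Fintype D] [DecidableEq D]

/-- Extension of scalars for matrices whose entries are matrices. -/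
def extScal {R R' : Type*} [CommRing R] [CommRing R'] (f : R →+* R') :
    Matrix (Fin n) (Fin n) (Matrix D D R) →+* Matrix (Fin n) (Fin n) (Matrix D D R') :=
  (f.mapMatrix : Matrix D D R →+* Matrix D D R').mapMatrix

theorem extScal_apply {R R' : Type*} [CommRing R] [CommRing R'] (f : R →+* R')
    (x : Matrix (Fin n) (Fin n) (Matrix D D R)) (i j : Fin n) (a b : D) :
    extScal f x i j a b = f (x i j a b) := rfl

theorem map_chain {ι A A' : Type*} [Ring A] [Ring A']
    (φ : Matrix (Fin n) (Fin n) A →+* Matrix (Fin n) (Fin n) A') (l : List ι)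
    (L M : ι → Matrix (Fin n) (Fin n) A) (K : Matrix (Fin n) (Fin n) A) :
    φ (chain l L M K) = chain l (fun s => φ (L s)) (fun s => φ (M s)) (φ K) := by
  simp only [chain, map_mul, map_list_prod, List.map_map, List.map_reverse]
  rfl

theorem extScal_lax {R R' : Type*} [CommRing R] [CommRing R'] (f : R →+* R') (α : R)
    (x : Matrix (Fin n) (Fin n) (Matrix D D R)) :
    extScal f (lax α x) = lax (f α) (extScal f x) := by
  rw [lax, lax, map_sub, map_one]
  congr 1
  ext
  simp [extScal_apply]

theorem extScal_diagonal {R R' : Type*} [CommRing R] [CommRing R'] (f : R →+* R')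
    (k : Fin n → R) :
    extScal (D := D) f (Matrix.diagonal fun i => k i • 1) =
      Matrix.diagonal fun i => f (k i) • 1 := by
  ext i j a b
  rw [extScal_apply, Matrix.diagonal_apply, Matrix.diagonal_apply]
  split_ifs
  · simp only [Matrix.smul_apply, Matrix.one_apply]
    split_ifs <;> simp
  · simp

theorem extScal_extScal {R R' R'' : Type*} [CommRing R] [CommRing R'] [CommRing R'']
    (f : R →+* R') (g : R' →+* R'') (x : Matrix (Fin n) (Fin n) (Matrix D D R)) :
    extScal g (extScal f x) = extScal (g.comp f) x := rfl

theorem IsSite.extScal {R R' : Type*} [CommRing R] [CommRing R'] (f : R →+* R')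
    {x : Matrix (Fin n) (Fin n) (Matrix D D R)} {e q : R} (h : IsSite x e q) :
    IsSite (NestedChain.extScal f x) (f e) (f q) where
  comm i j k l := by
    have := congrArg (f.mapMatrix : Matrix D D R →+* Matrix D D R') (h.comm i j k l)
    simp only [map_add, map_sub, map_mul, apply_ite (f.mapMatrix : Matrix D D R →+* Matrix D D R'),
      map_zero] at this
    exact this
  quad := by
    rw [← map_mul, h.quad, map_add]
    congr 1 <;> ext i j a b <;>
      simp [NestedChain.extScal_apply, Matrix.one_apply, apply_ite f,
        apply_ite (fun M : Matrix D D R => M a b), apply_ite (fun M : Matrix D D R' => M a b)]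

theorem EntryComm.extScal {R R' : Type*} [CommRing R] [CommRing R'] (f : R →+* R')
    {x y : Matrix (Fin n) (Fin n) (Matrix D D R)} (h : EntryComm x y) :
    EntryComm (NestedChain.extScal f x) (NestedChain.extScal f y) := by
  intro i j k l
  exact (h i j k l).map (f.mapMatrix : Matrix D D R →+* Matrix D D R')

/-- The chain of Lax matrices `1 - α x`, the diagonal matrix `k` and the Lax matrices `1 - β x`. -/
def laxProd {ι Z : Type*} [CommRing Z] (l : List ι) (x : ι → Matrix (Fin n) (Fin n) (Matrix D D Z))
    (α β : ι → Z) (k : Fin n → Z) : Matrix (Fin n) (Fin n) (Matrix D D Z) :=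
  chain l (fun s => lax (α s) (x s)) (fun s => lax (β s) (x s)) (Matrix.diagonal fun i => k i • 1)

theorem extScal_laxProd {ι R R' : Type*} [CommRing R] [CommRing R'] (f : R →+* R') (l : List ι)
    (x : ι → Matrix (Fin n) (Fin n) (Matrix D D R)) (α β : ι → R) (k : Fin n → R) :
    extScal f (laxProd l x α β k) = laxProd l (fun s => extScal f (x s)) (fun s => f (α s))
      (fun s => f (β s)) (fun i => f (k i)) := by
  rw [laxProd, laxProd, map_chain, extScal_diagonal]
  simp only [extScal_lax]

/-- The chain of Lax matrices `1 - x / (v - a)`, the diagonal matrix `k` and the Lax matrices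
`1 - x / (v + h)`, expanded in `v⁻¹`. -/
def laxChain {ι R : Type*} [CommRing R] (l : List ι) (x : ι → Matrix (Fin n) (Fin n) (Matrix D D R))
    (a h : ι → R) (k : Fin n → R⟦X⟧) : Matrix (Fin n) (Fin n) (Matrix D D R⟦X⟧) :=
  laxProd l (fun s => extScal C (x s)) (fun s => geo (a s)) (fun s => geo (-h s)) k

theorem extScal_laxChain {ι R R' : Type*} [CommRing R] [CommRing R'] (f : R →+* R') (l : List ι)
    (x : ι → Matrix (Fin n) (Fin n) (Matrix D D R)) (a h : ι → R) (k : Fin n → R⟦X⟧) :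
    extScal (PowerSeries.map f) (laxChain l x a h k) =
      laxChain l (fun s => extScal f (x s)) (fun s => f (a s)) (fun s => f (h s))
        (fun i => PowerSeries.map f (k i)) := by
  have e : (PowerSeries.map f).comp C = (C (R := R')).comp f := by
    ext r : 1; simp
  rw [laxChain, laxChain, extScal_laxProd]
  simp only [map_geo, extScal_extScal, e, map_neg]

/-- The inclusion of the power series in `X_t`. -/
def inVar (t : Fin 2) : ℂ⟦X⟧ →+* MvPowerSeries (Fin 2) ℂ :=
  (MvPowerSeries.rename (R := ℂ) (⟨fun _ : Unit => t, fun _ _ _ => rfl⟩ : Unit ↪ Fin 2)).toRingHom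

theorem inVar_X (t : Fin 2) : inVar t X = MvPowerSeries.X t :=
  MvPowerSeries.rename_X _ _

theorem inVar_C (t : Fin 2) (r : ℂ) : inVar t (C r) = MvPowerSeries.C r :=
  MvPowerSeries.rename_C _ _

theorem coeff_inVar (t : Fin 2) (f : ℂ⟦X⟧) (d : Fin 2 →₀ ℕ) :
    MvPowerSeries.coeff d (inVar t f) = if d = Finsupp.single t (d t) then coeff (d t) f else 0 := by
  set e : Unit ↪ Fin 2 := ⟨fun _ : Unit => t, fun _ _ _ => rfl⟩ with he
  split_ifs with h
  · have : d = Finsupp.embDomain e (Finsupp.single () (d t)) := by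
      rw [Finsupp.embDomain_single]; exact h
    conv_lhs => rw [this]
    exact MvPowerSeries.coeff_embDomain_rename e f _
  · refine MvPowerSeries.coeff_rename_eq_zero e f ?_
    rintro ⟨y, rfl⟩
    apply h
    have : y = Finsupp.single () (y ()) := by ext; simp
    rw [this, Finsupp.mapDomain_single]
    change Finsupp.single t _ = Finsupp.single t (Finsupp.single t _ t)
    rw [Finsupp.single_eq_same]

/-- A power series with matrix coefficients as a matrix of power series. -/
def matOfSeries {σ : Type*} :
    MvPowerSeries σ (Matrix D D ℂ) →+* Matrix D D (MvPowerSeries σ ℂ) where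
  toFun f := Matrix.of fun a b => fun d => MvPowerSeries.coeff d f a b
  map_one' := by
    classical
    ext a b d
    change (MvPowerSeries.coeff d (1 : MvPowerSeries σ (Matrix D D ℂ))) a b = _
    rw [MvPowerSeries.coeff_one, Matrix.one_apply]
    by_cases h : a = b <;> by_cases h' : d = 0 <;>
      simp [h, h', MvPowerSeries.coeff_one, Matrix.one_apply]
  map_zero' := rfl
  map_add' f g := rfl
  map_mul' f g := by
    classical
    ext a b d
    change (MvPowerSeries.coeff d (f * g)) a b = _
    rw [MvPowerSeries.coeff_mul, Matrix.sum_apply, Matrix.mul_apply, map_sum]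
    simp only [MvPowerSeries.coeff_mul, Matrix.mul_apply]
    rw [Finset.sum_comm]
    rfl

theorem matOfSeries_apply {σ : Type*} (f : MvPowerSeries σ (Matrix D D ℂ)) (a b : D) (d : σ →₀ ℕ) :
    MvPowerSeries.coeff d (matOfSeries f a b) = MvPowerSeries.coeff d f a b := rfl

theorem matOfSeries_injective {σ : Type*} :
    Function.Injective (matOfSeries : MvPowerSeries σ (Matrix D D ℂ) → _) := by
  intro f g h
  ext d a b
  rw [← matOfSeries_apply, h, matOfSeries_apply]

theorem matOfSeries_X {σ : Type*} (t : σ) :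
    matOfSeries (D := D) (MvPowerSeries.X t) = (MvPowerSeries.X t : MvPowerSeries σ ℂ) • 1 := by
  classical
  ext a b d
  rw [matOfSeries_apply, MvPowerSeries.coeff_X, Matrix.smul_apply, Matrix.one_apply]
  by_cases h : a = b <;> by_cases h' : d = Finsupp.single t 1 <;>
    simp [h, h', MvPowerSeries.coeff_X, Matrix.one_apply]

theorem matOfSeries_C {σ : Type*} (r : ℂ) :
    matOfSeries (D := D) (σ := σ) (MvPowerSeries.C (algebraMap ℂ (Matrix D D ℂ) r)) =
      (MvPowerSeries.C r : MvPowerSeries σ ℂ) • 1 := by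
  classical
  ext a b d
  rw [matOfSeries_apply, MvPowerSeries.coeff_C, Matrix.smul_apply, Matrix.one_apply]
  by_cases h : a = b <;> by_cases h' : d = 0 <;>
    simp [h, h', MvPowerSeries.coeff_C, Matrix.algebraMap_matrix_apply]

/-- The coefficient of `v⁻ˢ` of the entry `(i, j)`. -/
def coeffMat {R : Type*} [CommRing R] (B : Matrix (Fin n) (Fin n) (Matrix D D R⟦X⟧))
    (i j : Fin n) (s : ℕ) : Matrix D D R :=
  Matrix.of fun a b => coeff s (B i j a b)

variable (n) in
theorem mapMatrix_permMat {A A' : Type*} [Ring A] [Ring A'] (φ : A →+* A') :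
    φ.mapMatrix (permMat n A) = permMat n A' := by
  ext p q
  simp only [RingHom.mapMatrix_apply, Matrix.map_apply, permMat, Matrix.of_apply]
  split_ifs <;> simp

theorem mapMatrix_inFst {A A' : Type*} [Ring A] [Ring A'] (φ : A →+* A')
    (X : Matrix (Fin n) (Fin n) A) : φ.mapMatrix (inFst X) = inFst (φ.mapMatrix X) := by
  ext p q
  simp only [RingHom.mapMatrix_apply, Matrix.map_apply, inFst_apply]
  split_ifs <;> simp

theorem mapMatrix_inSnd {A A' : Type*} [Ring A] [Ring A'] (φ : A →+* A')
    (X : Matrix (Fin n) (Fin n) A) : φ.mapMatrix (inSnd X) = inSnd (φ.mapMatrix X) := by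
  ext p q
  simp only [RingHom.mapMatrix_apply, Matrix.map_apply, inSnd_apply]
  split_ifs <;> simp

theorem mapMatrix_smul_one {A A' Z : Type*} [Ring A] [Ring A'] [CommRing Z] [Algebra Z A']
    (φ : A →+* A') (c : A) (z : Z) (h : φ c = z • 1)
    (Y : Matrix (Fin n × Fin n) (Fin n × Fin n) A) :
    φ.mapMatrix (c • Y) = z • φ.mapMatrix Y := by
  ext p q
  simp [h]

/-- Bridge between the two readings of a generating series: series with operator coefficients, as in
the defining relations, and operators with entries in a commutative ring of series, where the
scalars of `reflection_chain` live. -/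
theorem mapMatrix_matOfSeries_genMat (B : Matrix (Fin n) (Fin n) (Matrix D D ℂ⟦X⟧)) (t : Fin 2) :
    (matOfSeries (D := D)).mapMatrix (genMat (coeffMat B) t) = extScal (inVar t) B := by
  ext i j a b d
  rw [extScal_apply, coeff_inVar]
  change (MvPowerSeries.coeff d (genMat (coeffMat B) t i j)) a b = _
  change (if d = Finsupp.single t (d t) then coeffMat B i j (d t) else 0) a b = _
  split_ifs <;> rfl

theorem mapMatrix_yangDiff : (matOfSeries (D := D)).mapMatrix (yangDiff n (Matrix D D ℂ)) =
    ((MvPowerSeries.X 1 - MvPowerSeries.X 0 : MvPowerSeries (Fin 2) ℂ)) • 1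
      - ((MvPowerSeries.X 0 * MvPowerSeries.X 1 : MvPowerSeries (Fin 2) ℂ)) • permMat n _ := by
  rw [yangDiff, map_sub]
  refine congrArg₂ (· - ·) ((mapMatrix_smul_one _ _
    (MvPowerSeries.X 1 - MvPowerSeries.X 0 : MvPowerSeries (Fin 2) ℂ) ?_ _).trans ?_)
    ((mapMatrix_smul_one _ _
    (MvPowerSeries.X 0 * MvPowerSeries.X 1 : MvPowerSeries (Fin 2) ℂ) ?_ _).trans ?_)
  · rw [map_sub, matOfSeries_X, matOfSeries_X, sub_smul]
  · rw [map_one]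
  · rw [map_mul, matOfSeries_X, matOfSeries_X, smul_mul_smul_comm, one_mul]
  · rw [mapMatrix_permMat]

theorem mapMatrix_yangSum (ρ : ℂ) :
    (matOfSeries (D := D)).mapMatrix (yangSum n (Matrix D D ℂ) ρ) =
    ((MvPowerSeries.X 0 + MvPowerSeries.X 1
      + MvPowerSeries.C ρ * (MvPowerSeries.X 0 * MvPowerSeries.X 1) :
        MvPowerSeries (Fin 2) ℂ)) • 1
      - ((MvPowerSeries.X 0 * MvPowerSeries.X 1 : MvPowerSeries (Fin 2) ℂ)) • permMat n _ := by
  have e : matOfSeries (D := D)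
      (MvPowerSeries.X 0 * MvPowerSeries.X 1 : MvPowerSeries (Fin 2) (Matrix D D ℂ)) =
      (MvPowerSeries.X 0 * MvPowerSeries.X 1 : MvPowerSeries (Fin 2) ℂ) • 1 := by
    rw [map_mul, matOfSeries_X, matOfSeries_X, smul_mul_smul_comm, one_mul]
  rw [yangSum, map_sub]
  refine congrArg₂ (· - ·) ((mapMatrix_smul_one _ _ (MvPowerSeries.X 0 + MvPowerSeries.X 1
    + MvPowerSeries.C ρ * (MvPowerSeries.X 0 * MvPowerSeries.X 1) : MvPowerSeries (Fin 2) ℂ)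
    ?_ _).trans ?_)
    ((mapMatrix_smul_one _ _ _ e _).trans ?_)
  · rw [map_add, map_add, map_mul, e, matOfSeries_X, matOfSeries_X, matOfSeries_C,
      smul_mul_smul_comm, one_mul, add_smul, add_smul]
  · rw [map_one]
  · rw [mapMatrix_permMat]

/-- The coefficients of a chain of Lax matrices satisfy the reflection equation. -/
theorem reflLeft_laxChain {ι : Type*} {l : List ι} (hl : l.Nodup)
    (x : ι → Matrix (Fin n) (Fin n) (Matrix D D ℂ)) (e q a : ι → ℂ) (ρ : ℂ)
    (hx : ∀ s, IsSite (x s) (e s) (q s)) (hxx : ∀ s t, s ≠ t → EntryComm (x s) (x t))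
    (g : Fin n → ℂ) (hg : ∀ i, g i = 1 ∨ g i = -1) (α : ℂ) (ψ : ℂ⟦X⟧) :
    let B := laxChain l x a (fun s => ρ + a s + e s)
      (fun i => ψ * (C (g i) * (1 + C (ρ / 2) * X) + C α * X))
    reflLeft ρ (coeffMat B) = reflRight ρ (coeffMat B) := by
  intro B
  apply Matrix.map_injective (matOfSeries_injective (D := D))
  change (matOfSeries (D := D)).mapMatrix _ = (matOfSeries (D := D)).mapMatrix _
  have hB : ∀ t, extScal (inVar t) B = chain l
      (fun s => lax (inVar t (geo (a s))) (extScal MvPowerSeries.C (x s)))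
      (fun s => lax (inVar t (geo (-(ρ + a s + e s)))) (extScal MvPowerSeries.C (x s)))
      (Matrix.diagonal fun i =>
        inVar t (ψ * (C (g i) * (1 + C (ρ / 2) * X) + C α * X)) • 1) := by
    intro t
    have e : (inVar t).comp C = MvPowerSeries.C := RingHom.ext fun r => inVar_C t r
    simp only [B, laxChain, extScal_laxProd, extScal_extScal, e]
    rfl
  have e1 : genMat (coeffMat B) 0 ⊗ₖ (1 : Matrix (Fin n) (Fin n)
      (MvPowerSeries (Fin 2) (Matrix D D ℂ))) = inFst (genMat (coeffMat B) 0) := rfl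
  have e2 : (1 : Matrix (Fin n) (Fin n) (MvPowerSeries (Fin 2) (Matrix D D ℂ))) ⊗ₖ
      genMat (coeffMat B) 1 = inSnd (genMat (coeffMat B) 1) := rfl
  rw [reflLeft, reflRight, e1, e2]
  simp only [map_mul, mapMatrix_inFst, mapMatrix_inSnd, mapMatrix_matOfSeries_genMat,
    mapMatrix_yangDiff, mapMatrix_yangSum, hB]
  have hgeo : ∀ (t : Fin 2) (b : ℂ), inVar t (geo b) * (1 - MvPowerSeries.C b * MvPowerSeries.X t) =
      MvPowerSeries.X t := by
    intro t b
    have := congrArg (inVar t) (geo_mul b)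
    simpa [inVar_X, inVar_C] using this
  -- With `α = 1/(u - a)`, `α' = 1/(v - a)` and `β = 1/(u + ρ + a + e)`, the scalar conditions say
  -- `1/α - 1/α' = u - v` and `1/α' + 1/β - e = u + v + ρ`, multiplied by `u⁻¹ v⁻¹`. The second one
  -- dictates the shift `ρ + a + e`.
  refine reflection_chain hl _ (fun s => MvPowerSeries.C (e s)) (fun s => MvPowerSeries.C (q s))
    _ _ _ _ _ _ _ (fun s => (hx s).extScal _) (fun s t h => (hxx s t h).extScal _)
    ?_ ?_ ?_ ?_ _ _ ?_
  · intro s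
    linear_combination (-inVar 0 (geo (a s)) * MvPowerSeries.X 0) * (hgeo 1 (a s)) +
      (inVar 1 (geo (a s)) * MvPowerSeries.X 1) * (hgeo 0 (a s))
  · intro s
    linear_combination (-inVar 0 (geo (-(ρ + a s + e s))) * MvPowerSeries.X 0) *
      (hgeo 1 (-(ρ + a s + e s))) +
      (inVar 1 (geo (-(ρ + a s + e s))) * MvPowerSeries.X 1) * (hgeo 0 (-(ρ + a s + e s)))
  · intro s
    have h0 := hgeo 0 (-(ρ + a s + e s))
    have h1 := hgeo 1 (a s)
    generalize inVar 0 (geo (-(ρ + a s + e s))) = b0 at *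
    generalize inVar 1 (geo (a s)) = a1 at *
    simp only [map_neg, map_add] at h0
    linear_combination (-b0 * MvPowerSeries.X 0 ) * h1
      - (a1 * MvPowerSeries.X 1) * h0
  · intro s
    have h0 := hgeo 1 (-(ρ + a s + e s))
    have h1 := hgeo 0 (a s)
    generalize inVar 1 (geo (-(ρ + a s + e s))) = b0 at *
    generalize inVar 0 (geo (a s)) = a1 at *
    simp only [map_neg, map_add] at h0
    linear_combination (-b0 * MvPowerSeries.X 1) * h1
      - (a1 * MvPowerSeries.X 0) * h0
  -- Put `x = u + ρ/2`, `y = v + ρ/2`. Up to a common factor and because `gᵢ² = gⱼ² = 1`, the two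
  -- brackets are `α (gᵢ - gⱼ)(x + y)` and `-α (gᵢ - gⱼ)(x - y)`, while `u - v = x - y` and `u + v +
  -- ρ = x + y`.
  · intro i j
    have hC : (MvPowerSeries.C ρ : MvPowerSeries (Fin 2) ℂ) = 2 * MvPowerSeries.C (ρ / 2) := by
      rw [show (2 : MvPowerSeries (Fin 2) ℂ) = MvPowerSeries.C 2 from (map_ofNat _ 2).symm,
        ← map_mul, mul_div_cancel₀ _ two_ne_zero]
    simp only [map_mul, map_add, map_one, inVar_C, inVar_X, hC]
    rcases hg i with hi | hi <;> rcases hg j with hj | hj <;> rw [hi, hj] <;>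
      simp only [map_one, map_neg] <;> ring

end PowerSeriesChain

/-! ### From solutions of the reflection equation to representations. -/

section Representation

variable {n r : ℕ} {ρ : ℂ}

/-- Both sides of the reflection equation are natural in the coefficient algebra; this transports
the universal relations of the free algebra to a concrete algebra of operators. -/
theorem mapMatrix_reflection {A A' : Type*} [Ring A] [Ring A'] [Algebra ℂ A] [Algebra ℂ A']
    (f : A →ₐ[ℂ] A') (ρ : ℂ) (β : Fin n → Fin n → ℕ → A) :
    (MvPowerSeries.map (σ := Fin 2) (f : A →+* A')).mapMatrix (reflLeft ρ β) =
        reflLeft ρ (fun i j s => f (β i j s)) ∧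
      (MvPowerSeries.map (σ := Fin 2) (f : A →+* A')).mapMatrix (reflRight ρ β) =
        reflRight ρ (fun i j s => f (β i j s)) := by
  set φ := MvPowerSeries.map (σ := Fin 2) (f : A →+* A') with hφ
  have hsm : ∀ (c : MvPowerSeries (Fin 2) A)
      (Y : Matrix (Fin n × Fin n) (Fin n × Fin n) (MvPowerSeries (Fin 2) A)),
      φ.mapMatrix (c • Y) = φ c • φ.mapMatrix Y := by
    intro c Y
    ext1 p q
    simp [RingHom.mapMatrix_apply]
  have hX : ∀ t, φ (MvPowerSeries.X t) = MvPowerSeries.X t := fun t => MvPowerSeries.map_X _ t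
  have h1 : φ.mapMatrix (yangDiff n A) = yangDiff n A' := by
    rw [yangDiff, yangDiff, map_sub]
    refine congrArg₂ (· - ·) ((hsm _ _).trans ?_) ((hsm _ _).trans ?_)
    · rw [map_one, map_sub, hX, hX]
    · rw [mapMatrix_permMat, map_mul, hX, hX]
  have h2 : φ.mapMatrix (yangSum n A ρ) = yangSum n A' ρ := by
    rw [yangSum, yangSum, map_sub]
    refine congrArg₂ (· - ·) ((hsm _ _).trans ?_) ((hsm _ _).trans ?_)
    · rw [map_one, map_add, map_add, map_mul, map_mul, hX, hX, hφ, MvPowerSeries.map_C]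
      simp
    · rw [mapMatrix_permMat, map_mul, hX, hX]
  have h3 : ∀ t, φ.mapMatrix (genMat β t) = genMat (fun i j s => f (β i j s)) t := by
    intro t
    ext i j d
    change f (if d = Finsupp.single t (d t) then β i j (d t) else 0) =
      if d = Finsupp.single t (d t) then f (β i j (d t)) else 0
    split_ifs <;> simp
  constructor
  · change φ.mapMatrix (yangDiff n A * inFst (genMat β 0) * yangSum n A ρ * inSnd (genMat β 1)) =
      yangDiff n A' * inFst (genMat _ 0) * yangSum n A' ρ * inSnd (genMat _ 1)
    simp only [map_mul, h1, h2, h3, mapMatrix_inFst, mapMatrix_inSnd]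
  · change φ.mapMatrix (inSnd (genMat β 1) * yangSum n A ρ * inFst (genMat β 0) * yangDiff n A) =
      inSnd (genMat _ 1) * yangSum n A' ρ * inFst (genMat _ 0) * yangDiff n A'
    simp only [map_mul, h1, h2, h3, mapMatrix_inFst, mapMatrix_inSnd]

/-- A solution of the reflection equation defines a representation of the reflection algebra. -/
theorem exists_representation {A : Type*} [Ring A] [Algebra ℂ A] (β : Fin n → Fin n → ℕ → A)
    (h0 : ∀ i j, β i j 0 = algebraMap ℂ A (if i = j then gCirc n r i else 0))
    (hβ : reflLeft ρ β = reflRight ρ β) :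
    ∃ Φ : ExtReflAlg n r ρ →ₐ[ℂ] A, ∀ i j s, Φ (bGen n r ρ i j s) = β i j s := by
  set f : FreeGen n →ₐ[ℂ] A := FreeAlgebra.lift ℂ fun t => β t.1 t.2.1 t.2.2 with hf
  have hfι : ∀ t, f (FreeAlgebra.ι ℂ t) = β t.1 t.2.1 t.2.2 := fun t => by
    rw [hf, FreeAlgebra.lift_ι_apply]
  have hrel : ∀ ⦃x y : FreeGen n⦄, ReflRel n r ρ x y → f x = f y := by
    intro x y hxy
    induction hxy with
    | const i j => rw [hfι, h0, f.commutes]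
    | refl p q d =>
      have h1 := (mapMatrix_reflection f ρ (fun i j s => FreeAlgebra.ι ℂ (i, j, s))).1
      have h2 := (mapMatrix_reflection f ρ (fun i j s => FreeAlgebra.ι ℂ (i, j, s))).2
      simp only [hfι] at h1 h2
      rw [hβ, ← h2] at h1
      exact congrArg (MvPowerSeries.coeff d) (congrFun (congrFun h1 p) q)
  refine ⟨RingQuot.liftAlgHom ℂ ⟨f, hrel⟩, fun i j s => ?_⟩
  rw [bGen, RingQuot.liftAlgHom_mkAlgHom_apply, hfι]

end Representation

/-! ### The lowest weight of a chain. -/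

section LowestWeight

variable {n : ℕ} {Z : Type*} [CommRing Z]

/-- The transform `f ↦ (W - j U) f_j + U ∑_{a<j} f_a`. -/
def tildeGen (W U : Z) (f : Fin n → Z) (j : Fin n) : Z :=
  (W - (j : ℕ) * U) * f j + U * ∑ a ∈ Finset.Iio j, f a

/-- Dressing by one site acts on diagonal eigenvalues by a triangular matrix, and the tilde
transform diagonalises it. After interchanging the double sum, the coefficient of each `f a` with `a
< j` vanishes by `h` and by the difference of the quadratic equations for the weights at `a` and at
`j`, in which `q` drops out. The intended values are `U = v⁻¹` and `W = 2 + ρ v⁻¹`. -/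
theorem tildeGen_dress {W U α β e q : Z} (h : U * (α + β) = α * β * (W + e * U)) (wt : Fin n → Z)
    (hwt : ∀ j, wt j ^ 2 + ∑ b ∈ Finset.Iio j, (wt b - wt j) - e * wt j = q) (f : Fin n → Z)
    (j : Fin n) :
    tildeGen W U (fun j => (1 - α * wt j) * (1 - β * wt j) * f j +
        α * β * ∑ a ∈ Finset.Iio j, (wt a - wt j) * f a) j =
      (1 - α * wt j) * (1 - β * wt j) * tildeGen W U f j := by
  have hswap : ∑ a ∈ Finset.Iio j, ∑ b ∈ Finset.Iio a, (wt b - wt a) * f b =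
      ∑ a ∈ Finset.Iio j, (∑ b ∈ Finset.Ioo a j, (wt a - wt b)) * f a := by
    simp only [Finset.sum_mul]
    refine Finset.sum_comm' fun x y => ?_
    simp only [Finset.mem_Iio, Finset.mem_Ioo]
    exact ⟨fun h => ⟨⟨h.2, h.1⟩, h.2.trans h.1⟩, fun h => ⟨h.1.2, h.1.1⟩⟩
  -- The total coefficient of `f a` in the difference of the two sides.
  have hcoef : ∀ a ∈ Finset.Iio j,
      (W - (j : ℕ) * U) * (α * β) * (wt a - wt j) +
        U * ((1 - α * wt a) * (1 - β * wt a) - (1 - α * wt j) * (1 - β * wt j)) +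
        U * (α * β) * ∑ b ∈ Finset.Ioo a j, (wt a - wt b) = 0 := by
    intro a ha
    have haj := Finset.mem_Iio.1 ha
    have hsplit : ∑ b ∈ Finset.Iio j, wt b =
        ∑ b ∈ Finset.Iio a, wt b + wt a + ∑ b ∈ Finset.Ioo a j, wt b := by
      have : Finset.Iio j = insert a (Finset.Iio a ∪ Finset.Ioo a j) := by
        ext b
        simp only [Finset.mem_Iio, Finset.mem_insert, Finset.mem_union, Finset.mem_Ioo]
        grind
      rw [this, Finset.sum_insert (by simp), Finset.sum_union]
      · ring
      · rw [Finset.disjoint_left]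
        intro b
        simp only [Finset.mem_Iio, Finset.mem_Ioo]
        grind
    have h1 := hwt a
    have h2 := hwt j
    have hc : ((j - a - 1 : ℕ) : Z) = (j : ℕ) - (a : ℕ) - 1 := by
      have : (a : ℕ) < j := haj
      rw [Nat.sub_sub, Nat.cast_sub this]
      push_cast; ring
    simp only [Finset.sum_sub_distrib, Finset.sum_const, Fin.card_Iio, Fin.card_Ioo, nsmul_eq_mul,
      hc] at h1 h2 ⊢
    linear_combination (wt j - wt a) * h + α * β * U * (h1 - h2) + α * β * U * hsplit
  have hsum : (W - (j : ℕ) * U) * (α * β) * ∑ a ∈ Finset.Iio j, (wt a - wt j) * f a +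
      U * (∑ a ∈ Finset.Iio j, (1 - α * wt a) * (1 - β * wt a) * f a -
        (1 - α * wt j) * (1 - β * wt j) * ∑ a ∈ Finset.Iio j, f a) +
      U * (α * β) * ∑ a ∈ Finset.Iio j, (∑ b ∈ Finset.Ioo a j, (wt a - wt b)) * f a = 0 := by
    rw [← Finset.sum_eq_zero fun a ha => congrArg (· * f a) (hcoef a ha) |>.trans (zero_mul _)]
    simp only [Finset.mul_sum, ← Finset.sum_sub_distrib, ← Finset.sum_add_distrib]
    refine Finset.sum_congr rfl fun a _ => ?_
    rw [Finset.sum_mul, Finset.mul_sum, add_mul, Finset.sum_mul, ← sub_eq_zero]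
    simp only [mul_assoc, add_sub_add_right_eq_sub]
    ring
  simp only [tildeGen, Finset.sum_add_distrib, ← Finset.mul_sum]
  rw [hswap]
  linear_combination hsum

variable {D : Type*} [Fintype D] [DecidableEq D]

/-- Let `B` be the inner chain and `L`, `M` the two Lax matrices of the new site, whose entries
commute with those of `B`. In `L i a * B a b * M b j` applied to `ξ`, the factor `B a b` can be
moved to the right if `b < a`, where it kills `ξ`, and to the left if `a ≤ b`. In the second case `L
i a * M b j` with `j ≤ i` gives a multiple of `ξ`, non-zero only if `a = b` and `i = j`, so that
only diagonal entries of `B` contribute. -/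
theorem laxProd_lowest {ι : Type*} {l : List ι} (hl : l.Nodup)
    (x : ι → Matrix (Fin n) (Fin n) (Matrix D D Z)) (e q α β : ι → Z)
    (hx : ∀ s, IsSite (x s) (e s) (q s)) (hxx : ∀ s t, s ≠ t → EntryComm (x s) (x t))
    {ξ : D → Z} {wt : ι → Fin n → Z} (hlow : ∀ s i j, j < i → (x s i j).mulVec ξ = 0)
    (hdiag : ∀ s j, (x s j j).mulVec ξ = wt s j • ξ)
    (hwt : ∀ s j, wt s j ^ 2 + ∑ b ∈ Finset.Iio j, (wt s b - wt s j) - e s * wt s j = q s)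
    {W U : Z} (hαβ : ∀ s, U * (α s + β s) = α s * β s * (W + e s * U)) (k : Fin n → Z) :
    ∃ γ : Fin n → Z,
      (∀ i j, j < i → (laxProd l x α β k i j).mulVec ξ = 0) ∧
      (∀ j, (laxProd l x α β k j j).mulVec ξ = γ j • ξ) ∧
      ∀ j, tildeGen W U γ j = tildeGen W U k j *
        (l.map fun s => (1 - α s * wt s j) * (1 - β s * wt s j)).prod := by
  simp only [laxProd]
  induction l with
  | nil =>
    refine ⟨k, fun i j hij => ?_, fun j => ?_, fun j => by simp⟩
    · simp [chain, hij.ne']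
    · simp [chain, Matrix.smul_mulVec]
  | cons s l ih =>
    obtain ⟨γ, h1, h2, h3⟩ := ih (List.nodup_cons.1 hl).2
    have hs : s ∉ l := (List.nodup_cons.1 hl).1
    set B := chain l (fun s => lax (α s) (x s)) (fun s => lax (β s) (x s))
        (Matrix.diagonal fun i => k i • (1 : Matrix D D Z)) with hB
    have key : ∀ a : Z, EntryComm (lax a (x s)) B := by
      intro a
      have : ∀ t ∈ l, s ≠ t := fun t ht h => hs (h ▸ ht)
      refine EntryComm.symm (((EntryComm.list_prod_left ?_).mul_left
        (EntryComm.diagonal_left k)).mul_left (EntryComm.list_prod_left ?_))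
      · simp only [List.mem_map]
        rintro _ ⟨t, ht, rfl⟩
        exact ((hxx s t (this t ht)).symm.lax _ _)
      · simp only [List.mem_reverse, List.mem_map]
        rintro _ ⟨t, ht, rfl⟩
        exact ((hxx s t (this t ht)).symm.lax _ _)
    have lapp : ∀ (c : Z) (i j : Fin n) (v : D → Z), (lax c (x s) i j).mulVec v =
        (if i = j then v else 0) - c • (x s i j).mulVec v := by
      intro c i j v
      rw [lax, Matrix.sub_apply, Matrix.smul_apply, Matrix.sub_mulVec, Matrix.smul_mulVec,
        Matrix.one_apply]
      split_ifs <;> simp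
    have hdl : ∀ i j, j ≤ i → (x s i j).mulVec ξ = if i = j then wt s j • ξ else 0 := by
      intro i j hij
      split_ifs with h
      · rw [h, hdiag]
      · exact hlow s i j (lt_of_le_of_ne hij (Ne.symm h))
    have hLM : ∀ i j a b, j ≤ i → a ≤ b → (lax (α s) (x s) i a).mulVec
        ((lax (β s) (x s) b j).mulVec ξ) = (if a = b ∧ i = j ∧ a ≤ j then
          (if a = j then (1 - α s * wt s j) * (1 - β s * wt s j)
            else α s * β s * (wt s a - wt s j)) else 0) • ξ := by
      intro i j a b hij hab
      rcases lt_or_ge j b with hjb | hbj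
      · have : (lax (β s) (x s) b j).mulVec ξ = 0 := by
          rw [lapp, hlow s b j hjb, if_neg hjb.ne', smul_zero, sub_zero]
        rw [this, Matrix.mulVec_zero, if_neg, zero_smul]
        rintro ⟨rfl, -, h⟩
        exact absurd hjb (not_lt.2 h)
      -- Here `a ≤ b ≤ j ≤ i`. If `a = i`, all four indices coincide; otherwise `x i a` kills `ξ`,
      -- so the product of the two generators can be replaced by their commutator.
      · rcases eq_or_lt_of_le ((hab.trans hbj).trans hij) with rfl | hai
        · obtain rfl : a = b := le_antisymm hab (hbj.trans hij)
          obtain rfl : j = a := le_antisymm hij hbj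
          simp only [lapp, hdiag, if_true, Matrix.mulVec_sub, Matrix.mulVec_smul, le_refl, and_self]
          module
        · have e1 : (x s i a).mulVec ((x s b j).mulVec ξ) =
              (if i = j ∧ a = b then wt s a else 0) • ξ -
                (if a = b ∧ i = j then wt s j else 0) • ξ := by
            have := (hx s).comm b j i a
            rw [Matrix.mulVec_mulVec, this, Matrix.add_mulVec, Matrix.sub_mulVec,
              ← Matrix.mulVec_mulVec, hlow s i a hai, Matrix.mulVec_zero, zero_add]
            congr 1
            · by_cases hij' : i = j
              · simp only [hij', if_true, true_and]
                rw [hdl _ _ hab]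
                by_cases h : a = b
                · simp [h]
                · simp [h, Ne.symm h]
              · simp [hij']
            · by_cases h : b = a
              · simp only [h, if_true, true_and]
                rw [hdl _ _ hij]
                by_cases h : i = j <;> simp [h]
              · simp [h, Ne.symm h]
          have haj := hab.trans hbj
          simp only [lapp, Matrix.mulVec_sub, Matrix.mulVec_smul, e1, hai.ne', if_false]
          by_cases h1 : a = b <;> by_cases h2 : i = j
          · have h3 : a ≠ j := h2 ▸ hai.ne
            simp only [h1, h2, if_true, hbj, h1 ▸ h3, if_false, and_self, Matrix.mulVec_zero]
            module
          · simp [h1, h2, h1 ▸ hlow s i a hai, apply_ite (Matrix.mulVec _)]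
          · simp [h1, h2, h2 ▸ hlow s i a hai, apply_ite (Matrix.mulVec _)]
          · simp [h1, h2, hlow s i a hai, apply_ite (Matrix.mulVec _)]
    have hstep : ∀ i j, j ≤ i → ((lax (α s) (x s) * B * lax (β s) (x s)) i j).mulVec ξ =
        (if i = j then (1 - α s * wt s j) * (1 - β s * wt s j) * γ j +
          α s * β s * ∑ a ∈ Finset.Iio j, (wt s a - wt s j) * γ a else 0) • ξ := by
      intro i j hij
      have hterm : ∀ a b, ((lax (α s) (x s) i a) * B a b * (lax (β s) (x s) b j)).mulVec ξ =
          (if a = b ∧ i = j ∧ a ≤ j then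
          (if a = j then (1 - α s * wt s j) * (1 - β s * wt s j)
            else α s * β s * (wt s a - wt s j)) * γ a else 0) • ξ := by
        intro a b
        rcases lt_or_ge b a with hba | hab
        · rw [mul_assoc, ← (key (β s) b j a b).eq, ← Matrix.mulVec_mulVec, ← Matrix.mulVec_mulVec,
            h1 a b hba, Matrix.mulVec_zero, Matrix.mulVec_zero, if_neg, zero_smul]
          rintro ⟨rfl, -⟩
          exact lt_irrefl _ hba
        · rw [(key (α s) i a a b).eq, mul_assoc, ← Matrix.mulVec_mulVec, ← Matrix.mulVec_mulVec,
            hLM i j a b hij hab, Matrix.mulVec_smul]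
          split_ifs with h h'
          · rw [← h.1, h2, smul_smul]
          · rw [← h.1, h2, smul_smul]
          · simp
      rw [mul_assoc, Matrix.mul_apply]
      simp only [Matrix.mul_apply, Finset.mul_sum, Matrix.sum_mulVec, ← mul_assoc, hterm]
      by_cases h : i = j
      · simp only [h, true_and, if_true, ite_and, ite_smul, zero_smul, Finset.sum_ite_eq,
          Finset.mem_univ]
        rw [← Finset.sum_filter]
        have : Finset.univ.filter (fun a => a ≤ j) = insert j (Finset.Iio j) := by
          ext a; simp [le_iff_eq_or_lt]
        rw [this, Finset.sum_insert (by simp), add_smul, Finset.sum_smul]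
        simp only [if_true]
        congr 1
        refine Finset.sum_congr rfl fun a ha => ?_
        rw [if_neg (Finset.mem_Iio.1 ha).ne, mul_assoc]
      · simp [h]
    refine ⟨fun j => (1 - α s * wt s j) * (1 - β s * wt s j) * γ j +
        α s * β s * ∑ a ∈ Finset.Iio j, (wt s a - wt s j) * γ a, fun i j hij => ?_, fun j => ?_,
        fun j => ?_⟩
    · rw [chain_cons, ← hB, hstep i j hij.le, if_neg hij.ne', zero_smul]
    · rw [chain_cons, ← hB, hstep j j le_rfl, if_pos rfl]
    · rw [tildeGen_dress (hαβ s) (wt s) (hwt s), h3, List.map_cons, List.prod_cons]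
      ring

end LowestWeight

/-! ### Cyclic vectors: openness and a Vandermonde argument. -/

section Cyclic

variable {K K' D : Type*} [Fintype D]

/-- The vector `ξ` generates `ℂᴰ` under the operators `O k`. -/
def CyclicFam (O : K → Matrix D D ℂ) (ξ : D → ℂ) : Prop :=
  ∀ N : Submodule ℂ (D → ℂ), ξ ∈ N → (∀ k, ∀ x ∈ N, (O k).mulVec x ∈ N) → N = ⊤

theorem CyclicFam.of_mem_span {O : K → Matrix D D ℂ} {O' : K' → Matrix D D ℂ} {ξ : D → ℂ}
    (h : CyclicFam O ξ) (hO : ∀ k, O k ∈ Submodule.span ℂ (Set.range O')) : CyclicFam O' ξ := by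
  intro N hξ hN
  refine h N hξ fun k x hx => ?_
  have hk := hO k
  generalize O k = M at hk
  induction hk using Submodule.span_induction with
  | mem M hM =>
    obtain ⟨k', rfl⟩ := hM
    exact hN k' x hx
  | zero => rw [Matrix.zero_mulVec]; exact N.zero_mem
  | add M M' _ _ h1 h2 => rw [Matrix.add_mulVec]; exact N.add_mem h1 h2
  | smul c M _ h1 => rw [Matrix.smul_mulVec]; exact N.smul_mem c h1

/-- The result of applying a word in the operators `O k` to the vector `ξ`. -/
def wordVec {R : Type*} [CommRing R] (O : K → Matrix D D R) (ξ : D → R) (w : List K) : D → R :=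
  w.foldr (fun k v => (O k).mulVec v) ξ

theorem map_wordVec {R R' : Type*} [CommRing R] [CommRing R'] (f : R →+* R')
    (O : K → Matrix D D R) (ξ : D → R) (w : List K) :
    f ∘ wordVec O ξ w = wordVec (fun k => (O k).map f) (f ∘ ξ) w := by
  induction w with
  | nil => rfl
  | cons k w ih =>
    ext a
    change f ((O k).mulVec (wordVec O ξ w) a) = ((O k).map f).mulVec (wordVec _ _ w) a
    rw [← ih, RingHom.map_mulVec]

theorem CyclicFam.span_wordVec {O : K → Matrix D D ℂ} {ξ : D → ℂ} (h : CyclicFam O ξ) :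
    Submodule.span ℂ (Set.range (wordVec O ξ)) = ⊤ := by
  refine h _ (Submodule.subset_span ⟨[], rfl⟩) fun k x hx => ?_
  induction hx using Submodule.span_induction with
  | mem x hx =>
    obtain ⟨w, rfl⟩ := hx
    exact Submodule.subset_span ⟨k :: w, rfl⟩
  | zero => rw [Matrix.mulVec_zero]; exact Submodule.zero_mem _
  | add x y _ _ h1 h2 => rw [Matrix.mulVec_add]; exact Submodule.add_mem _ h1 h2
  | smul c x _ h1 => rw [Matrix.mulVec_smul]; exact Submodule.smul_mem _ c h1

theorem wordVec_mem {O : K → Matrix D D ℂ} {ξ : D → ℂ} {N : Submodule ℂ (D → ℂ)} (hξ : ξ ∈ N)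
    (hN : ∀ k, ∀ x ∈ N, (O k).mulVec x ∈ N) (w : List K) : wordVec O ξ w ∈ N := by
  induction w with
  | nil => exact hξ
  | cons k w ih => exact hN k _ ih

/-- Cyclicity is an open condition. -/
theorem exists_ne_zero_cyclicFam [DecidableEq D] {R : Type*} [CommRing R] (O : K → Matrix D D R) (ξ : D → R)
    (f₀ : R →+* ℂ) (h : CyclicFam (fun k => (O k).map f₀) (f₀ ∘ ξ)) :
    ∃ F : R, f₀ F ≠ 0 ∧
      ∀ f : R →+* ℂ, f F ≠ 0 → CyclicFam (fun k => (O k).map f) (f ∘ ξ) := by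
  have hspan := h.span_wordVec
  obtain ⟨v, hv, -, hli⟩ := Submodule.exists_fun_fin_finrank_span_eq ℂ
    (Set.range (wordVec (fun k => (O k).map f₀) (f₀ ∘ ξ)))
  have hcard : Fintype.card D =
      Module.finrank ℂ (Submodule.span ℂ (Set.range (wordVec (fun k => (O k).map f₀) (f₀ ∘ ξ)))) := by
    rw [hspan, finrank_top, Module.finrank_pi]
  let e : D ≃ Fin _ := Fintype.equivFinOfCardEq hcard
  choose ws hws using hv
  have hdet : ∀ f : R →+* ℂ, f (Matrix.of fun a => wordVec O ξ (ws (e a))).det =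
      (Matrix.of fun a => wordVec (fun k => (O k).map f) (f ∘ ξ) (ws (e a))).det := by
    intro f
    rw [RingHom.map_det]
    congr 1
    ext a b
    exact congrFun (map_wordVec f O ξ (ws (e a))) b
  -- Words giving a basis at `f₀` are fixed, and `F` is the determinant of their vectors over `R`.
  -- Wherever `F` does not vanish, the same words give a basis.
  refine ⟨(Matrix.of fun a => wordVec O ξ (ws (e a))).det, ?_, fun f hf => ?_⟩
  · rw [hdet]
    have : LinearIndependent ℂ (Matrix.of fun a =>
        wordVec (fun k => (O k).map f₀) (f₀ ∘ ξ) (ws (e a))).row := by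
      have e1 : (Matrix.of fun a =>
        wordVec (fun k => (O k).map f₀) (f₀ ∘ ξ) (ws (e a))).row = v ∘ e := by
        funext a
        exact hws (e a)
      rw [e1]
      exact hli.comp _ e.injective
    rw [Matrix.linearIndependent_rows_iff_isUnit, Matrix.isUnit_iff_isUnit_det] at this
    exact this.ne_zero
  · rw [hdet] at hf
    have : LinearIndependent ℂ (Matrix.of fun a =>
        wordVec (fun k => (O k).map f) (f ∘ ξ) (ws (e a))).row := by
      rw [Matrix.linearIndependent_rows_iff_isUnit, Matrix.isUnit_iff_isUnit_det]
      exact hf.isUnit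
    have htop := this.span_eq_top_of_card_eq_finrank' (by rw [Module.finrank_pi])
    intro N hξ hN
    rw [eq_top_iff, ← htop, Submodule.span_le]
    rintro _ ⟨a, rfl⟩
    exact wordVec_mem hξ hN _

/-- A Vandermonde argument. -/
theorem mem_span_of_powers {ι V : Type*} [Fintype ι] [AddCommGroup V] [Module ℂ V] (y : ι → V)
    {b β : ι → ℂ} (hβ : Function.Injective β) (hb : ∀ s, b s ≠ 0) (t : ι) :
    y t ∈ Submodule.span ℂ (Set.range fun q : ℕ => ∑ s, (b s * β s ^ q) • y s) := by
  classical
  -- Combining the given vectors with the coefficients of this polynomial evaluates it at the nodes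
  -- `β s`, which removes every `y s` except `y t`.
  set f := Lagrange.basis Finset.univ β t
  have h : ∑ q ∈ Finset.range (f.natDegree + 1), f.coeff q • ∑ s, (b s * β s ^ q) • y s =
      b t • y t := by
    simp only [Finset.smul_sum, smul_smul]
    rw [Finset.sum_comm]
    simp only [← Finset.sum_smul]
    rw [Finset.sum_eq_single t]
    · congr 1
      have : f.eval (β t) = 1 := Lagrange.eval_basis_self hβ.injOn (Finset.mem_univ t)
      rw [Polynomial.eval_eq_sum_range] at this
      calc _ = b t * ∑ q ∈ Finset.range (f.natDegree + 1), f.coeff q * β t ^ q := by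
            rw [Finset.mul_sum]; exact Finset.sum_congr rfl fun q _ => by ring
        _ = b t := by rw [this, mul_one]
    · intro s _ hst
      have : f.eval (β s) = 0 := Lagrange.eval_basis_of_ne hst.symm (Finset.mem_univ s)
      rw [Polynomial.eval_eq_sum_range] at this
      have e : ∑ q ∈ Finset.range (f.natDegree + 1), f.coeff q * (b s * β s ^ q) = 0 := by
        calc _ = b s * ∑ q ∈ Finset.range (f.natDegree + 1), f.coeff q * β s ^ q := by
              rw [Finset.mul_sum]; exact Finset.sum_congr rfl fun q _ => by ring
          _ = 0 := by rw [this, mul_zero]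
      rw [e, zero_smul]
    · simp
  have h2 : y t = (b t)⁻¹ • b t • y t := by rw [smul_smul, inv_mul_cancel₀ (hb t), one_smul]
  rw [h2, ← h]
  exact Submodule.smul_mem _ _ (Submodule.sum_mem _ fun q _ =>
    Submodule.smul_mem _ _ (Submodule.subset_span ⟨q, rfl⟩))

end Cyclic

/-! ### Degeneration of the chain and generic cyclicity. -/

section Generic

open PowerSeries

variable {n : ℕ}

/-- To first order in `ε` the ordered product becomes a sum over the sites; products of different
site operators occur only from the second order on. -/
theorem chain_first_order {ι Z A : Type*} [CommRing Z] [Ring A] [Algebra Z A] (l : List ι) (ε : Z)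
    (Y Y' : ι → Matrix (Fin n) (Fin n) A) (K : Matrix (Fin n) (Fin n) A) :
    ∃ E, chain l (fun s => 1 - ε • Y s) (fun s => 1 - ε • Y' s) K =
      K - ε • (l.map fun s => Y s * K + K * Y' s).sum + ε ^ 2 • E := by
  induction l with
  | nil => exact ⟨0, by simp [chain]⟩
  | cons s l ih =>
    obtain ⟨E, hE⟩ := ih
    set T := (l.map fun s => Y s * K + K * Y' s).sum
    refine ⟨E + Y s * T + T * Y' s + Y s * K * Y' s - ε • (Y s * E + E * Y' s + Y s * T * Y' s)
      + ε ^ 2 • (Y s * E * Y' s), ?_⟩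
    rw [chain_cons, hE, List.map_cons, List.sum_cons]
    simp only [sub_mul, mul_sub, add_mul, mul_add, smul_mul_assoc, mul_smul_comm, one_mul, mul_one,
      smul_sub, smul_add, smul_smul]
    module

variable {D : Type*} [Fintype D] [DecidableEq D]

theorem lax_geo_smul {R : Type*} [CommRing R] (c : R⟦X⟧) (ε : R)
    (x : Matrix (Fin n) (Fin n) (Matrix D D R)) :
    lax c (extScal C (ε • x)) = 1 - C ε • (c • extScal (C (R := R)) x) := by
  rw [lax]
  congr 1
  ext i j a b : 4
  simp only [Matrix.smul_apply, extScal_apply, smul_eq_mul, map_mul]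
  ring_nf

theorem coeffMat_first_order {ι R : Type*} [CommRing R] (l : List ι) (ε : R)
    (x : ι → Matrix (Fin n) (Fin n) (Matrix D D R)) (a h : ι → R) (k : Fin n → R⟦X⟧) :
    ∃ E : Fin n → Fin n → ℕ → Matrix D D R, ∀ i j s,
      coeffMat (laxChain l (fun s => ε • x s) a h k) i j s =
        (if i = j then coeff s (k i) else 0) • 1 -
          ε • (l.map fun t => coeff s (geo (a t) * k j + geo (-h t) * k i) • x t i j).sum +
          ε ^ 2 • E i j s := by
  obtain ⟨E, hE⟩ := chain_first_order l (C ε) (fun s => geo (a s) • extScal (C (R := R)) (x s))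
    (fun s => geo (-h s) • extScal (C (R := R)) (x s))
    (Matrix.diagonal fun i => k i • (1 : Matrix D D R⟦X⟧))
  refine ⟨fun i j s => coeffMat E i j s, fun i j s => ?_⟩
  rw [laxChain, laxProd]
  simp only [lax_geo_smul]
  rw [hE]
  ext p q
  have hsum : ∀ l : List ι, coeff s ((l.map fun s =>
      (geo (a s) • extScal (C (R := R)) (x s)) *
        (Matrix.diagonal fun i => k i • (1 : Matrix D D R⟦X⟧)) +
      (Matrix.diagonal fun i => k i • (1 : Matrix D D R⟦X⟧)) *
        (geo (-h s) • extScal (C (R := R)) (x s))).sum i j p q) =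
      (l.map fun t => coeff s (geo (a t) * k j + geo (-h t) * k i) • x t i j).sum p q := by
    intro l
    induction l with
    | nil => simp
    | cons t l ih =>
      simp only [List.map_cons, List.sum_cons, Matrix.add_apply, map_add, ih]
      congr 1
      rw [Matrix.mul_diagonal, Matrix.diagonal_mul, mul_smul_comm, smul_mul_assoc, mul_one, one_mul,
        ← map_add]
      simp only [Matrix.smul_apply, extScal_apply, smul_eq_mul, ← mul_assoc, ← add_mul,
        coeff_mul_C]
      congr 2
      rw [← map_add]
      congr 1
      ring
  simp only [coeffMat, Matrix.of_apply, Matrix.add_apply, Matrix.sub_apply, Matrix.smul_apply,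
    map_add, map_sub, smul_eq_mul, ← map_pow, coeff_C_mul, hsum, Matrix.diagonal_apply]
  congr 2
  split_ifs
  · simp only [Matrix.smul_apply, Matrix.one_apply]
    split_ifs <;> simp
  · simp

theorem rescale_geo {R : Type*} [CommRing R] (ε a : R) :
    rescale ε (geo a) = C ε * geo (ε * a) := by
  ext s
  rw [coeff_rescale, coeff_C_mul]
  cases s with
  | zero => simp [coeff_zero_geo]
  | succ s => rw [coeff_succ_geo, coeff_succ_geo]; ring

/-- Replacing `v⁻¹` by `ε v⁻¹` multiplies both the generators and the parameters by `ε`. Hence large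
parameters amount to small generators. -/
theorem extScal_rescale_laxChain {ι R : Type*} [CommRing R] (l : List ι) (ε : R)
    (x : ι → Matrix (Fin n) (Fin n) (Matrix D D R)) (a h : ι → R) (k : Fin n → R⟦X⟧) :
    extScal (rescale ε) (laxChain l x a h k) =
      laxChain l (fun s => ε • x s) (fun s => ε * a s) (fun s => ε * h s)
        (fun i => rescale ε (k i)) := by
  have e : (rescale ε).comp C = C (R := R) := by
    ext r : 1
    ext s
    simp only [RingHom.comp_apply, coeff_rescale, coeff_C]
    split_ifs with h <;> simp [h]
  have e2 : ∀ (b : R) (y : Matrix (Fin n) (Fin n) (Matrix D D R)),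
      lax (C ε * geo (ε * b)) (extScal C y) = lax (geo (ε * b)) (extScal C (ε • y)) := by
    intro b y
    rw [lax_geo_smul, lax, smul_smul]
  rw [laxChain, laxChain, extScal_laxProd]
  simp only [laxProd, extScal_extScal, e, rescale_geo, e2]
  simp only [mul_neg]

/-- There are parameters for which the chain generates everything that the sites generate. -/
theorem exists_params_cyclicFam {ι : Type*} [Fintype ι] {l : List ι} (hl : l.Nodup)
    (hl' : ∀ s, s ∈ l) (x : ι → Matrix (Fin n) (Fin n) (Matrix D D ℂ)) (c d : ι → ℂ)
    (k : Fin n → ℂ⟦X⟧) (hk : ∀ i, constantCoeff (k i) = 1 ∨ constantCoeff (k i) = -1) {ξ : D → ℂ}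
    (hξ : CyclicFam (fun t : ι × Fin n × Fin n => x t.1 t.2.1 t.2.2) ξ) :
    ∃ p : ι → ℂ, CyclicFam (fun t : Fin n × Fin n × ℕ =>
      coeffMat (laxChain l x (p + c) (p + d) k) t.1 t.2.1 t.2.2) ξ := by
  classical
  set g := fun i => constantCoeff (k i) with hg
  -- Positive integers, so that even the squares are distinct: the Vandermonde nodes used below are
  -- `α s ^ 2`.
  set α : ι → ℂ := fun s => ((Fintype.equivFin ι s : ℕ) : ℂ) + 1 with hα
  have hα0 : ∀ s, α s ≠ 0 := fun s => Nat.cast_add_one_ne_zero _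
  have hα2 : Function.Injective fun s => α s ^ 2 := by
    intro s t hst
    have h1 : ((Fintype.equivFin ι s : ℕ) + 1) ^ 2 = ((Fintype.equivFin ι t : ℕ) + 1) ^ 2 := by
      have : (((((Fintype.equivFin ι s : ℕ) + 1) ^ 2 : ℕ)) : ℂ) =
        ((((Fintype.equivFin ι t : ℕ) + 1) ^ 2 : ℕ)) := by push_cast; exact hst
      exact_mod_cast this
    have h2 := Nat.pow_left_injective (n := 2) (by norm_num) h1
    exact (Fintype.equivFin ι).injective (Fin.ext (by omega))
  set ε : Polynomial ℂ := Polynomial.X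
  set x' : ι → Matrix (Fin n) (Fin n) (Matrix D D (Polynomial ℂ)) :=
    fun s => extScal Polynomial.C (x s) with hx'
  set a' : ι → Polynomial ℂ := fun s => Polynomial.C (α s) + ε * Polynomial.C (c s)
  set h' : ι → Polynomial ℂ := fun s => Polynomial.C (α s) + ε * Polynomial.C (d s)
  set k' : Fin n → (Polynomial ℂ)⟦X⟧ := fun i => rescale ε (PowerSeries.map Polynomial.C (k i))
  obtain ⟨E, hE⟩ := coeffMat_first_order l ε x' a' h' k'
  -- A coefficient of the chain divided by `ε`. The coefficient index starts at `2` so that the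
  -- scalar contributed by the boundary matrix keeps a positive power of `ε` and disappears at `ε =
  -- 0`.
  set O : Fin n × Fin n × ℕ → Matrix D D (Polynomial ℂ) := fun t =>
    (if t.1 = t.2.1 then ε ^ (t.2.2 + 1) * Polynomial.C (coeff (t.2.2 + 2) (k t.1)) else 0) • 1 -
      (l.map fun s => coeff (t.2.2 + 2) (geo (a' s) * k' t.2.1 + geo (-h' s) * k' t.1) •
        x' s t.1 t.2.1).sum + ε • E t.1 t.2.1 (t.2.2 + 2) with hO
  have hOE : ∀ t, coeffMat (laxChain l (fun s => ε • x' s) a' h' k') t.1 t.2.1 (t.2.2 + 2) =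
      ε • O t := by
    intro t
    rw [hE, hO]
    simp only [smul_add, smul_sub, smul_smul, k', coeff_rescale, coeff_map]
    congr 2
    · split_ifs
      · rw [← mul_assoc, ← pow_succ']
      · simp
    · rw [sq]
  have hcyc0 : CyclicFam (fun t => (O t).map (Polynomial.evalRingHom (0 : ℂ)))
      (Polynomial.evalRingHom (0 : ℂ) ∘ Polynomial.C ∘ ξ) := by
    have e0 : (Polynomial.evalRingHom (0 : ℂ) ∘ Polynomial.C ∘ ξ) = ξ := by
      funext a; simp
    rw [e0]
    refine hξ.of_mem_span ?_
    have hval : ∀ i j r, (O (i, j, r)).map (Polynomial.evalRingHom (0 : ℂ)) =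
        - ∑ s, (g j * α s ^ (r + 1) + g i * (-α s) ^ (r + 1)) • x s i j := by
      intro i j r
      have hk0 : ∀ i, PowerSeries.map (Polynomial.evalRingHom (0 : ℂ)) (k' i) = C (g i) := by
        intro i
        ext s
        simp only [k', coeff_map, coeff_rescale, coeff_C, map_mul, map_pow, hg]
        cases s with
        | zero => simp
        | succ s => simp [ε]
      have hw : ∀ s, Polynomial.eval 0 (coeff (r + 2) (geo (a' s) * k' j + geo (-h' s) * k' i)) =
          g j * α s ^ (r + 1) + g i * (-α s) ^ (r + 1) := by
        intro s
        have : Polynomial.eval 0 (coeff (r + 2) (geo (a' s) * k' j + geo (-h' s) * k' i)) =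
          coeff (r + 2) (PowerSeries.map (Polynomial.evalRingHom (0 : ℂ))
            (geo (a' s) * k' j + geo (-h' s) * k' i)) := by
          rw [coeff_map]; rfl
        rw [this, map_add, map_mul, map_mul, hk0, hk0, map_geo, map_geo, map_add, coeff_mul_C,
          coeff_mul_C, coeff_succ_geo, coeff_succ_geo]
        have ha : Polynomial.evalRingHom (0 : ℂ) (a' s) = α s := by simp [a', ε]
        have hh : Polynomial.evalRingHom (0 : ℂ) (h' s) = α s := by simp [h', ε]
        rw [map_neg, ha, hh]
        ring
      have hsum : ∀ l : List ι, l.Nodup → ∀ p q, Polynomial.eval 0 ((l.map fun s =>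
          coeff (r + 2) (geo (a' s) * k' j + geo (-h' s) * k' i) • x' s i j).sum p q) =
          (∑ s ∈ l.toFinset, (g j * α s ^ (r + 1) + g i * (-α s) ^ (r + 1)) • x s i j) p q := by
        intro l hl p q
        rw [← List.sum_toFinset _ hl, Matrix.sum_apply, Matrix.sum_apply, Polynomial.eval_finsetSum]
        refine Finset.sum_congr rfl fun s _ => ?_
        rw [Matrix.smul_apply, smul_eq_mul, Polynomial.eval_mul, hw]
        simp [x', extScal_apply]
      ext p q
      have : l.toFinset = Finset.univ := by ext s; simp [hl' s]
      simp only [hO, Matrix.map_apply, Matrix.add_apply, Matrix.sub_apply, Matrix.smul_apply,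
        Polynomial.coe_evalRingHom, Polynomial.eval_add, Polynomial.eval_sub, smul_eq_mul,
        Polynomial.eval_mul, hsum l hl, this, Matrix.neg_apply]
      split_ifs <;> simp [ε]
    rintro ⟨t, i, j⟩
    -- In the limit the left and right Lax matrices have the opposite parameters `α s` and `-α s`.
    -- Their contributions reinforce each other in even degrees when `g i = g j` and in odd degrees
    -- when `g i = -g j`; `f` selects those degrees.
    have hpow : ∃ (b : ι → ℂ) (f : ℕ → ℕ), (∀ s, b s ≠ 0) ∧ ∀ q s,
        g j * α s ^ (f q + 1) + g i * (-α s) ^ (f q + 1) = b s * (α s ^ 2) ^ q := by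
      have hgj : g j ≠ 0 := by
        rcases hk j with h | h <;> simp [g, h]
      by_cases hij : g i = g j
      · refine ⟨fun s => 2 * g j * α s ^ 2, fun q => 2 * q + 1, fun s => ?_, fun q s => ?_⟩
        · exact mul_ne_zero (mul_ne_zero two_ne_zero hgj) (pow_ne_zero _ (hα0 s))
        · rw [Even.neg_pow ⟨q + 1, by ring⟩, hij]
          ring_nf
      · refine ⟨fun s => 2 * g j * α s, fun q => 2 * q, fun s => ?_, fun q s => ?_⟩
        · exact mul_ne_zero (mul_ne_zero two_ne_zero hgj) (hα0 s)
        · have : g i = - g j := by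
            rcases hk i with h1 | h1 <;> rcases hk j with h2 | h2 <;>
              simp [g, h1, h2] at hij ⊢
          rw [Odd.neg_pow ⟨q, rfl⟩, this]
          ring_nf
    obtain ⟨b, f, hb, hf⟩ := hpow
    have := mem_span_of_powers (fun s => x s i j) hα2 hb t
    refine Submodule.span_le.2 ?_ this
    rintro _ ⟨q, rfl⟩
    have e : ∑ s, (b s * (α s ^ 2) ^ q) • x s i j =
        -(O (i, j, f q)).map (Polynomial.evalRingHom (0 : ℂ)) := by
      rw [hval, neg_neg]
      exact Finset.sum_congr rfl fun s _ => by rw [hf]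
    simp only [SetLike.mem_coe]
    rw [e]
    exact Submodule.neg_mem _ (Submodule.subset_span ⟨(i, j, f q), rfl⟩)
  obtain ⟨F, hF0, hF⟩ := exists_ne_zero_cyclicFam O (Polynomial.C ∘ ξ) _ hcyc0
  have hF' : F ≠ 0 := fun h => hF0 (by rw [h, map_zero])
  obtain ⟨z, hz⟩ : ∃ z : ℂ, z ≠ 0 ∧ F.eval z ≠ 0 := by
    by_contra! hcon
    have : (F * Polynomial.X) = 0 := Polynomial.funext fun z => by
      by_cases h : z = 0
      · simp [h]
      · simp [hcon z h]
    exact hF' ((mul_eq_zero.1 this).resolve_right Polynomial.X_ne_zero)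
  -- At `ε = z` the degenerating chain has generators `z • x` and parameters `z (z⁻¹ α + c)`, `z
  -- (z⁻¹ α + d)`. It is therefore the rescaled original chain, which is why `z ≠ 0` was required.
  refine ⟨fun s => z⁻¹ * α s, ?_⟩
  have hc := hF (Polynomial.evalRingHom z) hz.2
  have e0 : (Polynomial.evalRingHom z ∘ Polynomial.C ∘ ξ) = ξ := by
    funext a; simp
  rw [e0] at hc
  refine hc.of_mem_span ?_
  rintro ⟨i, j, r⟩
  have e1 : extScal (PowerSeries.map (Polynomial.evalRingHom z))
      (laxChain l (fun s => ε • x' s) a' h' k') = extScal (rescale z)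
        (laxChain l x ((fun s => z⁻¹ * α s) + c) ((fun s => z⁻¹ * α s) + d) k) := by
    rw [extScal_laxChain, extScal_rescale_laxChain]
    congr 1
    · funext s
      ext a b i j
      simp [extScal_apply, x', ε]
      ring
    · funext s
      simp [a', ε, mul_add, hz.1]
      ring
    · funext s
      simp [h', ε, mul_add, hz.1]
      ring
    · funext i
      ext s
      simp [k', ε, coeff_rescale]
      ring
  have e2 : z • (O (i, j, r)).map (Polynomial.evalRingHom z) = z ^ (r + 2) •
      coeffMat (laxChain l x ((fun s => z⁻¹ * α s) + c) ((fun s => z⁻¹ * α s) + d) k) i j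
        (r + 2) := by
    ext p q
    have h1 := congrArg (fun M => Polynomial.eval z (M p q)) (hOE (i, j, r))
    simp only [Matrix.smul_apply, smul_eq_mul, Polynomial.eval_mul, ε, Polynomial.eval_X] at h1
    have h2 := congrArg (fun M => coeff (r + 2) (M i j p q)) e1
    simp only [extScal_apply, coeff_map, coeff_rescale] at h2
    simp only [Matrix.smul_apply, Matrix.map_apply, smul_eq_mul, Polynomial.coe_evalRingHom]
    rw [← h1]
    exact h2
  have e3 : (O (i, j, r)).map (Polynomial.evalRingHom z) = z ^ (r + 1) •
      coeffMat (laxChain l x ((fun s => z⁻¹ * α s) + c) ((fun s => z⁻¹ * α s) + d) k) i j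
        (r + 2) := by
    have := congrArg (z⁻¹ • ·) e2
    simp only [smul_smul, inv_mul_cancel₀ hz.1, one_smul] at this
    rw [this]
    congr 1
    rw [pow_succ z (r + 1), mul_comm _ z, inv_mul_cancel_left₀ hz.1]
  change (O (i, j, r)).map (Polynomial.evalRingHom z) ∈ _
  rw [e3]
  exact Submodule.smul_mem _ _ (Submodule.subset_span ⟨(i, j, r + 2), rfl⟩)

/-- Generically, the chain generates everything that the sites generate. -/
theorem generic_cyclicFam {ι : Type*} [Fintype ι] {l : List ι} (hl : l.Nodup)
    (hl' : ∀ s, s ∈ l) (x : ι → Matrix (Fin n) (Fin n) (Matrix D D ℂ)) (c d : ι → ℂ)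
    (k : Fin n → ℂ⟦X⟧) (hk : ∀ i, constantCoeff (k i) = 1 ∨ constantCoeff (k i) = -1) {ξ : D → ℂ}
    (hξ : CyclicFam (fun t : ι × Fin n × Fin n => x t.1 t.2.1 t.2.2) ξ) :
    ∃ F : MvPolynomial ι ℂ, F ≠ 0 ∧ ∀ p : ι → ℂ, MvPolynomial.eval p F ≠ 0 →
      CyclicFam (fun t : Fin n × Fin n × ℕ =>
        coeffMat (laxChain l x (p + c) (p + d) k) t.1 t.2.1 t.2.2) ξ := by
  obtain ⟨p₀, hp₀⟩ := exists_params_cyclicFam hl hl' x c d k hk hξ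
  set O : Fin n × Fin n × ℕ → Matrix D D (MvPolynomial ι ℂ) := fun t => coeffMat
    (laxChain l (fun s => extScal MvPolynomial.C (x s))
      (fun s => MvPolynomial.X s + MvPolynomial.C (c s))
      (fun s => MvPolynomial.X s + MvPolynomial.C (d s))
      (fun i => PowerSeries.map MvPolynomial.C (k i))) t.1 t.2.1 t.2.2 with hO
  have hOp : ∀ p : ι → ℂ, (fun t => (O t).map (MvPolynomial.eval p)) =
      fun t => coeffMat (laxChain l x (p + c) (p + d) k) t.1 t.2.1 t.2.2 := by
    intro p
    funext t
    have e1 : extScal (PowerSeries.map (MvPolynomial.eval p)) (laxChain l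
        (fun s => extScal MvPolynomial.C (x s))
        (fun s => MvPolynomial.X s + MvPolynomial.C (c s))
        (fun s => MvPolynomial.X s + MvPolynomial.C (d s))
        (fun i => PowerSeries.map MvPolynomial.C (k i))) = laxChain l x (p + c) (p + d) k := by
      rw [extScal_laxChain]
      congr 1
      · funext s
        ext a b i j
        simp [extScal_apply]
      · funext s
        simp
      · funext s
        simp
      · funext i
        ext s
        simp
    rw [← e1]
    rfl
  have e0 : ∀ p : ι → ℂ, (MvPolynomial.eval p ∘ MvPolynomial.C ∘ ξ) = ξ := fun p => by
    funext a; simp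
  obtain ⟨F, hF0, hF⟩ := exists_ne_zero_cyclicFam O (MvPolynomial.C ∘ ξ) (MvPolynomial.eval p₀)
    (by rw [hOp, e0]; exact hp₀)
  refine ⟨F, fun h => hF0 (by rw [h, map_zero]), fun p hp => ?_⟩
  have := hF (MvPolynomial.eval p) hp
  rwa [hOp, e0] at this

end Generic

/-! ### Modules attached to commuting sites with a common lowest vector. -/

section SiteModule

open PowerSeries

variable {n : ℕ} {D : Type*} [Fintype D] [DecidableEq D]

/-- The quadratic equation, evaluated on a lowest vector. -/
theorem IsSite.weight_eq {x : Matrix (Fin n) (Fin n) (Matrix D D ℂ)} {e q : ℂ} (h : IsSite x e q)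
    {ξ : D → ℂ} (hξ : ξ ≠ 0) {wt : Fin n → ℂ} (hlow : ∀ i j, j < i → (x i j).mulVec ξ = 0)
    (hdiag : ∀ j, (x j j).mulVec ξ = wt j • ξ) (j : Fin n) :
    wt j ^ 2 + ∑ b ∈ Finset.Iio j, (wt b - wt j) - e * wt j = q := by
  have h1 := congrArg (fun M : Matrix D D ℂ => M.mulVec ξ) (congrFun (congrFun h.quad j) j)
  have h2 : ∀ b, (x j b * x b j).mulVec ξ =
      (if b = j then wt j ^ 2 else if b < j then wt b - wt j else 0) • ξ := by
    intro b
    rcases lt_trichotomy b j with hb | hb | hb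
    · have := h.comm b j j b
      simp only [if_true] at this
      rw [this, Matrix.add_mulVec, Matrix.sub_mulVec, ← Matrix.mulVec_mulVec, hlow j b hb, hdiag,
        hdiag, Matrix.mulVec_zero, zero_add, if_neg hb.ne, if_pos hb, sub_smul]
    · rw [hb, ← Matrix.mulVec_mulVec, hdiag, Matrix.mulVec_smul, hdiag, smul_smul, if_pos rfl, sq]
    · rw [← Matrix.mulVec_mulVec, hlow b j hb, Matrix.mulVec_zero, if_neg hb.ne', if_neg hb.not_gt,
        zero_smul]
  simp only [Matrix.mul_apply, Matrix.add_apply, Matrix.smul_apply, Matrix.sum_mulVec, h2,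
    Matrix.add_mulVec, Matrix.smul_mulVec, hdiag, Matrix.one_apply_eq, Matrix.one_mulVec,
    smul_smul, ← add_smul, ← Finset.sum_smul] at h1
  have h3 := smul_left_injective ℂ hξ h1
  rw [← Finset.sum_erase_add _ _ (Finset.mem_univ j), if_pos rfl] at h3
  have h4 : ∑ b ∈ Finset.univ.erase j,
      (if b = j then wt j ^ 2 else if b < j then wt b - wt j else 0) =
      ∑ b ∈ Finset.Iio j, (wt b - wt j) := by
    have : Finset.Iio j = (Finset.univ.erase j).filter (· < j) := by
      ext b; simp only [Finset.mem_Iio, Finset.mem_filter, Finset.mem_erase, Finset.mem_univ]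
      grind
    rw [this, Finset.sum_filter]
    refine Finset.sum_congr rfl fun b hb => ?_
    rw [if_neg (Finset.ne_of_mem_erase hb)]
  rw [h4] at h3
  linear_combination h3

theorem coeffMat_zero_laxChain {ι R : Type*} [CommRing R] (l : List ι)
    (x : ι → Matrix (Fin n) (Fin n) (Matrix D D R)) (a h : ι → R) (k : Fin n → R⟦X⟧) (i j : Fin n) :
    coeffMat (laxChain l x a h k) i j 0 = (if i = j then constantCoeff (k i) else 0) • 1 := by
  have e : extScal constantCoeff (laxChain l x a h k) =
      Matrix.diagonal fun i => constantCoeff (k i) • 1 := by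
    rw [laxChain, extScal_laxProd]
    have h0 : ∀ b : R, constantCoeff (geo b) = 0 := fun b => by
      rw [← coeff_zero_eq_constantCoeff_apply, coeff_zero_geo]
    simp only [h0]
    simp [laxProd, chain, lax]
  have e2 : coeffMat (laxChain l x a h k) i j 0 = extScal constantCoeff (laxChain l x a h k) i j := by
    ext a b
    rw [extScal_apply, ← coeff_zero_eq_constantCoeff_apply]
    rfl
  rw [e2, e, Matrix.diagonal_apply]
  split_ifs <;> simp

theorem laxProd_extScal_lowest {Z ι : Type*} [CommRing Z] (φ : ℂ →+* Z) {l : List ι} (hl : l.Nodup)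
    (x : ι → Matrix (Fin n) (Fin n) (Matrix D D ℂ)) (e q : ι → ℂ) (α β : ι → Z)
    (hx : ∀ s, IsSite (x s) (e s) (q s)) (hxx : ∀ s t, s ≠ t → EntryComm (x s) (x t))
    {ξ : D → ℂ} (hξ : ξ ≠ 0) {wt : ι → Fin n → ℂ}
    (hlow : ∀ s i j, j < i → (x s i j).mulVec ξ = 0)
    (hdiag : ∀ s j, (x s j j).mulVec ξ = wt s j • ξ) {U W : Z}
    (hαβ : ∀ s, U * (α s + β s) = α s * β s * (W + φ (e s) * U)) (k : Fin n → Z) :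
    ∃ γ : Fin n → Z,
      (∀ i j, j < i →
        (laxProd l (fun s => extScal φ (x s)) α β k i j).mulVec (fun b => φ (ξ b)) = 0) ∧
      (∀ j, (laxProd l (fun s => extScal φ (x s)) α β k j j).mulVec (fun b => φ (ξ b)) =
        γ j • fun b => φ (ξ b)) ∧
      (∀ j, tildeGen W U γ j = tildeGen W U k j *
        (l.map fun s => (1 - α s * φ (wt s j)) * (1 - β s * φ (wt s j))).prod) := by
  have hmap' : ∀ s i j, (extScal φ (x s) i j).mulVec (fun b => φ (ξ b)) =
      fun b => φ ((x s i j).mulVec ξ b) := by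
    intro s i j
    funext a
    exact (RingHom.map_mulVec φ (x s i j) ξ a).symm
  refine laxProd_lowest hl (fun s => extScal φ (x s)) (fun s => φ (e s))
    (fun s => φ (q s)) α β (fun s => (hx s).extScal φ) (fun s t h => (hxx s t h).extScal φ)
    ?_ ?_ ?_ hαβ k
  · intro s i j hij
    rw [hmap', hlow s i j hij]
    funext b
    simp
  · intro s j
    rw [hmap', hdiag]
    funext b
    simp
  · intro s j
    rw [← (hx s).weight_eq hξ (hlow s) (hdiag s) j]
    simp only [map_sub, map_add, map_pow, map_mul, map_sum]

/-- The sum `(v - a) + (v + ρ + a + e)` equals `2v + ρ + e`; this is the scalar condition of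
`tildeGen_dress`. -/
theorem geo_crossing (ρ a e : ℂ) :
    (X : ℂ⟦X⟧) * (geo a + geo (-(ρ + a + e))) =
      geo a * geo (-(ρ + a + e)) * ((2 + C ρ * X) + C e * X) := by
  have g1 := geo_mul a
  have g2 := geo_mul (-(ρ + a + e))
  generalize geo a = y at *
  generalize geo (-(ρ + a + e)) = z at *
  simp only [map_neg, map_add] at g1 g2
  linear_combination -y * g2 - z * g1

theorem coeff_mulVec_C (B : Matrix (Fin n) (Fin n) (Matrix D D ℂ⟦X⟧)) (ξ : D → ℂ) (i j : Fin n)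
    (s : ℕ) (b : D) :
    coeff s ((B i j).mulVec (fun b => C (ξ b)) b) = (coeffMat B i j s).mulVec ξ b := by
  simp [Matrix.mulVec, dotProduct, coeffMat, coeff_mul_C]

theorem laxChain_lowest {ι : Type*} {l : List ι} (hl : l.Nodup)
    (x : ι → Matrix (Fin n) (Fin n) (Matrix D D ℂ)) (e q a : ι → ℂ) (ρ : ℂ)
    (hx : ∀ s, IsSite (x s) (e s) (q s)) (hxx : ∀ s t, s ≠ t → EntryComm (x s) (x t))
    {ξ : D → ℂ} (hξ : ξ ≠ 0) {wt : ι → Fin n → ℂ}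
    (hlow : ∀ s i j, j < i → (x s i j).mulVec ξ = 0)
    (hdiag : ∀ s j, (x s j j).mulVec ξ = wt s j • ξ) (k : Fin n → ℂ⟦X⟧) :
    ∃ γ : Fin n → ℂ⟦X⟧,
      (∀ i j, j < i → ∀ s,
        (coeffMat (laxChain l x a (fun s => ρ + a s + e s) k) i j s).mulVec ξ = 0) ∧
      (∀ j s, (coeffMat (laxChain l x a (fun s => ρ + a s + e s) k) j j s).mulVec ξ =
        coeff s (γ j) • ξ) ∧
      (∀ j, tildeGen (2 + C ρ * X) X γ j = tildeGen (2 + C ρ * X) X k j *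
        (l.map fun s => (1 - geo (a s) * C (wt s j)) *
          (1 - geo (-(ρ + a s + e s)) * C (wt s j))).prod) := by
  obtain ⟨γ, h1, h2, h3⟩ := laxProd_extScal_lowest C hl x e q (fun s => geo (a s))
    (fun s => geo (-(ρ + a s + e s))) hx hxx hξ hlow hdiag
    (fun s => geo_crossing ρ (a s) (e s)) k
  refine ⟨γ, fun i j hij s => ?_, fun j s => ?_, h3⟩
  · funext b
    refine (coeff_mulVec_C _ ξ i j s b).symm.trans ?_
    refine (congrArg (coeff s) (congrFun (h1 i j hij) b)).trans ?_
    simp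
  · funext b
    refine (coeff_mulVec_C _ ξ j j s b).symm.trans ?_
    refine (congrArg (coeff s) (congrFun (h2 j) b)).trans ?_
    simp [coeff_mul_C]

/-- A family of commuting sites with a common lowest vector defines, for all values of the
parameters, a module over the reflection algebra with an explicit lowest weight. This module is
generated by the lowest vector for generic parameters. -/
theorem exists_siteModule {ι : Type*} [Fintype ι] {l : List ι} (hl : l.Nodup) (hl' : ∀ s, s ∈ l)
    (x : ι → Matrix (Fin n) (Fin n) (Matrix D D ℂ)) (e q c : ι → ℂ) (r : ℕ) (ρ : ℂ)
    (hx : ∀ s, IsSite (x s) (e s) (q s)) (hxx : ∀ s t, s ≠ t → EntryComm (x s) (x t))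
    {ξ : D → ℂ} (hξ : ξ ≠ 0) {wt : ι → Fin n → ℂ}
    (hlow : ∀ s i j, j < i → (x s i j).mulVec ξ = 0)
    (hdiag : ∀ s j, (x s j j).mulVec ξ = wt s j • ξ)
    (hcyc : CyclicFam (fun t : ι × Fin n × Fin n => x t.1 t.2.1 t.2.2) ξ)
    (α : ℂ) (ψ : ℂ⟦X⟧) (hψ : constantCoeff ψ = 1) :
    let k : Fin n → ℂ⟦X⟧ := fun i => ψ * (C (gCirc n r i) * (1 + C (ρ / 2) * X) + C α * X)
    ∃ F : MvPolynomial ι ℂ, F ≠ 0 ∧ ∀ p : ι → ℂ,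
      ∃ Φ : ExtReflAlg n r ρ →ₐ[ℂ] Matrix D D ℂ,
        (∀ i j s, Φ (bGen n r ρ i j s) =
          coeffMat (laxChain l x (p + c) (fun s => ρ + (p + c) s + e s) k) i j s) ∧
        ∃ γ : Fin n → ℂ⟦X⟧,
          (∀ i j, j < i → ∀ s, (Φ (bGen n r ρ i j s)).mulVec ξ = 0) ∧
          (∀ j s, (Φ (bGen n r ρ j j s)).mulVec ξ = coeff s (γ j) • ξ) ∧
          (∀ j, constantCoeff (γ j) = gCirc n r j) ∧
          (∀ j, tildeGen (2 + C ρ * X) X γ j = tildeGen (2 + C ρ * X) X k j *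
            (l.map fun s => (1 - geo ((p + c) s) * C (wt s j)) *
              (1 - geo (-(ρ + (p + c) s + e s)) * C (wt s j))).prod) ∧
          (MvPolynomial.eval p F ≠ 0 →
            CyclicFam (fun t : Fin n × Fin n × ℕ => Φ (bGen n r ρ t.1 t.2.1 t.2.2)) ξ) := by
  intro k
  have hg : ∀ i, gCirc n r i = 1 ∨ gCirc n r i = -1 := by
    intro i; rw [gCirc]; split_ifs <;> simp
  have hk0 : ∀ i, constantCoeff (k i) = gCirc n r i := by
    intro i; simp [k, hψ]
  obtain ⟨F, hF, hFc⟩ := generic_cyclicFam hl hl' x c (fun s => ρ + c s + e s) k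
    (fun i => by rw [hk0]; exact hg i) hcyc
  refine ⟨F, hF, fun p => ?_⟩
  set B := laxChain l x (p + c) (fun s => ρ + (p + c) s + e s) k with hB
  obtain ⟨Φ, hΦ⟩ := exists_representation (r := r) (ρ := ρ) (coeffMat B)
    (fun i j => by
      rw [hB, coeffMat_zero_laxChain, hk0, Algebra.algebraMap_eq_smul_one])
    (reflLeft_laxChain hl x e q (p + c) ρ hx hxx _ hg α ψ)
  obtain ⟨γ, h1, h2, h3⟩ := laxChain_lowest hl x e q (p + c) ρ hx hxx hξ hlow hdiag k
  rw [← hB] at h1 h2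
  refine ⟨Φ, hΦ, γ, fun i j hij s => ?_, fun j s => ?_, fun j => ?_, h3, fun hp => ?_⟩
  · rw [hΦ, h1 i j hij]
  · rw [hΦ, h2]
  · have := h2 j 0
    rw [hB, coeffMat_zero_laxChain, if_pos rfl, hk0, Matrix.smul_mulVec, Matrix.one_mulVec,
      coeff_zero_eq_constantCoeff_apply] at this
    exact (smul_left_injective ℂ hξ this).symm
  · have := hFc p hp
    have e1 : (p + fun s => ρ + c s + e s) = fun s => ρ + (p + c) s + e s := by
      funext s; simp only [Pi.add_apply]; ring
    simp only [hΦ]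
    rw [e1] at this
    exact this

end SiteModule

/-! ### Laurent series in `v⁻¹` and the shape of the boundary matrices. -/

section SeriesAtInfinity

open PowerSeries

/-- A power series in `v⁻¹`. -/
def toSer : ℂ⟦X⟧ →+* Ser := HahnSeries.ofPowerSeries ℤ ℂ

theorem toSer_C (a : ℂ) : toSer (C a) = cst a := HahnSeries.ofPowerSeries_C a

theorem toSer_X : toSer X = HahnSeries.single 1 1 := HahnSeries.ofPowerSeries_X

theorem toSer_injective : Function.Injective toSer := HahnSeries.ofPowerSeries_injective

theorem toSer_X_mul_vv : toSer X * vv = 1 := by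
  rw [toSer_X, vv, HahnSeries.single_mul_single]
  norm_num

theorem vv_ne_zero : vv ≠ 0 := right_ne_zero_of_mul_eq_one toSer_X_mul_vv

theorem toSer_X_eq : toSer X = vv⁻¹ := eq_inv_of_mul_eq_one_left toSer_X_mul_vv

theorem vv_sub_cst_mul (a : ℂ) : (vv - cst a) * toSer (mk fun s => a ^ s) = vv := by
  have h := congrArg toSer (mk_pow_mul a)
  simp only [map_mul, map_sub, map_one, toSer_C, toSer_X_eq] at h
  have hv := vv_ne_zero
  field_simp at h
  linear_combination h

theorem vv_sub_cst_ne_zero (a : ℂ) : vv - cst a ≠ 0 := fun h => by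
  have := vv_sub_cst_mul a
  rw [h, zero_mul] at this
  exact vv_ne_zero this.symm

theorem toSer_mk_pow (a : ℂ) : toSer (mk fun s => a ^ s) = vv / (vv - cst a) :=
  (eq_div_iff (vv_sub_cst_ne_zero a)).2 (by rw [mul_comm, vv_sub_cst_mul])

theorem toSer_geo (a : ℂ) : toSer (geo a) = (vv - cst a)⁻¹ := by
  rw [geo, map_mul, toSer_mk_pow, toSer_X_eq]
  have := vv_ne_zero
  have := vv_sub_cst_ne_zero a
  field_simp

theorem vv_add_cst_ne_zero (a : ℂ) : vv + cst a ≠ 0 := by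
  have := vv_sub_cst_ne_zero (-a)
  rwa [map_neg, sub_neg_eq_add] at this

theorem tildeW_toSer {n : ℕ} (ρ : ℂ) (f : Fin n → ℂ⟦X⟧) (j : Fin n) :
    tildeW ρ (fun i => toSer (f i)) j = vv * toSer (tildeGen (2 + C ρ * X) X f j) := by
  have hv := vv_ne_zero
  have : Finset.univ.filter (· < j) = Finset.Iio j := by ext; simp
  simp only [tildeW, tildeGen, map_add, map_mul, map_sub, map_natCast, map_ofNat, toSer_C,
    toSer_X_eq, map_sum, this]
  field_simp

theorem tildeW_mul {n : ℕ} (ρ : ℂ) (g : Ser) (f : Fin n → Ser) (j : Fin n) :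
    tildeW ρ (fun i => g * f i) j = g * tildeW ρ f j := by
  simp only [tildeW, ← Finset.mul_sum]
  ring

/-- The upper left block of the boundary matrix is a scalar series times `x G° + α`,
where `x = v + ρ/2`. -/
theorem Boundary.exists_kDiag_eq (n : ℕ) (bd : Boundary) (ρ : ℂ) :
    ∃ (α : ℂ) (ψ : ℂ⟦X⟧), constantCoeff ψ = 1 ∧ ∀ i : Fin n, bd.kDiag n ρ (Sum.inl i) =
      toSer (ψ * (C (gCirc n bd.r i) * (1 + C (ρ / 2) * X) + C α * X)) := by
  have hv := vv_ne_zero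
  have hx := vv_add_cst_ne_zero (ρ / 2)
  have hg : ∀ d : ℂ, vv + cst (ρ / 2) - cst d ≠ 0 := fun d => by
    have := vv_sub_cst_ne_zero (d - ρ / 2)
    rw [map_sub] at this
    convert this using 1
    ring
  have h0 : ∀ a : ℂ, constantCoeff (mk fun s => a ^ s) = 1 := fun a => by
    simp [← coeff_zero_eq_constantCoeff_apply]
  -- With `x = v + ρ/2`, `(d - x g)/(d - x) = (x g - d)/(x - d)`. This settles all types whose
  -- boundary matrix is `G(v + ρ/2)`, with `α = -d`.
  have hG : ∀ (bd : Boundary) (d : ℂ) (i : Fin n),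
      (cst d - (vv + cst (ρ / 2)) * cst (gCirc n bd.r i)) / (cst d - (vv + cst (ρ / 2))) =
      toSer ((mk fun s => (d - ρ / 2) ^ s) *
        (C (gCirc n bd.r i) * (1 + C (ρ / 2) * X) + C (-d) * X)) := by
    intro bd d i
    have h1 : vv - (cst d - cst (ρ / 2)) ≠ 0 := by
      rw [← map_sub]; exact vv_sub_cst_ne_zero _
    have h2 : cst d - (vv + cst (ρ / 2)) ≠ 0 := by
      rw [← neg_sub]; exact neg_ne_zero.2 (hg d)
    simp only [map_mul, map_add, map_one, toSer_C, toSer_X_eq, toSer_mk_pow, map_neg, map_sub]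
    field_simp
    ring
  have hψ : vv - (-cst (ρ / 2)) ≠ 0 := by rwa [sub_neg_eq_add]
  cases bd with
  | CI a =>
    refine ⟨-a, mk fun s => (-(ρ / 2)) ^ s, h0 _, fun i => ?_⟩
    simp only [kDiag, gDiag, gCirc, r, Sum.elim_inl, Nat.not_lt_zero, if_false, map_mul, map_add,
      map_one, map_neg, toSer_C, toSer_X_eq, toSer_mk_pow]
    field_simp
    ring
  | DIII a =>
    refine ⟨-a, mk fun s => (-(ρ / 2)) ^ s, h0 _, fun i => ?_⟩
    simp only [kDiag, gDiag, gCirc, r, Sum.elim_inl, Nat.not_lt_zero, if_false, map_mul, map_add,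
      map_one, map_neg, toSer_C, toSer_X_eq, toSer_mk_pow]
    field_simp
    ring
  | DIs a b =>
    -- The two upper entries are `(1 - b/x) x⁻¹` times `-x + a` and `x + a`.
    refine ⟨a, (mk fun s => (-(ρ / 2)) ^ s) * (1 - C b * geo (-(ρ / 2))), ?_, fun i => ?_⟩
    · simp [h0, geo]
    · simp only [kDiag, gCirc, r, Nat.lt_one_iff]
      split_ifs <;>
      · simp only [map_mul, map_add, map_one, map_neg, map_sub, toSer_C, toSer_X_eq, toSer_mk_pow,
          toSer_geo]
        field_simp
        ring
  | DIt a =>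
    generalize hd : (DIt a).dPar n = d
    -- The denominator `x - a` cancels: since `(x - a) - 2x = -(x + a)`, the upper entries are `(∓x
    -- - a)(x + a - 2d)/(x - d)²`.
    refine ⟨-a, (mk fun s => (d - ρ / 2) ^ s) ^ 2 * (1 + C (ρ / 2 + a - 2 * d) * X), ?_,
      fun i => ?_⟩
    · simp [h0]
    · have h1 : vv - (cst d - cst (ρ / 2)) ≠ 0 := by
        rw [← map_sub]; exact vv_sub_cst_ne_zero _
      have h2 := hg a
      have h3 := hg d
      simp only [kDiag, gCirc, r, Nat.lt_one_iff, hd]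
      split_ifs <;>
      · simp only [map_mul, map_add, map_one, map_neg, map_sub, map_pow, toSer_C, toSer_X_eq,
          toSer_mk_pow, map_ofNat]
        field_simp
        ring
  | CII s => exact ⟨_, _, h0 _, fun i => hG (CII s) ((CII s).dPar n) i⟩
  | DI s => exact ⟨_, _, h0 _, fun i => hG (DI s) ((DI s).dPar n) i⟩
  | C0 => exact ⟨_, _, h0 _, fun i => hG C0 (C0.dPar n) i⟩
  | D0 => exact ⟨_, _, h0 _, fun i => hG D0 (D0.dPar n) i⟩

end SeriesAtInfinity

/-! ### Matrix units on one factor of a tensor power. -/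

section SiteUnits

variable {S α R : Type*} [Fintype S] [DecidableEq S] [DecidableEq α]

theorem siteUnit_apply [Zero R] [One R] (s : S) (a b : α) (f g : S → α) :
    siteUnit R s a b f g = if f s = a ∧ g = Function.update f s b then 1 else 0 := by
  rw [siteUnit, Matrix.of_apply]
  refine if_congr ⟨?_, ?_⟩ rfl rfl
  · rintro ⟨rfl, rfl⟩
    simp
  · rintro ⟨rfl, rfl⟩
    simp

variable [Fintype α] [Semiring R]

theorem siteUnit_mul_apply {D : Type*} (s : S) (a b : α) (M : Matrix (S → α) D R) (f : S → α)
    (d : D) :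
    (siteUnit R s a b * M) f d = if f s = a then M (Function.update f s b) d else 0 := by
  simp only [Matrix.mul_apply, siteUnit_apply, ite_and, ite_mul, one_mul, zero_mul]
  by_cases h : f s = a <;> simp [h]

theorem siteUnit_mulVec (s : S) (a b : α) (ζ : (S → α) → R) (f : S → α) :
    (siteUnit R s a b).mulVec ζ f = if f s = a then ζ (Function.update f s b) else 0 := by
  simp only [Matrix.mulVec, dotProduct, siteUnit_apply, ite_and, ite_mul, one_mul, zero_mul]
  by_cases h : f s = a <;> simp [h]

theorem siteUnit_mul_siteUnit (s : S) (a b c d : α) :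
    siteUnit R s a b * siteUnit R s c d = if b = c then siteUnit R s a d else 0 := by
  ext f g
  rw [siteUnit_mul_apply]
  by_cases h : b = c <;> by_cases h' : f s = a <;> simp [h, h', siteUnit_apply]

theorem siteUnit_commute {s t : S} (h : s ≠ t) (a b c d : α) :
    Commute (siteUnit R s a b) (siteUnit R t c d) := by
  ext f g
  rw [siteUnit_mul_apply, siteUnit_mul_apply, siteUnit_apply, siteUnit_apply,
    Function.update_of_ne h.symm, Function.update_of_ne h, Function.update_comm h]
  by_cases h1 : f s = a <;> by_cases h2 : f t = c <;> simp [h1, h2]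

theorem sum_siteUnit_diag (s : S) : ∑ c : α, siteUnit R s c c = 1 := by
  ext f g
  simp only [Matrix.sum_apply, siteUnit_apply, ite_and, Finset.sum_ite_eq, Finset.mem_univ,
    if_true, Function.update_eq_self, Matrix.one_apply, eq_comm (a := f)]

theorem siteUnit_map {R' : Type*} [Semiring R'] (φ : R →+* R') (s : S) (a b : α) :
    (siteUnit R s a b).map φ = siteUnit R' s a b := by
  ext f g
  simp only [Matrix.map_apply, siteUnit_apply]
  split_ifs <;> simp

theorem update_comp_swap (f : S → α) {s t : S} (h : s ≠ t) (a : α) :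
    Function.update f t a ∘ Equiv.swap s t =
      Function.update (Function.update f s a) t (f s) := by
  funext x
  simp only [Function.comp_apply, Function.update_apply, Equiv.swap_apply_def]
  split_ifs <;> simp_all

/-- The product of two one-site matrices of units, on columns which are symmetric up to a sign. -/
theorem sum_siteUnit_mul_of_symm {A D : Type*} [CommRing A] {s t : S} (h : s ≠ t) (ε : A)
    (Y : Matrix (S → α) D A)
    (hY : ∀ f d, Y (f ∘ Equiv.swap s t) d = ε * Y f d) (a b : α) :
    (∑ c, siteUnit A s c a * siteUnit A t b c) * Y = ε • (siteUnit A t b a * Y) := by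
  ext f d
  simp only [Matrix.sum_mul, Matrix.sum_apply, Matrix.mul_assoc, siteUnit_mul_apply,
    Function.update_of_ne h.symm, Matrix.smul_apply, smul_eq_mul, Finset.sum_ite_eq,
    Finset.mem_univ, if_true]
  split_ifs with hb
  · rw [← hY, update_comp_swap f h]
  · simp

end SiteUnits

/-! ### Intertwiners for matrices of operators. -/

section Intertwining

variable {n : ℕ} {T T' D R : Type*} [Fintype T] [Fintype T'] [DecidableEq T] [DecidableEq T'] [Fintype D]
  [DecidableEq D] [CommRing R]

/-- `J` intertwines the entries of `X` and of `X'`. -/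
def Intertwines (J : Matrix T D R) (X : Matrix (Fin n) (Fin n) (Matrix T T R))
    (X' : Matrix (Fin n) (Fin n) (Matrix D D R)) : Prop :=
  ∀ a b, X a b * J = J * X' a b

namespace Intertwines

variable {J : Matrix T D R} {X Y : Matrix (Fin n) (Fin n) (Matrix T T R)}
  {X' Y' : Matrix (Fin n) (Fin n) (Matrix D D R)}

theorem mul (h : Intertwines J X X') (h' : Intertwines J Y Y') :
    Intertwines J (X * Y) (X' * Y') := by
  intro a b
  simp only [Matrix.mul_apply (M := X), Matrix.mul_apply (M := X'), Matrix.sum_mul, Matrix.mul_sum]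
  refine Finset.sum_congr rfl fun c _ => ?_
  rw [Matrix.mul_assoc, h', ← Matrix.mul_assoc, h, Matrix.mul_assoc]

theorem one : Intertwines J (1 : Matrix (Fin n) (Fin n) (Matrix T T R)) 1 := by
  intro a b
  simp only [Matrix.one_apply]
  split_ifs <;> simp

theorem lax (h : Intertwines J X X') (z : R) :
    Intertwines J (lax z X) (NestedChain.lax z X') := by
  intro a b
  have h1 := one (J := J) (n := n) a b
  simp only [NestedChain.lax, Matrix.sub_apply, Matrix.smul_apply, Matrix.sub_mul, Matrix.mul_sub] at h1 ⊢
  rw [h1, Matrix.smul_mul, h, Matrix.mul_smul]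

theorem smul (h : Intertwines J X X') (z : R) :
    Intertwines J (z • X) (z • X') := by
  intro a b
  simp only [Matrix.smul_apply]
  rw [Matrix.smul_mul, h, Matrix.mul_smul]

theorem list_prod {ι : Type*} (l : List ι) {X : ι → Matrix (Fin n) (Fin n) (Matrix T T R)}
    {X' : ι → Matrix (Fin n) (Fin n) (Matrix D D R)} (h : ∀ i ∈ l, Intertwines J (X i) (X' i)) :
    Intertwines J (l.map X).prod (l.map X').prod := by
  induction l with
  | nil => simpa using one
  | cons i l ih =>
    simp only [List.map_cons, List.prod_cons]
    exact (h i (by simp)).mul (ih fun j hj => h j (by simp [hj]))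

theorem diagonal (k : Fin n → R) :
    Intertwines J (Matrix.diagonal fun i => k i • (1 : Matrix T T R))
      (Matrix.diagonal fun i => k i • (1 : Matrix D D R)) := by
  intro a b
  simp only [Matrix.diagonal_apply]
  split_ifs <;> simp

theorem comp {D' : Type*} [Fintype D'] [DecidableEq D'] {K : Matrix D D' R}
    {X'' : Matrix (Fin n) (Fin n) (Matrix D' D' R)}
    (h : Intertwines J X X') (h' : Intertwines K X' X'') : Intertwines (J * K) X X'' := by
  intro a b
  rw [← Matrix.mul_assoc, h, Matrix.mul_assoc, h', Matrix.mul_assoc]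

end Intertwines

/-- The first block column of `X` acts on the image of `J` as `(X', 0)`. -/
def BlockIntertwines (Θ : Matrix T' T' R →ₐ[R] Matrix T T R) (J : Matrix T D R)
    (X : Matrix (Idx n) (Idx n) (Matrix T' T' R)) (X' : Matrix (Fin n) (Fin n) (Matrix D D R)) :
    Prop :=
  ∀ a b, Θ (X (.inl a) (.inl b)) * J = J * X' a b ∧ Θ (X (.inr a) (.inl b)) * J = 0

namespace BlockIntertwines

variable {Θ : Matrix T' T' R →ₐ[R] Matrix T T R} {J : Matrix T D R}
  {X Y : Matrix (Idx n) (Idx n) (Matrix T' T' R)} {X' Y' : Matrix (Fin n) (Fin n) (Matrix D D R)}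

/-- The terms passing through a lower intermediate index vanish, because the lower left entries of
`Y` annihilate the image of `J`. Thus upper left blocks multiply like ordinary matrices. -/
theorem mul (h : BlockIntertwines Θ J X X') (h' : BlockIntertwines Θ J Y Y') :
    BlockIntertwines Θ J (X * Y) (X' * Y') := by
  intro a b
  simp only [Matrix.mul_apply (M := X), Matrix.mul_apply (M := X'), Fintype.sum_sum_type, map_add,
    map_sum, map_mul, Matrix.add_mul, Matrix.sum_mul, Matrix.mul_sum, Matrix.mul_assoc, (h' _ _).1, (h' _ _).2, Matrix.mul_zero,
    Finset.sum_const_zero, add_zero]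
  simp only [← Matrix.mul_assoc, (h _ _).1, (h _ _).2, Matrix.zero_mul, Finset.sum_const_zero,
    and_self]

theorem one : BlockIntertwines Θ J (1 : Matrix (Idx n) (Idx n) (Matrix T' T' R)) 1 := by
  intro a b
  simp only [Matrix.one_apply, Sum.inl.injEq, reduceCtorEq, if_false, map_zero, Matrix.zero_mul,
    and_true]
  split_ifs <;> simp

theorem list_prod {ι : Type*} (l : List ι) {X : ι → Matrix (Idx n) (Idx n) (Matrix T' T' R)}
    {X' : ι → Matrix (Fin n) (Fin n) (Matrix D D R)} (h : ∀ i ∈ l, BlockIntertwines Θ J (X i) (X' i)) :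
    BlockIntertwines Θ J (l.map X).prod (l.map X').prod := by
  induction l with
  | nil => simpa using one
  | cons i l ih =>
    simp only [List.map_cons, List.prod_cons]
    exact (h i (by simp)).mul (ih fun j hj => h j (by simp [hj]))

theorem diagonal (k : Idx n → R) :
    BlockIntertwines Θ J (Matrix.diagonal fun i => k i • (1 : Matrix T' T' R))
      (Matrix.diagonal fun i => k (.inl i) • (1 : Matrix D D R)) := by
  intro a b
  simp only [Matrix.diagonal_apply, Sum.inl.injEq, reduceCtorEq, if_false, map_zero,
    Matrix.zero_mul, and_true]
  split_ifs <;> simp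

theorem smul (h : BlockIntertwines Θ J X X') (z : R) :
    BlockIntertwines Θ J (z • X) (z • X') := by
  intro a b
  simp only [Matrix.smul_apply, map_smul, Matrix.smul_mul, (h _ _).1, (h _ _).2, Matrix.mul_smul,
    smul_zero, and_self]

end BlockIntertwines

end Intertwining

/-! ### The index involution and the signs. -/

section Bar

variable {n : ℕ} (bd : Boundary)

theorem bar_bar (i : Idx n) : bar (bar i) = i := by
  cases i <;> simp [bar]

theorem bar_injective : Function.Injective (bar (n := n)) := fun i j h => by
  rw [← bar_bar i, h, bar_bar]

theorem theta_mul_self (i : Idx n) : bd.theta n i * bd.theta n i = 1 := by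
  cases i <;> simp only [Boundary.theta] <;> (try split_ifs) <;> norm_num

theorem eps_mul_self : bd.eps * bd.eps = 1 := by
  rw [Boundary.eps]; split_ifs <;> norm_num

end Bar

/-! ### Transposition of the auxiliary space. -/

section Transposition

variable {n : ℕ} {bd : Boundary} {A : Type*} [Ring A]

/-- Reversing the order of multiplication needs commuting entries; the intermediate signs cancel by
`theta_mul_self`. -/
theorem transp_mul {X Y : Matrix (Idx n) (Idx n) A} (h : ∀ i j k l, Commute (X i j) (Y k l)) :
    transp n bd (X * Y) = transp n bd Y * transp n bd X := by
  ext i j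
  simp only [transp, Matrix.of_apply, Matrix.mul_apply, Finset.smul_sum]
  let e : Idx n ≃ Idx n := ⟨bar, bar, bar_bar, bar_bar⟩
  rw [← e.sum_comp]
  refine Finset.sum_congr rfl fun c _ => ?_
  change _ • (X (bar j) (bar c) * Y (bar c) (bar i)) = _
  rw [(h _ _ _ _).eq, smul_mul_smul_comm]
  congr 1
  have := theta_mul_self bd c
  linear_combination (-(bd.theta n i * bd.theta n j)) * this

theorem transp_one : transp n bd (1 : Matrix (Idx n) (Idx n) A) = 1 := by
  ext i j
  simp only [transp, Matrix.of_apply, Matrix.one_apply, bar_injective.eq_iff, eq_comm (a := j)]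
  split_ifs with h
  · rw [h, theta_mul_self, one_smul]
  · simp

theorem transp_list_prod {ι : Type*} {l : List ι} (hl : l.Nodup) {X : ι → Matrix (Idx n) (Idx n) A}
    (h : ∀ s t, s ≠ t → ∀ i j k l, Commute (X s i j) (X t k l)) :
    transp n bd (l.map X).prod = (l.map fun s => transp n bd (X s)).reverse.prod := by
  induction l with
  | nil => simpa using transp_one
  | cons s l ih =>
    rw [List.nodup_cons] at hl
    obtain ⟨hs, hl⟩ := hl
    replace ih := ih hl
    have : ∀ i j k m, Commute (X s i j) ((l.map X).prod k m) := by
      clear ih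
      intro i j
      induction l with
      | nil =>
        intro k m
        simp only [List.map_nil, List.prod_nil, Matrix.one_apply]
        split_ifs
        · exact Commute.one_right _
        · exact Commute.zero_right _
      | cons t l ih =>
        intro k m
        simp only [List.mem_cons, not_or] at hs
        simp only [List.map_cons, List.prod_cons, Matrix.mul_apply]
        exact Commute.sum_right _ _ _ fun c _ =>
          (h s t hs.1 i j k c).mul_right (ih hs.2 (List.nodup_cons.1 hl).2 c m)
    simp only [List.map_cons, List.prod_cons, List.reverse_cons, List.prod_append, List.prod_nil,
      mul_one, transp_mul this, ih]

end Transposition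

/-! ### Collapse of products of Lax matrices on symmetric tensors. -/

section Fusion

variable {n : ℕ} {S R : Type*} [Fintype S] [DecidableEq S] [CommRing R]

/-- The generators of `𝔤𝔩ₙ` acting on the tensor factor `s`. -/
def siteGen (R : Type*) [CommRing R] (s : S) :
    Matrix (Fin n) (Fin n) (Matrix (S → Fin n) (S → Fin n) R) :=
  Matrix.of fun a b => siteUnit R s b a

theorem siteGen_apply (s : S) (a b : Fin n) : siteGen R s a b = siteUnit R s b a := rfl

/-- A product of one-site Lax matrices collapses on columns which are symmetric up to a sign. -/
theorem lax_prod_mul_of_symm {D : Type*} {r : ℕ} (e : Fin r → S) (he : Function.Injective e)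
    (ε : R) (β : ℕ → R) (hβ : ∀ j, β j = β (j + 1) * (1 - ε * β j)) (Y : Matrix (S → Fin n) D R)
    (hY : ∀ i j, i ≠ j → ∀ f d, Y (f ∘ Equiv.swap (e i) (e j)) d = ε * Y f d) (a b : Fin n) :
    (List.ofFn fun j : Fin r => lax (β j) (siteGen R (e j))).prod a b * Y =
      lax (β 0) (∑ j, siteGen R (e j)) a b * Y := by
  induction r generalizing β a b with
  | zero => simp [lax]
  | succ r ih =>
    have ih' := ih (fun j => e j.succ) (fun i j h => Fin.succ_injective _ (he h))
      (fun j => β (j + 1)) (fun j => hβ (j + 1))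
      (fun i j h => hY _ _ fun h' => h (Fin.succ_injective _ h'))
    set E' : Matrix (Fin n) (Fin n) (Matrix (S → Fin n) (S → Fin n) R) :=
      ∑ j : Fin r, siteGen R (e j.succ) with hE'
    rw [List.ofFn_succ, List.prod_cons, Matrix.mul_apply, Matrix.sum_mul]
    simp only [Matrix.mul_assoc, Fin.val_succ, Fin.val_zero]
    simp only [ih']
    -- A product of generators at two sites exchanges these two factors, which on `Y` is
    -- multiplication by `ε`.
    have key : ∀ a b, ((siteGen R (e 0) * E' : Matrix (Fin n) (Fin n) _) a b) * Y =
        ε • (E' a b * Y) := by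
      intro a b
      rw [hE', Finset.mul_sum, Matrix.sum_apply, Matrix.sum_apply, Matrix.sum_mul, Matrix.sum_mul,
        Finset.smul_sum]
      refine Finset.sum_congr rfl fun j _ => ?_
      have h0 : (0 : Fin (r + 1)) ≠ j.succ := (Fin.succ_ne_zero j).symm
      rw [siteGen_apply, ← sum_siteUnit_mul_of_symm (fun h => h0 (he h)) ε Y (hY _ _ h0),
        Matrix.mul_apply]
      rfl
    simp only [← Matrix.mul_assoc, ← Matrix.sum_mul]
    rw [← Matrix.mul_apply, Fin.sum_univ_succ, ← hE']
    have e1 : lax (β 0) (siteGen R (e 0)) * lax (β (0 + 1)) E' =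
        1 - β 0 • siteGen R (e 0) - β 1 • E' + (β 0 * β 1) • (siteGen R (e 0) * E') := by
      simp only [lax, zero_add, sub_mul, mul_sub, one_mul, mul_one, smul_mul_smul_comm]
      abel
    have e2 : lax (β 0) (siteGen R (e 0) + E') = 1 - β 0 • siteGen R (e 0) - β 0 • E' := by
      simp only [lax, smul_add]
      abel
    rw [e1, e2]
    simp only [Matrix.add_apply, Matrix.sub_apply, Matrix.smul_apply, Matrix.add_mul,
      Matrix.sub_mul, Matrix.smul_mul, key, smul_smul]
    -- Together with the quadratic term, the coefficient of `E'` is `β 1 - ε β 0 β 1`; the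
    -- recursion, modelled on `β j = 1/(z - ε j)`, makes it `β 0`.
    have e3 : β 0 = β 1 - β 0 * β 1 * ε := by
      rw [hβ 0]; linear_combination (-ε * β 1) * hβ 0
    nth_rewrite 4 [e3]
    rw [sub_smul]
    abel

end Fusion

/-! ### Zamolodchikov's matrix on the upper tensors. -/

section Zamolodchikov

variable {n : ℕ} (bd : Boundary) {S' S T R : Type*} [Fintype S'] [DecidableEq S'] [Fintype S]
  [DecidableEq S] [Fintype T] [DecidableEq T] [CommRing R]

/-- The matrix `1 - α P + β Q` in the auxiliary space. -/
def zamGen (n : ℕ) (s : S') (α β : R) :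
    Matrix (Idx n) (Idx n) (Matrix (S' → Idx n) (S' → Idx n) R) :=
  Matrix.of fun i j => (if i = j then 1 else 0) - α • siteUnit R s j i
    + β • (bd.theta n i * bd.theta n j) • siteUnit R s (bar i) (bar j)

/-- A product of matrices `1 - α P + β Q`. -/
def fusedGen (n k : ℕ) (e : Fin k → S') (α β : Fin k → R) :
    Matrix (Idx n) (Idx n) (Matrix (S' → Idx n) (S' → Idx n) R) :=
  (List.ofFn fun j => zamGen bd n (e j) (α j) (β j)).prod

theorem zamGen_commute {s t : S'} (h : s ≠ t) (α β α' β' : R) (i j k l : Idx n) :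
    Commute (zamGen bd n s α β i j) (zamGen bd n t α' β' k l) := by
  have h1 : ∀ a b c d, Commute (siteUnit R s a b) (siteUnit R t (c : Idx n) (d : Idx n)) :=
    fun a b c d => siteUnit_commute h a b c d
  have h2 : ∀ (p : Prop) [Decidable p] (M : Matrix (S' → Idx n) (S' → Idx n) R),
      Commute (if p then 1 else 0) M := fun p _ M => by
    split_ifs
    · exact Commute.one_left _
    · exact Commute.zero_left _
  simp only [zamGen, Matrix.of_apply]
  refine Commute.add_left (Commute.sub_left ?_ (Commute.smul_left ?_ _))
    (Commute.smul_left (Commute.smul_left ?_ _) _)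
  · exact h2 _ _
  all_goals
    exact Commute.add_right (Commute.sub_right (h2 _ _).symm (Commute.smul_right (h1 _ _ _ _) _))
      (Commute.smul_right (Commute.smul_right (h1 _ _ _ _) _) _)

/-- An embedding of `(ℂⁿ)^{⊗ S}` which is compatible with the action of the upper left blocks. -/
structure IsUpperEmbedding (Θ : Matrix (S' → Idx n) (S' → Idx n) R →ₐ[R] Matrix T T R)
    (φ : S' → S) (J : Matrix T (S → Fin n) R) : Prop where
  inl : ∀ s a b, Θ (siteUnit R s (.inl a) (.inl b)) * J = J * siteUnit R (φ s) a b
  inr : ∀ s x b, Θ (siteUnit R s x (.inr b)) * J = 0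

namespace IsUpperEmbedding

variable {bd} {Θ : Matrix (S' → Idx n) (S' → Idx n) R →ₐ[R] Matrix T T R}
  {φ : S' → S} {J : Matrix T (S → Fin n) R}

/-- The involution sends upper indices to lower ones, so the `Q` term kills the upper tensors and
only the permutation term survives, as a `𝔤𝔩ₙ` Lax matrix. -/
theorem zamGen (hJ : IsUpperEmbedding Θ φ J) (s : S') (α β : R) :
    BlockIntertwines Θ J (zamGen bd n s α β) (lax α (siteGen R (φ s))) := by
  intro a b
  constructor
  · simp only [NestedChain.zamGen, Matrix.of_apply, bar, map_add, map_sub, map_smul, Matrix.add_mul,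
      Matrix.sub_mul, Matrix.smul_mul, hJ.inl, hJ.inr, smul_zero, add_zero, lax, Matrix.sub_apply,
      Matrix.smul_apply, Matrix.mul_sub, Matrix.mul_smul, siteGen_apply, Sum.inl.injEq, map_zsmul]
    congr 1
    rw [Matrix.one_apply]
    split_ifs <;> simp
  · simp only [NestedChain.zamGen, Matrix.of_apply, bar, map_add, map_sub, map_smul, Matrix.add_mul,
      Matrix.sub_mul, Matrix.smul_mul, hJ.inr, smul_zero, add_zero, reduceCtorEq, if_false, map_zero,
      Matrix.zero_mul, map_zsmul, sub_zero]

/-- Transposition exchanges the roles of `P` and `Q`; now the former `Q` term survives with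
coefficient `+β`, whence the sign. -/
theorem transp_zamGen (hJ : IsUpperEmbedding Θ φ J) (s : S') (α β : R) :
    BlockIntertwines Θ J (transp n bd (NestedChain.zamGen bd n s α β))
      (lax (-β) (siteGen R (φ s))) := by
  intro a b
  constructor
  · have h' : bd.theta n (.inl a) * bd.theta n (.inl b) = 1 := by
      simp only [Boundary.theta]; split_ifs <;> norm_num
    simp only [transp, NestedChain.zamGen, Matrix.of_apply, bar, map_add, map_sub, map_smul,
      Matrix.add_mul, smul_add, smul_sub, Fin.rev_rev, smul_comm _ β,
      Matrix.sub_mul, Matrix.smul_mul, hJ.inl, hJ.inr, smul_zero, lax, Matrix.sub_apply,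
      Matrix.mul_sub, Sum.inr.injEq, map_zsmul, smul_smul, one_smul, neg_smul, sub_zero, h',
      Fin.rev_inj]
    rw [Matrix.one_apply]
    have h2 : bd.theta n (.inr b.rev) * bd.theta n (.inr a.rev) = 1 := by
      simp only [Boundary.theta]; norm_num
    simp only [eq_comm (a := b), h2]
    split_ifs <;> simp [siteGen_apply]
  · simp only [transp, NestedChain.zamGen, Matrix.of_apply, bar, map_add, map_sub, map_smul,
      Matrix.add_mul, smul_add, smul_sub, Fin.rev_rev,
      Matrix.sub_mul, Matrix.smul_mul, hJ.inr, smul_zero, add_zero, reduceCtorEq, if_false, map_zero,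
      Matrix.zero_mul, map_zsmul, sub_zero]

theorem fusedGen (hJ : IsUpperEmbedding Θ φ J) {k : ℕ} (e : Fin k → S') (α β : Fin k → R) :
    BlockIntertwines Θ J (fusedGen bd n k e α β) (List.ofFn fun j : Fin k =>
      lax (α j) (siteGen R (φ (e j)))).prod := by
  rw [NestedChain.fusedGen, List.ofFn_eq_map, List.ofFn_eq_map]
  exact BlockIntertwines.list_prod _ fun j _ => hJ.zamGen _ _ _

/-- The reversed indices come from the antimultiplicativity of the transposition. -/
theorem transp_fusedGen (hJ : IsUpperEmbedding Θ φ J) {k : ℕ} (e : Fin k → S')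
    (he : Function.Injective e) (α β : Fin k → R) :
    BlockIntertwines Θ J (transp n bd (NestedChain.fusedGen bd n k e α β)) (List.ofFn fun j : Fin k =>
      lax (-β j.rev) (siteGen R (φ (e j.rev)))).prod := by
  rw [NestedChain.fusedGen, List.ofFn_eq_map, List.ofFn_eq_map, transp_list_prod (List.nodup_finRange k)
    (fun s t h => zamGen_commute bd (fun h' => h (he h')) _ _ _ _), ← List.map_reverse,
    List.finRange_reverse, List.map_map]
  exact BlockIntertwines.list_prod _ fun j _ => hJ.transp_zamGen _ _ _

end IsUpperEmbedding

end Zamolodchikov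

/-! ### The fused Lax operator with general coefficients. -/

section Instances

variable (n : ℕ) (bd : Boundary) {S : Type*} [Fintype S] [DecidableEq S]

theorem fusedLax_eq (k : ℕ) (e : Fin k → S) (z : Ser) :
    fusedLax n bd k e z = fusedGen bd n k e (fun j => (z - cst (bd.eps * (j : ℂ)))⁻¹)
      (fun j => (z - cst (bd.eps * (j : ℂ)) - cst (bd.kappa n))⁻¹) := rfl

end Instances

/-! ### The monodromy matrices over an arbitrary coefficient ring. -/

section Monodromy

variable (bd : Boundary) {R : Type*} [CommRing R]

/-- The monodromy matrix, with arbitrary coefficients in a commutative ring. -/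
def monodromyGen (n : ℕ) {ℓ : ℕ} (k : Fin ℓ → ℕ) (g : R) (K : Idx n → R)
    (α β α' β' : ∀ i : Fin ℓ, Fin (k i) → R) :
    Matrix (Idx n) (Idx n) (Matrix (BulkIdx n k) (BulkIdx n k) R) :=
  g • ((List.ofFn fun i : Fin ℓ =>
        fusedGen bd n (k i) (fun j => (⟨i, j⟩ : Σ i : Fin ℓ, Fin (k i))) (α i) (β i)).prod
      * Matrix.diagonal (fun a => K a • 1)
      * (List.ofFn fun i : Fin ℓ =>
          transp n bd (fusedGen bd n (k i) (fun j => (⟨i, j⟩ : Σ i : Fin ℓ, Fin (k i)))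
            (α' i) (β' i))).reverse.prod)

theorem monodromy_eq (n : ℕ) (ρ : ℂ) {ℓ : ℕ} (k : Fin ℓ → ℕ) (c : Fin ℓ → ℂ) :
    monodromy n bd ρ k c = monodromyGen bd n k (bd.gScal n ρ) (bd.kDiag n ρ)
      (fun i j => (vv - cst (c i) - cst (bd.kappa n / 2) - cst (bd.eps * (j : ℂ)))⁻¹)
      (fun i j => (vv - cst (c i) - cst (bd.kappa n / 2) - cst (bd.eps * (j : ℂ)) -
        cst (bd.kappa n))⁻¹)
      (fun i j => (bd.vTilde n ρ - cst (c i) - cst (bd.kappa n / 2) - cst (bd.eps * (j : ℂ)))⁻¹)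
      (fun i j => (bd.vTilde n ρ - cst (c i) - cst (bd.kappa n / 2) - cst (bd.eps * (j : ℂ)) -
        cst (bd.kappa n))⁻¹) := rfl

/-- `I - α Q` in the auxiliary space. -/
def yangGen (n : ℕ) {ℓ : ℕ} (k : Fin ℓ → ℕ) {m : ℕ} (s : Fin m ⊕ Fin m) (α : R) :
    Matrix (Fin n) (Fin n) (Matrix (TotIdx n k m) (TotIdx n k m) R) :=
  Matrix.of fun i j => (if i = j then 1 else 0)
    - α • (siteUnit R s i.rev j.rev ⊗ₖ (1 : Matrix (BulkIdx n k) (BulkIdx n k) R))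

/-- The nested monodromy matrix, with arbitrary coefficients in a commutative ring. -/
def nestedGen {n : ℕ} {ℓ : ℕ} (k : Fin ℓ → ℕ) (m : ℕ) (α β : Fin m ⊕ Fin m → R)
    (N : Matrix (Idx n) (Idx n) (Matrix (BulkIdx n k) (BulkIdx n k) R)) :
    Matrix (Fin n) (Fin n) (Matrix (TotIdx n k m) (TotIdx n k m) R) :=
  (List.ofFn fun i : Fin m => yangGen n k (Sum.inl i) (α (.inl i))).prod
    * (List.ofFn fun i : Fin m => yangGen n k (Sum.inr i) (α (.inr i))).prod
    * Matrix.of (fun i j => (1 : Matrix (WIdx n m) (WIdx n m) R) ⊗ₖ N (Sum.inl i) (Sum.inl j))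
    * (List.ofFn fun i : Fin m => yangGen n k (Sum.inr i) (β (.inr i))).reverse.prod
    * (List.ofFn fun i : Fin m => yangGen n k (Sum.inl i) (β (.inl i))).reverse.prod

theorem nestedMonodromy_eq (n : ℕ) (ρ : ℂ) {ℓ : ℕ} (k : Fin ℓ → ℕ) (c : Fin ℓ → ℂ) {m : ℕ}
    (u w : Fin m → ℂ) :
    nestedMonodromy n bd ρ k c u w = nestedGen k m
      (Sum.elim (fun i => (cst (u i) - vv)⁻¹) (fun i => (cst (w i) - vv)⁻¹))
      (Sum.elim (fun i => (cst (bd.kappa n - u i - ρ) - vv + cst bd.eps)⁻¹)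
        (fun i => (cst (bd.kappa n - w i - ρ) - vv + cst bd.eps)⁻¹))
      (monodromy n bd ρ k c) := rfl

end Monodromy

/-! ### The nested monodromy matrix as a chain of Lax matrices. -/

section NestedIntertwining

variable {n : ℕ} {ℓ : ℕ} (k : Fin ℓ → ℕ) (m : ℕ) {R : Type*} [CommRing R]

/-- The tensor factors: those of `W`, and those of the bulk spaces. -/
abbrev Site : Type := (Fin m ⊕ Fin m) ⊕ (Σ i : Fin ℓ, Fin (k i))

/-- The operators on the right tensor factor. -/
def kronRight (R W B : Type*) [CommRing R] [Fintype W] [DecidableEq W] [Fintype B] [DecidableEq B] :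
    Matrix B B R →ₐ[R] Matrix (W × B) (W × B) R where
  toFun X := (1 : Matrix W W R) ⊗ₖ X
  map_one' := Matrix.one_kronecker_one
  map_mul' X Y := by rw [← Matrix.mul_kronecker_mul, one_mul]
  map_zero' := Matrix.kronecker_zero _
  map_add' X Y := Matrix.kronecker_add _ _ _
  commutes' r := by
    rw [Algebra.algebraMap_eq_smul_one, Algebra.algebraMap_eq_smul_one, Matrix.kronecker_smul,
      Matrix.one_kronecker_one]

theorem kronRight_apply {W B : Type*} [Fintype W] [DecidableEq W] [Fintype B] [DecidableEq B]
    (X : Matrix B B R) : kronRight R W B X = (1 : Matrix W W R) ⊗ₖ X := rfl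

variable {k m}

/-- The basis vector of the big tensor product attached to a function with values in `1, …, n`. -/
def upperIdx (g : Site k m → Fin n) : TotIdx n k m :=
  (fun s => g (.inl s), fun t => .inl (g (.inr t)))

theorem upperIdx_injective : Function.Injective (upperIdx (n := n) (k := k) (m := m)) := by
  intro g g' h
  simp only [upperIdx, Prod.mk.injEq, funext_iff, Sum.inl.injEq] at h
  funext s
  cases s with
  | inl s => exact h.1 s
  | inr t => exact h.2 t

/-- The matrix of the inclusion of the upper tensors. -/
def upperMat (n : ℕ) {ℓ : ℕ} (k : Fin ℓ → ℕ) (m : ℕ) (R : Type*) [CommRing R] :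
    Matrix (TotIdx n k m) (Site k m → Fin n) R :=
  Matrix.of fun q g => if q = upperIdx g then 1 else 0

theorem mul_upperMat_apply (M : Matrix (TotIdx n k m) (TotIdx n k m) R) (q : TotIdx n k m)
    (g : Site k m → Fin n) : (M * upperMat n k m R) q g = M q (upperIdx g) := by
  simp [Matrix.mul_apply, upperMat]

theorem siteUnit_apply' {S α : Type*} [Fintype S] [DecidableEq S] [DecidableEq α] (s : S) (a b : α)
    (f g : S → α) :
    siteUnit R s a b f g = if g s = b ∧ f = Function.update g s a then 1 else 0 := rfl

theorem upperMat_mul_siteUnit_apply (s : Site k m) (a b : Fin n) (q : TotIdx n k m)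
    (g : Site k m → Fin n) : (upperMat n k m R * siteUnit R s a b) q g =
      if g s = b ∧ q = upperIdx (Function.update g s a) then 1 else 0 := by
  simp only [Matrix.mul_apply, siteUnit_apply', upperMat, Matrix.of_apply, ite_and, mul_ite,
    mul_one, mul_zero]
  by_cases h : g s = b <;> simp [h]

theorem siteUnit_kron_mul_upperMat (s : Fin m ⊕ Fin m) (a b : Fin n) :
    (siteUnit R s a b ⊗ₖ (1 : Matrix (BulkIdx n k) (BulkIdx n k) R)) * upperMat n k m R =
      upperMat n k m R * siteUnit R (.inl s) a b := by
  ext q g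
  refine Eq.trans ?_ (upperMat_mul_siteUnit_apply (.inl s) a b q g).symm
  rw [mul_upperMat_apply, Matrix.kroneckerMap_apply, siteUnit_apply', Matrix.one_apply]
  simp only [ite_mul, one_mul, zero_mul, ← ite_and]
  refine if_congr ?_ rfl rfl
  have : upperIdx (Function.update g (.inl s) a) =
      (Function.update (upperIdx g).1 s a, (upperIdx g).2) := by
    simp only [upperIdx, Prod.mk.injEq]
    constructor
    · funext t; simp [Function.update_apply]
    · funext t; simp
  rw [this, Prod.ext_iff, and_assoc]
  rfl

theorem isUpperEmbedding_upperMat :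
    IsUpperEmbedding (n := n) (R := R) (S := Site k m) (kronRight R (WIdx n m) (BulkIdx n k)) .inr
      (upperMat n k m R) := by
  constructor
  · intro t a b
    ext q g
    refine Eq.trans ?_ (upperMat_mul_siteUnit_apply (.inr t) a b q g).symm
    rw [mul_upperMat_apply, kronRight_apply, Matrix.kroneckerMap_apply, siteUnit_apply',
      Matrix.one_apply]
    simp only [ite_mul, one_mul, zero_mul, ← ite_and]
    refine if_congr ?_ rfl rfl
    have : upperIdx (Function.update g (.inr t) a) =
        ((upperIdx g).1, Function.update (upperIdx g).2 t (.inl a)) := by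
      simp only [upperIdx, Prod.mk.injEq]
      constructor
      · funext s; simp
      · funext s
        simp only [Function.update_apply, Sum.inr.injEq]
        split_ifs <;> rfl
    rw [this, Prod.ext_iff]
    simp only [upperIdx, Sum.inl.injEq]
    tauto
  · intro t x b
    ext q g
    rw [mul_upperMat_apply, kronRight_apply, Matrix.kroneckerMap_apply, siteUnit_apply']
    simp [upperIdx]

/-- The indices of the one-site modules. -/
abbrev ModIdx (ℓ m : ℕ) : Type := Fin ℓ ⊕ (Fin m ⊕ Fin m)

/-- The order in which the one-site modules occur. -/
def modList (ℓ m : ℕ) : List (ModIdx ℓ m) :=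
  (List.finRange m).map (fun i => .inr (.inl i)) ++
    ((List.finRange m).map (fun i => .inr (.inr i)) ++ (List.finRange ℓ).map .inl)

theorem modList_nodup (ℓ m : ℕ) : (modList ℓ m).Nodup := by
  rw [modList, List.nodup_append, List.nodup_append]
  refine ⟨?_, ⟨?_, ?_, ?_⟩, ?_⟩
  · exact (List.nodup_finRange m).map fun i j h => by simpa using h
  · exact (List.nodup_finRange m).map fun i j h => by simpa using h
  · exact (List.nodup_finRange ℓ).map fun i j h => by simpa using h
  · simp
  · simp

theorem mem_modList {ℓ m : ℕ} (s : ModIdx ℓ m) : s ∈ modList ℓ m := by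
  rcases s with s | s | s <;> simp [modList]

/-- The generators of `𝔤𝔩ₙ` acting on a one-site module inside `(ℂⁿ)^{⊗ S}`. -/
def modGen (n : ℕ) {ℓ : ℕ} (k : Fin ℓ → ℕ) (m : ℕ) (R : Type*) [CommRing R] :
    ModIdx ℓ m → Matrix (Fin n) (Fin n) (Matrix (Site k m → Fin n) (Site k m → Fin n) R)
  | .inl i => ∑ j : Fin (k i), siteGen R (.inr ⟨i, j⟩)
  | .inr s => Matrix.of fun a b => -siteUnit R (.inl s) a.rev b.rev

variable {D : Type*} [Fintype D] [DecidableEq D]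

/-- Reduction to a chain with one site per bulk space and one per factor of `W`. On the upper
tensors each fused Lax operator is a product of `𝔤𝔩ₙ` Lax matrices, and the symmetry `hJ` of the
columns of `J` collapses it to one, with the coefficient of its first factor. For the transposed
operators the first factor is the last one of the original product, hence `j.rev` in `hβ`. -/
theorem nestedGen_mul (bd : Boundary) (J : Matrix (Site k m → Fin n) D R)
    {x : ModIdx ℓ m → Matrix (Fin n) (Fin n) (Matrix D D R)}
    (hx : ∀ s, Intertwines J (modGen n k m R s) (x s)) (ε : R)
    (hJ : ∀ i (j j' : Fin (k i)), j ≠ j' → ∀ f d,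
      J (f ∘ Equiv.swap (.inr ⟨i, j⟩) (.inr ⟨i, j'⟩)) d = ε * J f d)
    (g : R) (K : Idx n → R) (α β α' β' : ∀ i : Fin ℓ, Fin (k i) → R) (δ δ' : Fin ℓ → ℕ → R)
    (hδ : ∀ i j, δ i j = δ i (j + 1) * (1 - ε * δ i j))
    (hδ' : ∀ i j, δ' i j = δ' i (j + 1) * (1 - ε * δ' i j))
    (hα : ∀ i j, α i j = δ i j) (hβ : ∀ i (j : Fin (k i)), -β' i j.rev = δ' i j)
    (η η' : Fin m ⊕ Fin m → R) (a b : Fin n) :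
    nestedGen k m η η' (monodromyGen bd n k g K α β α' β') a b * (upperMat n k m R * J) =
      (upperMat n k m R * J) * (g • laxProd (modList ℓ m) x
        (Sum.elim (fun i => δ i 0) fun s => -η s) (Sum.elim (fun i => δ' i 0) fun s => -η' s)
        fun i => K (.inl i)) a b := by
  have hY : ∀ s z, Intertwines (upperMat n k m R * J) (yangGen n k s z)
      (lax (-z) (x (.inr s))) := by
    intro s z
    refine Intertwines.comp (X' := lax (-z) (modGen n k m R (.inr s))) ?_ ((hx (.inr s)).lax _)
    intro a b
    simp only [lax, neg_smul, sub_neg_eq_add, Matrix.add_apply]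
    simp only [yangGen, modGen, Matrix.of_apply, Matrix.smul_apply, Matrix.sub_mul, Matrix.mul_sub,
      Matrix.smul_mul, siteUnit_kron_mul_upperMat, Matrix.mul_smul, smul_neg, ← sub_eq_add_neg]
    congr 1
    rw [Matrix.one_apply]
    split_ifs <;> simp
  have hL : ∀ i, Intertwines J
      (List.ofFn fun j : Fin (k i) => lax (α i j) (siteGen R (Sum.inr ⟨i, j⟩ : Site k m))).prod
      (lax (δ i 0) (x (.inl i))) := by
    intro i a b
    simp only [hα]
    rw [lax_prod_mul_of_symm (fun j => (Sum.inr ⟨i, j⟩ : Site k m)) (fun j j' h => by simpa using h)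
      ε (δ i) (hδ i) J (hJ i)]
    exact (hx (.inl i)).lax (δ i 0) a b
  have hM : ∀ i, Intertwines J
      (List.ofFn fun j : Fin (k i) => lax (-β' i j.rev)
        (siteGen R (Sum.inr ⟨i, j.rev⟩ : Site k m))).prod
      (lax (δ' i 0) (x (.inl i))) := by
    intro i a b
    simp only [hβ]
    rw [lax_prod_mul_of_symm (fun j : Fin (k i) => (Sum.inr ⟨i, j.rev⟩ : Site k m))
      (fun j j' h => by simpa using h)
      ε (δ' i) (hδ' i) J (fun j j' h => hJ i j.rev j'.rev fun h' => h (Fin.rev_injective h'))]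
    have : ∑ j : Fin (k i), siteGen (n := n) R (Sum.inr ⟨i, j.rev⟩ : Site k m) =
        ∑ j : Fin (k i), siteGen R (.inr ⟨i, j⟩) :=
      Equiv.sum_comp Fin.revPerm fun j : Fin (k i) => siteGen (n := n) R (Sum.inr ⟨i, j⟩ : Site k m)
    rw [this]
    exact (hx (.inl i)).lax (δ' i 0) a b
  have hA : Intertwines (upperMat n k m R * J)
      (Matrix.of fun i j => (1 : Matrix (WIdx n m) (WIdx n m) R) ⊗ₖ
        monodromyGen bd n k g K α β α' β' (Sum.inl i) (Sum.inl j))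
      (g • (((List.finRange ℓ).map fun i => lax (δ i 0) (x (.inl i))).prod *
        Matrix.diagonal (fun i => K (.inl i) • 1) *
        ((List.finRange ℓ).reverse.map fun i => lax (δ' i 0) (x (.inl i))).prod)) := by
    have hE := isUpperEmbedding_upperMat (n := n) (k := k) (m := m) (R := R)
    have h1 := ((BlockIntertwines.list_prod (List.finRange ℓ) fun i _ =>
      hE.fusedGen (bd := bd) (fun j => (⟨i, j⟩ : Σ i : Fin ℓ, Fin (k i))) (α i) (β i)).mul
      (BlockIntertwines.diagonal K)).mul
      (BlockIntertwines.list_prod (List.finRange ℓ).reverse fun i _ =>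
        hE.transp_fusedGen (bd := bd) (fun j => (⟨i, j⟩ : Σ i : Fin ℓ, Fin (k i)))
          (fun j j' h => by simpa using h) (α' i) (β' i))
    refine Intertwines.comp (fun a b => ?_) ((((Intertwines.list_prod _ fun i _ => hL i).mul
      (Intertwines.diagonal _)).mul (Intertwines.list_prod _ fun i _ => hM i)).smul g)
    have h2 := ((h1.smul g) a b).1
    rw [monodromyGen, List.ofFn_eq_map, List.ofFn_eq_map, ← List.map_reverse]
    exact h2
  have key : Intertwines (upperMat n k m R * J)
      (nestedGen k m η η' (monodromyGen bd n k g K α β α' β'))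
      (g • laxProd (modList ℓ m) x
        (Sum.elim (fun i => δ i 0) fun s => -η s) (Sum.elim (fun i => δ' i 0) fun s => -η' s)
        fun i => K (.inl i)) := by
    have e : g • laxProd (modList ℓ m) x
        (Sum.elim (fun i => δ i 0) fun s => -η s) (Sum.elim (fun i => δ' i 0) fun s => -η' s)
        (fun i => K (.inl i)) =
        ((List.finRange m).map fun i => lax (-η (.inl i)) (x (.inr (.inl i)))).prod *
        ((List.finRange m).map fun i => lax (-η (.inr i)) (x (.inr (.inr i)))).prod *
        (g • (((List.finRange ℓ).map fun i => lax (δ i 0) (x (.inl i))).prod *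
          Matrix.diagonal (fun i => K (.inl i) • 1) *
          ((List.finRange ℓ).reverse.map fun i => lax (δ' i 0) (x (.inl i))).prod)) *
        ((List.finRange m).reverse.map fun i => lax (-η' (.inr i)) (x (.inr (.inr i)))).prod *
        ((List.finRange m).reverse.map fun i => lax (-η' (.inl i)) (x (.inr (.inl i)))).prod := by
      simp only [laxProd, chain, modList, List.map_append, List.map_map, List.reverse_append,
        List.prod_append, Function.comp_def, Sum.elim_inl, Sum.elim_inr, List.map_reverse,
        mul_assoc, smul_mul_assoc, mul_smul_comm]
    rw [e, nestedGen]
    simp only [List.ofFn_eq_map, ← List.map_reverse]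
    exact ((((Intertwines.list_prod _ fun i _ => hY _ _).mul
      (Intertwines.list_prod _ fun i _ => hY _ _)).mul hA).mul
      (Intertwines.list_prod _ fun i _ => hY _ _)).mul (Intertwines.list_prod _ fun i _ => hY _ _)
  exact key a b

end NestedIntertwining

/-! ### The Yang–Baxter equation from the Brauer relations. -/

section YangBaxter

/-- The relations of the Brauer algebra on three strands which express all the products of the
generators in terms of its basis. -/
structure BrauerTriple {A : Type*} [Ring A] [Algebra ℂ A] (ε N : ℂ) (p q r a b c : A) : Prop where
  pp : p * p = 1
  rr : r * r = 1
  pq : p * q = r * p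
  qr : q * r = r * p
  qp : q * p = p * r
  rq : r * q = p * r
  pa : p * a = ε • a
  ap : a * p = ε • a
  rc : r * c = ε • c
  cr : c * r = ε • c
  pb : p * b = c * p
  pc : p * c = b * p
  qa : q * a = c * q
  qc : q * c = a * q
  ra : r * a = b * r
  rb : r * b = a * r
  aa : a * a = N • a
  cc : c * c = N • c
  ab : a * b = a * r
  ba : b * a = b * r
  ac : a * c = a * q
  ca : c * a = c * q
  bc : b * c = b * p
  cb : c * b = c * p

/-- The relations reduce every word to normal form, and the difference of the two sides is governed
by four scalar identities. The last of them, the coefficient of `a * q` and `c * q`, holds because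
the loop value is `2 (κ + ε)`, that is, `2n`. -/
theorem BrauerTriple.yang_baxter {A : Type*} [Ring A] [Algebra ℂ A] {ε κ : ℂ}
    {p q r a b c : A} (h : BrauerTriple ε (2 * (κ + ε)) p q r a b c) {u v : ℂ} (hu : u ≠ 0)
    (hv : v ≠ 0) (huv : u + v ≠ 0) (hu' : u - κ ≠ 0) (hv' : v - κ ≠ 0) (huv' : u + v - κ ≠ 0) :
    (1 - u⁻¹ • p + (u - κ)⁻¹ • a) * (1 - (u + v)⁻¹ • q + (u + v - κ)⁻¹ • b) *
        (1 - v⁻¹ • r + (v - κ)⁻¹ • c) =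
      (1 - v⁻¹ • r + (v - κ)⁻¹ • c) * (1 - (u + v)⁻¹ • q + (u + v - κ)⁻¹ • b) *
        (1 - u⁻¹ • p + (u - κ)⁻¹ • a) := by
  have t1 : p * q * r = q := by rw [mul_assoc, h.qr, ← mul_assoc, ← h.qp, mul_assoc, h.pp, mul_one]
  have t1' : r * q * p = q := by rw [mul_assoc, h.qp, ← mul_assoc, ← h.qr, mul_assoc, h.rr, mul_one]
  have t2 : p * q * c = ε • (a * q) := by rw [mul_assoc, h.qc, ← mul_assoc, h.pa, smul_mul_assoc]
  have t2' : r * q * a = ε • (c * q) := by rw [mul_assoc, h.qa, ← mul_assoc, h.rc, smul_mul_assoc]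
  have t3 : p * b * r = ε • (c * q) := by
    rw [h.pb, mul_assoc, ← h.rq, ← mul_assoc, h.cr, smul_mul_assoc]
  have t3' : r * b * p = ε • (a * q) := by
    rw [h.rb, mul_assoc, ← h.pq, ← mul_assoc, h.ap, smul_mul_assoc]
  have t4 : p * b * c = c := by rw [mul_assoc, h.bc, ← mul_assoc, h.pb, mul_assoc, h.pp, mul_one]
  have t4' : r * b * a = a := by rw [mul_assoc, h.ba, ← mul_assoc, h.rb, mul_assoc, h.rr, mul_one]
  have t5 : a * q * r = ε • (a * q) := by
    rw [mul_assoc, h.qr, ← h.pq, ← mul_assoc, h.ap, smul_mul_assoc]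
  have t5' : c * q * p = ε • (c * q) := by
    rw [mul_assoc, h.qp, ← h.rq, ← mul_assoc, h.cr, smul_mul_assoc]
  have t6 : a * q * c = (2 * (κ + ε)) • (a * q) := by
    rw [mul_assoc, h.qc, ← mul_assoc, h.aa, smul_mul_assoc]
  have t6' : c * q * a = (2 * (κ + ε)) • (c * q) := by
    rw [mul_assoc, h.qa, ← mul_assoc, h.cc, smul_mul_assoc]
  have t7 : a * b * r = a := by rw [h.ab, mul_assoc, h.rr, mul_one]
  have t7' : c * b * p = c := by rw [h.cb, mul_assoc, h.pp, mul_one]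
  have t8 : a * b * c = ε • (a * q) := by rw [h.ab, mul_assoc, h.rc, mul_smul_comm, h.ac]
  have t8' : c * b * a = ε • (c * q) := by rw [h.cb, mul_assoc, h.pa, mul_smul_comm, h.ca]
  simp only [add_mul, sub_mul, mul_add, mul_sub, one_mul, mul_one, smul_mul_assoc, mul_smul_comm,
    t1, t2, t3, t4, t5, t6, t7, t8, t1', t2', t3', t4', t5', t6', t7', t8']
  simp only [h.pq, h.qr, h.qp, h.rq, h.pb, h.pc, h.qa, h.qc, h.ra, h.rb, h.ab, h.ba, h.ac, h.ca,
    h.bc, h.cb, smul_smul]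
  have h1 : (u⁻¹ * (u + v)⁻¹ + (u + v)⁻¹ * v⁻¹ - u⁻¹ * v⁻¹ : ℂ) = 0 := by
    field_simp; ring
  have h2 : (u⁻¹ * (v - κ)⁻¹ - u⁻¹ * (u + v - κ)⁻¹ - (u + v - κ)⁻¹ * (v - κ)⁻¹ : ℂ) = 0 := by
    field_simp; ring
  have h3 : (v⁻¹ * (u - κ)⁻¹ - v⁻¹ * (u + v - κ)⁻¹ - (u + v - κ)⁻¹ * (u - κ)⁻¹ : ℂ) = 0 := by
    field_simp; ring
  have h4 : (-((u - κ)⁻¹ * (u + v)⁻¹) + (u - κ)⁻¹ * (v - κ)⁻¹ - (u + v)⁻¹ * (v - κ)⁻¹ +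
      ε * (u⁻¹ * (u + v)⁻¹ * (v - κ)⁻¹ + (u + v)⁻¹ * v⁻¹ * (u - κ)⁻¹ +
        (u - κ)⁻¹ * (u + v - κ)⁻¹ * (v - κ)⁻¹ - u⁻¹ * v⁻¹ * (u + v - κ)⁻¹) -
      2 * (κ + ε) * (u - κ)⁻¹ * (u + v)⁻¹ * (v - κ)⁻¹ : ℂ) = 0 := by
    field_simp; ring
  generalize u⁻¹ = α₁ at *
  generalize v⁻¹ = α₃ at *
  generalize (u + v)⁻¹ = α₂ at *
  generalize (u - κ)⁻¹ = β₁ at *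
  generalize (v - κ)⁻¹ = β₃ at *
  generalize (u + v - κ)⁻¹ = β₂ at *
  linear_combination (norm := module) h1 • (r * p) - h1 • (p * r) + h2 • (c * p) - h2 • (b * p)
    - h3 • (a * r) + h3 • (b * r) + h4 • (a * q) - h4 • (c * q)

end YangBaxter

/-! ### Permutations and contractions of tensor factors satisfy the Brauer relations. -/

section BrauerOperators

variable {n : ℕ} (bd : Boundary) {S : Type*} [Fintype S] [DecidableEq S]

/-- The operator permuting two tensor factors. -/
def permOp (n : ℕ) (s t : S) : Matrix (S → Idx n) (S → Idx n) ℂ :=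
  ∑ i : Idx n, ∑ j : Idx n, siteUnit ℂ s i j * siteUnit ℂ t j i

/-- The operator obtained by transposing the permutation of two tensor factors. -/
def contrOp (n : ℕ) (s t : S) : Matrix (S → Idx n) (S → Idx n) ℂ :=
  ∑ i : Idx n, ∑ j : Idx n, (bd.theta n i * bd.theta n j) •
    (siteUnit ℂ s i j * siteUnit ℂ t (bar i) (bar j))

theorem permOp_mulVec {s t : S} (h : s ≠ t) (ζ : (S → Idx n) → ℂ) (f : S → Idx n) :
    (permOp n s t).mulVec ζ f = ζ (f ∘ Equiv.swap s t) := by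
  simp only [permOp, Matrix.sum_mulVec, Finset.sum_apply, ← Matrix.mulVec_mulVec, siteUnit_mulVec,
    Function.update_of_ne h.symm, Finset.sum_ite_eq, Finset.mem_univ, if_true,
    Finset.sum_ite_irrel, Finset.sum_const_zero]
  congr 1
  funext x
  simp only [Function.comp_apply, Function.update_apply, Equiv.swap_apply_def]
  split_ifs <;> simp_all

/-- The contraction of two tensor factors. -/
def contr {n : ℕ} (s t : S) (ζ : (S → Idx n) → ℂ) (f : S → Idx n) : ℂ :=
  ∑ j, bd.theta n j • ζ (Function.update (Function.update f s j) t (bar j))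

theorem contrOp_mulVec {s t : S} (h : s ≠ t) (ζ : (S → Idx n) → ℂ) (f : S → Idx n) :
    (contrOp bd n s t).mulVec ζ f =
      if f t = bar (f s) then bd.theta n (f s) • contr bd s t ζ f else 0 := by
  simp only [contrOp, Matrix.sum_mulVec, Finset.sum_apply, ← Matrix.mulVec_mulVec, siteUnit_mulVec,
    Matrix.smul_mulVec, Pi.smul_apply, Function.update_of_ne h.symm, smul_ite, smul_zero,
    Finset.sum_ite_irrel, Finset.sum_const_zero, Finset.sum_ite_eq, Finset.mem_univ, if_true,
    contr, Finset.smul_sum, mul_smul]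

theorem matrix_ext_mulVec {X : Type*} [Fintype X] [DecidableEq X] {M N : Matrix X X ℂ}
    (h : ∀ ζ f, M.mulVec ζ f = N.mulVec ζ f) : M = N :=
  Matrix.mulVec_injective (funext fun ζ => funext fun f => h ζ f)

theorem permOp_comm (s t : S) (h : s ≠ t) : permOp n s t = permOp n t s :=
  matrix_ext_mulVec fun ζ f => by rw [permOp_mulVec h, permOp_mulVec h.symm, Equiv.swap_comm]

theorem permOp_mul_self {s t : S} (h : s ≠ t) : permOp n s t * permOp n s t = 1 :=
  matrix_ext_mulVec fun ζ f => by
    rw [← Matrix.mulVec_mulVec, permOp_mulVec h, permOp_mulVec h, Matrix.one_mulVec]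
    congr 1
    funext x
    simp

theorem permOp_mul_permOp {s t a b : S} (h : s ≠ t) (h' : a ≠ b) :
    permOp n s t * permOp n a b =
      permOp n (Equiv.swap s t a) (Equiv.swap s t b) * permOp n s t :=
  matrix_ext_mulVec fun ζ f => by
    rw [← Matrix.mulVec_mulVec, ← Matrix.mulVec_mulVec, permOp_mulVec h, permOp_mulVec h',
      permOp_mulVec (fun e => h' ((Equiv.swap s t).injective e)), permOp_mulVec h]
    congr 1
    rw [Function.comp_assoc, Function.comp_assoc]
    congr 1
    funext x
    simp only [Function.comp_apply, Equiv.swap_apply_apply, Equiv.Perm.mul_apply, Equiv.swap_inv]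
    simp

theorem permOp_mul_contrOp {s t a b : S} (h : s ≠ t) (h' : a ≠ b) :
    permOp n s t * contrOp bd n a b =
      contrOp bd n (Equiv.swap s t a) (Equiv.swap s t b) * permOp n s t :=
  matrix_ext_mulVec fun ζ f => by
    rw [← Matrix.mulVec_mulVec, ← Matrix.mulVec_mulVec, permOp_mulVec h, contrOp_mulVec bd h',
      contrOp_mulVec bd (fun e => h' ((Equiv.swap s t).injective e))]
    simp only [Function.comp_apply, contr, permOp_mulVec h]
    congr 3
    funext j
    congr 2
    funext x
    simp only [Function.comp_apply, Function.update_apply, Equiv.apply_eq_iff_eq]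

theorem sum_bar {A : Type*} [AddCommMonoid A] (F : Idx n → A) : ∑ j, F (bar j) = ∑ j, F j :=
  (⟨bar, bar, bar_bar, bar_bar⟩ : Idx n ≃ Idx n).sum_comp F

theorem theta_bar (i : Idx n) : (bd.theta n (bar i) : ℂ) = bd.eps * bd.theta n i := by
  cases i <;> simp only [Boundary.theta, Boundary.eps, bar] <;> split_ifs <;> norm_num

theorem permOp_mul_contrOp_self {s t : S} (h : s ≠ t) :
    permOp n s t * contrOp bd n s t = bd.eps • contrOp bd n s t :=
  matrix_ext_mulVec fun ζ f => by
    rw [← Matrix.mulVec_mulVec, permOp_mulVec h, contrOp_mulVec bd h, Matrix.smul_mulVec,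
      Pi.smul_apply, contrOp_mulVec bd h]
    have e : contr bd s t ζ (f ∘ Equiv.swap s t) = contr bd s t ζ f := by
      simp only [contr]
      congr 1
      funext j
      congr 2
      funext x
      simp only [Function.comp_apply, Function.update_apply, Equiv.swap_apply_def]
      split_ifs <;> rfl
    simp only [Function.comp_apply, Equiv.swap_apply_left, Equiv.swap_apply_right, e]
    by_cases h1 : f t = bar (f s)
    · have h2 : f s = bar (f t) := by rw [h1, bar_bar]
      rw [if_pos h1, if_pos h2, h1, ← Int.cast_smul_eq_zsmul ℂ, theta_bar,
        ← Int.cast_smul_eq_zsmul ℂ, mul_smul]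
    · have h2 : f s ≠ bar (f t) := fun h2 => h1 (by rw [h2, bar_bar])
      rw [if_neg h1, if_neg h2, smul_zero]

theorem contrOp_mul_permOp_self {s t : S} (h : s ≠ t) :
    contrOp bd n s t * permOp n s t = bd.eps • contrOp bd n s t :=
  matrix_ext_mulVec fun ζ f => by
    rw [← Matrix.mulVec_mulVec, contrOp_mulVec bd h, Matrix.smul_mulVec,
      Pi.smul_apply, contrOp_mulVec bd h]
    have e : contr bd s t ((permOp n s t).mulVec ζ) f = bd.eps • contr bd s t ζ f := by
      simp only [contr, permOp_mulVec h]
      rw [← sum_bar, Finset.smul_sum]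
      refine Finset.sum_congr rfl fun j _ => ?_
      rw [bar_bar, ← Int.cast_smul_eq_zsmul ℂ, theta_bar, ← Int.cast_smul_eq_zsmul ℂ, mul_smul]
      congr 3
      funext x
      simp only [Function.comp_apply, Function.update_apply, Equiv.swap_apply_def]
      split_ifs <;> simp_all
    rw [e, smul_ite, smul_zero, smul_comm]

theorem contrOp_mul_self {s t : S} (h : s ≠ t) :
    contrOp bd n s t * contrOp bd n s t = (2 * n : ℂ) • contrOp bd n s t :=
  matrix_ext_mulVec fun ζ f => by
    rw [← Matrix.mulVec_mulVec, contrOp_mulVec bd h, Matrix.smul_mulVec,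
      Pi.smul_apply, contrOp_mulVec bd h]
    have e : contr bd s t ((contrOp bd n s t).mulVec ζ) f = (2 * n : ℂ) • contr bd s t ζ f := by
      have : ∀ j, bd.theta n j • (contrOp bd n s t).mulVec ζ
          (Function.update (Function.update f s j) t (bar j)) = contr bd s t ζ f := by
        intro j
        rw [contrOp_mulVec bd h, Function.update_self, Function.update_of_ne h,
          Function.update_self, if_pos rfl, smul_smul, theta_mul_self, one_smul]
        simp only [contr]
        congr 1
        funext i
        congr 2
        funext x
        simp only [Function.update_apply]
        split_ifs <;> rfl
      rw [contr]
      simp only [this, Finset.sum_const, Finset.card_univ, Fintype.card_sum, Fintype.card_fin,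
        ← Nat.cast_smul_eq_nsmul ℂ]
      push_cast
      rw [two_mul]
    rw [e, smul_ite, smul_zero, smul_comm]

theorem contrOp_mul_contrOp {a b c : S} (hab : a ≠ b) (hac : a ≠ c) (hbc : b ≠ c) :
    contrOp bd n a b * contrOp bd n a c = contrOp bd n a b * permOp n b c :=
  matrix_ext_mulVec fun ζ f => by
    rw [← Matrix.mulVec_mulVec, contrOp_mulVec bd hab, ← Matrix.mulVec_mulVec,
      contrOp_mulVec bd hab]
    have e : contr bd a b ((contrOp bd n a c).mulVec ζ) f =
        contr bd a b ((permOp n b c).mulVec ζ) f := by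
      simp only [contr, contrOp_mulVec bd hac, permOp_mulVec hbc]
      rw [← sum_bar]
      simp only [Function.update_of_ne hac.symm, Function.update_of_ne hbc.symm,
        Function.update_of_ne hab, Function.update_self, bar_bar]
      rw [Finset.sum_eq_single (f c)]
      · rw [if_pos rfl, smul_smul, theta_mul_self, one_smul]
        refine Finset.sum_congr rfl fun j _ => ?_
        congr 2
        funext x
        simp only [Function.comp_apply, Function.update_apply, Equiv.swap_apply_def]
        split_ifs <;> simp_all
      · intro j _ hj
        rw [if_neg hj.symm, smul_zero]
      · simp
    rw [e]

theorem contrOp_comm {s t : S} (h : s ≠ t) : contrOp bd n s t = contrOp bd n t s := by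
  have h1 := permOp_mul_contrOp (n := n) bd h h
  rw [Equiv.swap_apply_left, Equiv.swap_apply_right, permOp_mul_contrOp_self bd h,
    permOp_comm s t h, contrOp_mul_permOp_self bd h.symm] at h1
  have h2 := congrArg (fun M => bd.eps • M) h1
  simpa only [smul_smul, eps_mul_self, one_smul] using h2

theorem brauerTriple (n : ℕ) {s t w : S} (hst : s ≠ t) (hsw : s ≠ w) (htw : t ≠ w) :
    BrauerTriple bd.eps (2 * (bd.kappa n + bd.eps)) (permOp n s t) (permOp n s w) (permOp n t w)
      (contrOp bd n s t) (contrOp bd n s w) (contrOp bd n t w) := by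
  have e1 : ∀ a b c : S, a ≠ c → b ≠ c → Equiv.swap a b c = c := fun a b c h h' =>
    Equiv.swap_apply_of_ne_of_ne h.symm h'.symm
  have eN : (2 * (bd.kappa n + bd.eps) : ℂ) = 2 * n := by rw [Boundary.kappa]; ring
  have c1 := permOp_comm (n := n) s t hst
  have c2 := permOp_comm (n := n) s w hsw
  have c3 := permOp_comm (n := n) t w htw
  have d1 := contrOp_comm (n := n) bd hst
  have d2 := contrOp_comm (n := n) bd hsw
  have d3 := contrOp_comm (n := n) bd htw
  have f1 := e1 s t w hsw htw
  have f2 := e1 s w t hst htw.symm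
  have f3 := e1 t w s hst.symm hsw.symm
  have pq : permOp n s t * permOp n s w = permOp n t w * permOp n s t := by
    rw [permOp_mul_permOp hst hsw, Equiv.swap_apply_left, f1]
  have rq : permOp n t w * permOp n s w = permOp n s t * permOp n t w := by
    rw [permOp_mul_permOp htw hsw, Equiv.swap_apply_right, f3]
  constructor
  · exact permOp_mul_self hst
  · exact permOp_mul_self htw
  · exact pq
  · rw [permOp_mul_permOp hsw htw, Equiv.swap_apply_right, f2, ← c1, pq]
  · rw [permOp_mul_permOp hsw hst, Equiv.swap_apply_left, f2, ← c3, rq]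
  · exact rq
  · exact permOp_mul_contrOp_self bd hst
  · exact contrOp_mul_permOp_self bd hst
  · exact permOp_mul_contrOp_self bd htw
  · exact contrOp_mul_permOp_self bd htw
  · rw [permOp_mul_contrOp bd hst hsw, Equiv.swap_apply_left, f1]
  · rw [permOp_mul_contrOp bd hst htw, Equiv.swap_apply_right, f1]
  · rw [permOp_mul_contrOp bd hsw hst, Equiv.swap_apply_left, f2, d3]
  · rw [permOp_mul_contrOp bd hsw htw, Equiv.swap_apply_right, f2, d1]
  · rw [permOp_mul_contrOp bd htw hst, Equiv.swap_apply_left, f3]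
  · rw [permOp_mul_contrOp bd htw hsw, Equiv.swap_apply_right, f3]
  · rw [eN, contrOp_mul_self bd hst]
  · rw [eN, contrOp_mul_self bd htw]
  · exact contrOp_mul_contrOp bd hst hsw htw
  · rw [contrOp_mul_contrOp bd hsw hst htw.symm, c3]
  · rw [d1, contrOp_mul_contrOp bd hst.symm htw hsw]
  · rw [d1, contrOp_mul_contrOp bd htw hst.symm hsw.symm, c2]
  · rw [d2, d3, contrOp_mul_contrOp bd hsw.symm htw.symm hst]
  · rw [d2, d3, contrOp_mul_contrOp bd htw.symm hsw.symm hst.symm, c1]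

end BrauerOperators

/-! ### Rearranging ordered products by the Yang–Baxter equation. -/

section OrderedProducts

/-- The factor `R t (t + 1)` ends the group `b = t + 1`. Yang–Baxter moves it to the left through
the groups `b = t + 1` and `b = t`, exchanging them, and it commutes with all earlier groups. So any
adjacent factor can be brought to the front of the fusion operator. -/
theorem exists_prod_eq_mul_of_yang_baxter {M : Type*} [Monoid M] (R : ℕ → ℕ → M) {k t : ℕ}
    (ht : t + 1 < k)
    (hyb : ∀ a < t, R a t * R a (t + 1) * R t (t + 1) = R t (t + 1) * R a (t + 1) * R a t)
    (hc : ∀ a b c d, a < b → c < d → b < k → d < k → a ≠ c → a ≠ d → b ≠ c → b ≠ d →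
      Commute (R a b) (R c d)) :
    ∃ X, ((List.range k).map fun b => ((List.range b).map fun a => R a b).prod).prod =
      R t (t + 1) * X := by
  set r := R t (t + 1) with hr
  have hrtt : ∀ j ≤ t, ((List.range j).map fun a => R a t).prod *
      ((List.range j).map fun a => R a (t + 1)).prod * r =
      r * ((List.range j).map fun a => R a (t + 1)).prod *
        ((List.range j).map fun a => R a t).prod := by
    intro j
    induction j with
    | zero => intro _; simp
    | succ j ih =>
      intro hj
      have h1 : Commute (R j t) ((List.range j).map fun a => R a (t + 1)).prod :=
        Commute.list_prod_right _ _ fun x hx => by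
          obtain ⟨a, ha, rfl⟩ := List.mem_map.1 hx
          rw [List.mem_range] at ha
          exact hc _ _ _ _ (by omega) (by omega) (by omega) (by omega) (by omega) (by omega)
            (by omega) (by omega)
      have h2 : Commute (R j (t + 1)) ((List.range j).map fun a => R a t).prod :=
        Commute.list_prod_right _ _ fun x hx => by
          obtain ⟨a, ha, rfl⟩ := List.mem_map.1 hx
          rw [List.mem_range] at ha
          exact hc _ _ _ _ (by omega) (by omega) (by omega) (by omega) (by omega) (by omega)
            (by omega) (by omega)
      have ih := ih (by omega)
      have hy := hyb j (by omega)
      simp only [List.range_succ, List.map_append, List.map_cons, List.map_nil, List.prod_append,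
        List.prod_cons, List.prod_nil, mul_one]
      generalize ((List.range j).map fun a => R a t).prod = L at *
      generalize ((List.range j).map fun a => R a (t + 1)).prod = N at *
      calc L * R j t * (N * R j (t + 1)) * r = L * (R j t * N) * (R j (t + 1) * r) := by
            simp only [mul_assoc]
        _ = L * N * (R j t * R j (t + 1) * r) := by rw [h1.eq]; simp only [mul_assoc]
        _ = (L * N * r) * R j (t + 1) * R j t := by rw [hy]; simp only [mul_assoc]
        _ = r * N * (L * R j (t + 1)) * R j t := by rw [ih]; simp only [mul_assoc]
        _ = r * (N * R j (t + 1)) * (L * R j t) := by rw [← h2.eq]; simp only [mul_assoc]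
  have hcomm : Commute ((List.range t).map fun b => ((List.range b).map fun a => R a b).prod).prod
      r :=
    Commute.list_prod_left _ _ fun x hx => by
      obtain ⟨b, hb, rfl⟩ := List.mem_map.1 hx
      rw [List.mem_range] at hb
      refine Commute.list_prod_left _ _ fun y hy => ?_
      obtain ⟨a, ha, rfl⟩ := List.mem_map.1 hy
      rw [List.mem_range] at ha
      exact hc _ _ _ _ (by omega) (by omega) (by omega) (by omega) (by omega) (by omega)
        (by omega) (by omega)
  obtain ⟨j, rfl⟩ := Nat.exists_eq_add_of_le (show t + 1 + 1 ≤ k from ht)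
  rw [List.range_add, List.map_append, List.prod_append, List.range_succ, List.range_succ]
  simp only [List.map_append, List.map_cons, List.map_nil, List.prod_append, List.prod_cons,
    List.prod_nil, mul_one]
  rw [List.range_succ]
  simp only [List.map_append, List.map_cons, List.map_nil, List.prod_append, List.prod_cons,
    List.prod_nil, mul_one]
  have h := hrtt t le_rfl
  rw [← hr]
  generalize ((List.range t).map fun a => R a t).prod = L at *
  generalize ((List.range t).map fun a => R a (t + 1)).prod = N at *
  generalize ((List.range t).map fun b => ((List.range b).map fun a => R a b).prod).prod = G at *
  generalize (List.map (fun b => ((List.range b).map fun a => R a b).prod)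
        (List.map (fun x => t + 1 + 1 + x) (List.range j))).prod = Y
  refine ⟨G * N * L * Y, ?_⟩
  have h2 : G * L * N * r = r * (G * N * L) := by
    calc G * L * N * r = G * (L * N * r) := by simp only [mul_assoc]
      _ = G * r * (N * L) := by rw [h]; simp only [mul_assoc]
      _ = r * (G * N * L) := by rw [hcomm.eq]; simp only [mul_assoc]
  simp only [← mul_assoc] at h2 ⊢
  rw [h2]

end OrderedProducts

/-! ### The image of the fusion operator. -/

section FusionImage

variable {n : ℕ} (bd : Boundary) {k : ℕ}

theorem zamR_eq (a b : Fin k) (z : ℂ) :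
    zamR n bd a b z = 1 - z⁻¹ • permOp n a b + (z - bd.kappa n)⁻¹ • contrOp bd n a b := rfl

theorem permOp_commute {S : Type*} [Fintype S] [DecidableEq S] {a b c d : S} (hac : a ≠ c)
    (had : a ≠ d) (hbc : b ≠ c) (hbd : b ≠ d) (α β α' β' : ℂ) :
    Commute (1 - α • permOp n a b + β • contrOp bd n a b)
      (1 - α' • permOp n c d + β' • contrOp bd n c d) := by
  have h1 : ∀ i j i' j' p q p' q', Commute (siteUnit ℂ a i j * siteUnit ℂ b (i' : Idx n) j')
      (siteUnit ℂ c p q * siteUnit ℂ d (p' : Idx n) q') := fun i j i' j' p q p' q' =>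
    ((siteUnit_commute hac _ _ _ _).mul_right (siteUnit_commute had _ _ _ _)).mul_left
      ((siteUnit_commute hbc _ _ _ _).mul_right (siteUnit_commute hbd _ _ _ _))
  have h2 : ∀ i j i' j', Commute (siteUnit ℂ a i j * siteUnit ℂ b (i' : Idx n) j')
      (1 - α' • permOp n c d + β' • contrOp bd n c d) := by
    intro i j i' j'
    refine (((Commute.one_right _).sub_right (Commute.smul_right ?_ _))).add_right
      (Commute.smul_right ?_ _)
    · exact Commute.sum_right _ _ _ fun _ _ => Commute.sum_right _ _ _ fun _ _ => h1 _ _ _ _ _ _ _ _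
    · exact Commute.sum_right _ _ _ fun _ _ => Commute.sum_right _ _ _ fun _ _ =>
        (h1 _ _ _ _ _ _ _ _).smul_right _
  refine (((Commute.one_left _).sub_left (Commute.smul_left ?_ _))).add_left
    (Commute.smul_left ?_ _)
  · exact Commute.sum_left _ _ _ fun _ _ => Commute.sum_left _ _ _ fun _ _ => h2 _ _ _ _
  · exact Commute.sum_left _ _ _ fun _ _ => Commute.sum_left _ _ _ fun _ _ =>
      (h2 _ _ _ _).smul_left _

theorem fusion_eq (n k : ℕ) (z : ℕ → ℕ → Matrix (Fin k → Idx n) (Fin k → Idx n) ℂ)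
    (hz : ∀ (a b : ℕ) (h : a < b) (hb : b < k), z a b =
      zamR n bd ⟨a, h.trans hb⟩ ⟨b, hb⟩ (-bd.eps * ((b : ℂ) - (a : ℂ)))) :
    fusion n bd k = (k.factorial : ℂ)⁻¹ •
      ((List.range k).map fun b => ((List.range b).map fun a => z a b).prod).prod := by
  rw [fusion]
  congr 2
  refine List.ext_getElem (by simp) fun b h1 h2 => ?_
  simp only [List.getElem_ofFn, List.getElem_map, List.getElem_range]
  congr 1
  refine List.ext_getElem (by simp) fun a h3 h4 => ?_
  simp only [List.getElem_ofFn, List.getElem_map, List.getElem_range]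
  rw [hz a b (by simpa using h3) (by simpa using h1)]
  rfl

variable {bd}

theorem eps_eq_or (bd : Boundary) : (bd.orth = true ∧ bd.eps = 1) ∨ (bd.orth = false ∧ bd.eps = -1) := by
  rw [Boundary.eps]
  cases bd.orth <;> simp

/-- Regularity of the matrices entering the fusion operator. The value is `1 - n - d` in the
orthogonal case and `d - n - 1` in the symplectic case; the latter could vanish without the bound `k
≤ n`. -/
theorem eps_mul_sub_kappa_ne_zero (hn : 1 ≤ n) (hk : bd.orth = false → k ≤ n) {d : ℕ} (hd : 0 < d)
    (hdk : d < k) : -bd.eps * (d : ℂ) - bd.kappa n ≠ 0 := by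
  rw [Boundary.kappa]
  rcases eps_eq_or bd with ⟨h, e⟩ | ⟨h, e⟩
  · rw [e]
    intro h0
    have : ((d + n : ℕ) : ℂ) = (1 : ℕ) := by push_cast; linear_combination -h0
    have := Nat.cast_injective this
    omega
  · rw [e]
    intro h0
    have : (d : ℂ) = ((n + 1 : ℕ) : ℂ) := by push_cast; linear_combination h0
    have := Nat.cast_injective this
    have := hk h
    omega

/-- The image of the fusion operator consists of traceless tensors which are symmetric up to the
sign `ε`. -/
theorem fusion_adjacent (hn : 1 ≤ n) (hk : bd.orth = false → k ≤ n) {t : ℕ} (ht : t + 1 < k)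
    (η : (Fin k → Idx n) → ℂ) :
    (permOp n ⟨t, by omega⟩ ⟨t + 1, ht⟩).mulVec ((fusion n bd k).mulVec η) =
      bd.eps • (fusion n bd k).mulVec η ∧
    (contrOp bd n ⟨t, by omega⟩ ⟨t + 1, ht⟩).mulVec ((fusion n bd k).mulVec η) = 0 := by
  have he : bd.eps ≠ 0 := left_ne_zero_of_mul_eq_one (eps_mul_self bd)
  let z : ℕ → ℕ → Matrix (Fin k → Idx n) (Fin k → Idx n) ℂ := fun a b =>
    if h : a < b ∧ b < k then
      zamR n bd ⟨a, h.1.trans h.2⟩ ⟨b, h.2⟩ (-bd.eps * ((b : ℂ) - (a : ℂ))) else 1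
  have hz : ∀ (a b : ℕ) (h : a < b) (hb : b < k), z a b =
      zamR n bd ⟨a, h.trans hb⟩ ⟨b, hb⟩ (-bd.eps * ((b : ℂ) - (a : ℂ))) := fun a b h hb =>
    dif_pos ⟨h, hb⟩
  obtain ⟨X, hX⟩ := exists_prod_eq_mul_of_yang_baxter z ht
    (fun a ha => by
      have hat : (⟨a, by omega⟩ : Fin k) ≠ ⟨t, by omega⟩ := fun h => by
        simp only [Fin.mk.injEq] at h; omega
      have hat' : (⟨a, by omega⟩ : Fin k) ≠ ⟨t + 1, ht⟩ := fun h => by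
        simp only [Fin.mk.injEq] at h; omega
      have htt : (⟨t, by omega⟩ : Fin k) ≠ ⟨t + 1, ht⟩ := fun h => by
        simp only [Fin.mk.injEq] at h; omega
      obtain ⟨d, rfl⟩ := Nat.exists_eq_add_of_lt ha
      have hd : ∀ d : ℕ, (((d + 1 : ℕ) : ℂ)) ≠ 0 := fun d => Nat.cast_ne_zero.2 (by omega)
      have := (brauerTriple bd n hat hat' htt).yang_baxter
        (u := -bd.eps * ((d + 1 : ℕ) : ℂ)) (v := -bd.eps * ((1 : ℕ) : ℂ))
        (mul_ne_zero (neg_ne_zero.2 he) (hd d)) (mul_ne_zero (neg_ne_zero.2 he) (by simp))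
        (by rw [← mul_add, ← Nat.cast_add]; exact mul_ne_zero (neg_ne_zero.2 he) (hd _))
        (eps_mul_sub_kappa_ne_zero hn hk (by omega) (by omega))
        (eps_mul_sub_kappa_ne_zero hn hk (by omega) (by omega))
        (by rw [← mul_add, ← Nat.cast_add]
            exact eps_mul_sub_kappa_ne_zero hn hk (by omega) (by omega))
      rw [hz _ _ (by omega) (by omega), hz _ _ (by omega) (by omega), hz _ _ (by omega) (by omega),
        zamR_eq, zamR_eq, zamR_eq]
      convert this using 8 <;> push_cast <;> ring)
    (fun a b c d hab hcd hb hd h1 h2 h3 h4 => by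
      rw [hz _ _ hab hb, hz _ _ hcd hd, zamR_eq, zamR_eq]
      apply permOp_commute <;> simpa)
  rw [fusion_eq bd n k z hz, hX, hz _ _ (by omega) ht]
  have htt : (⟨t, by omega⟩ : Fin k) ≠ ⟨t + 1, ht⟩ := fun h => by
    simp only [Fin.mk.injEq] at h; omega
  have hn0 : (n : ℂ) ≠ 0 := Nat.cast_ne_zero.2 (by omega)
  -- The matrix brought to the front is `1 + ε P - Q/n`. Multiplication by `P` reproduces it with
  -- the factor `ε`, and multiplication by `Q` gives `Q + Q - 2Q = 0` since `Q² = 2n Q`.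
  have e1 : (-bd.eps * (((t + 1 : ℕ) : ℂ) - (t : ℂ)))⁻¹ = -bd.eps := by
    push_cast
    rw [add_sub_cancel_left, mul_one, inv_neg, inv_eq_of_mul_eq_one_left (eps_mul_self bd)]
  have e2 : -bd.eps * (((t + 1 : ℕ) : ℂ) - (t : ℂ)) - bd.kappa n = -n := by
    rw [Boundary.kappa]; push_cast; ring
  have e3 : permOp n (⟨t, by omega⟩ : Fin k) ⟨t + 1, ht⟩ *
      zamR n bd ⟨t, by omega⟩ ⟨t + 1, ht⟩ (-bd.eps * (((t + 1 : ℕ) : ℂ) - (t : ℂ))) =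
      bd.eps • zamR n bd ⟨t, by omega⟩ ⟨t + 1, ht⟩ (-bd.eps * (((t + 1 : ℕ) : ℂ) - (t : ℂ))) := by
    rw [zamR_eq, e1, e2, mul_add, mul_sub, mul_one, mul_smul_comm, mul_smul_comm,
      permOp_mul_self htt, permOp_mul_contrOp_self bd htt, smul_add, smul_sub, smul_smul, smul_smul,
      smul_smul, mul_neg, eps_mul_self, mul_comm]
    module
  have e4 : contrOp bd n (⟨t, by omega⟩ : Fin k) ⟨t + 1, ht⟩ *
      zamR n bd ⟨t, by omega⟩ ⟨t + 1, ht⟩ (-bd.eps * (((t + 1 : ℕ) : ℂ) - (t : ℂ))) = 0 := by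
    rw [zamR_eq, e1, e2, mul_add, mul_sub, mul_one, mul_smul_comm, mul_smul_comm,
      contrOp_mul_self bd htt, contrOp_mul_permOp_self bd htt, smul_smul, smul_smul, neg_mul,
      eps_mul_self]
    have : (-(n : ℂ))⁻¹ * (2 * n) = -2 := by field_simp
    rw [this]
    module
  constructor
  · rw [Matrix.mulVec_mulVec, Matrix.mul_smul, ← mul_assoc, e3, ← Matrix.smul_mulVec]
    congr 1
    rw [smul_comm, smul_mul_assoc]
  · rw [Matrix.mulVec_mulVec, Matrix.mul_smul, ← mul_assoc, e4, zero_mul, smul_zero,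
      Matrix.zero_mulVec]

end FusionImage

/-! ### Characters of the symmetric group. -/

section Symmetric

variable (bd : Boundary)

/-- The trivial character for `𝔰𝔬₂ₙ` and the sign for `𝔰𝔭₂ₙ`. -/
def symSign (X : Type*) [Fintype X] [DecidableEq X] : Equiv.Perm X →* ℂ :=
  if bd.orth then 1
  else ((Int.castRingHom ℂ : ℤ →* ℂ).comp (Units.coeHom ℤ)).comp Equiv.Perm.sign

theorem symSign_swap {X : Type*} [Fintype X] [DecidableEq X] {s t : X} (h : s ≠ t) :
    symSign bd X (Equiv.swap s t) = bd.eps := by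
  rw [symSign, Boundary.eps]
  split_ifs
  · rfl
  · simp [Equiv.Perm.sign_swap h]

theorem symSign_mul_self {X : Type*} [Fintype X] [DecidableEq X] (σ : Equiv.Perm X) :
    symSign bd X σ * symSign bd X σ = 1 := by
  rw [symSign]
  split_ifs
  · simp
  · rcases Int.units_eq_one_or (Equiv.Perm.sign σ) with h | h <;> simp [h]

/-- Adjacent transpositions generate the symmetric group. -/
theorem symm_of_adjacent {α : Type*} {k : ℕ} {ζ : (Fin k → α) → ℂ}
    (h : ∀ (t : ℕ) (ht : t + 1 < k) (f : Fin k → α),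
      ζ (f ∘ Equiv.swap ⟨t, by omega⟩ ⟨t + 1, ht⟩) = bd.eps * ζ f)
    (σ : Equiv.Perm (Fin k)) (f : Fin k → α) : ζ (f ∘ σ) = symSign bd _ σ * ζ f := by
  have hσ : ∀ (σ : Equiv.Perm (Fin k)),
      σ ∈ Submonoid.closure {τ : Equiv.Perm (Fin k) | ∃ (t : ℕ) (ht : t + 1 < k),
        τ = Equiv.swap ⟨t, by omega⟩ ⟨t + 1, ht⟩} → ∀ f, ζ (f ∘ σ) = symSign bd _ σ * ζ f := by
    intro σ hσ
    induction hσ using Submonoid.closure_induction with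
    | mem τ hτ =>
      obtain ⟨t, ht, rfl⟩ := hτ
      intro f
      rw [h, symSign_swap bd (by simp)]
    | one => intro f; simp
    | mul σ τ _ _ h1 h2 =>
      intro f
      rw [Equiv.Perm.coe_mul, ← Function.comp_assoc, h2, h1, map_mul]
      ring
  refine hσ σ ?_ f
  cases k with
  | zero =>
    rw [Subsingleton.elim σ 1]
    exact one_mem _
  | succ k =>
    have := Equiv.Perm.mclosure_swap_castSucc_succ k
    refine (this.symm ▸ Submonoid.mem_top σ : σ ∈ Submonoid.closure _) |> fun h' =>
      Submonoid.closure_mono ?_ h'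
    rintro _ ⟨i, rfl⟩
    exact ⟨i, by omega, rfl⟩

end Symmetric

/-! ### Highest-weight type conditions force support on the upper half of the basis. -/

section UpperSupport

variable {n : ℕ} {S : Type*} [Fintype S] [DecidableEq S] {ζ : (S → Idx n) → ℂ} {ε : ℂ}

theorem update_eq_update_comp_swap {α : Type*} {F : S → α} {s t : S} (h : F s = F t) (y : α) :
    Function.update F s y = Function.update F t y ∘ Equiv.swap s t := by
  funext x
  simp only [Function.comp_apply, Function.update_apply, Equiv.swap_apply_def]
  split_ifs <;> simp_all

theorem update_update_comp_swap {α : Type*} (f : S → α) {s t : S} (h : s ≠ t) (x y : α) :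
    Function.update (Function.update f s x) t y ∘ Equiv.swap s t =
      Function.update (Function.update f s y) t x := by
  funext z
  simp only [Function.comp_apply, Function.update_apply, Equiv.swap_apply_def]
  split_ifs <;> simp_all

/-- Symmetric traceless tensors annihilated by the lower left generators are supported on the
upper half of the basis. -/
theorem eq_zero_of_symm (hn : 2 ≤ n)
    (hsym : ∀ s t, s ≠ t → ∀ f, ζ (f ∘ Equiv.swap s t) = ζ f)
    (hC : ∀ f (i j : Fin n), ∑ s, (if f s = .inl i then ζ (Function.update f s (bar (.inl j))) else 0) =
      ∑ s, (if f s = .inl j then ζ (Function.update f s (bar (.inl i))) else 0))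
    (hT : ∀ s t, s ≠ t → ∀ f, ∑ i : Fin n,
      ζ (Function.update (Function.update f s (.inl i)) t (bar (.inl i))) = 0)
    (f : S → Idx n) (s₀ : S) (j : Fin n) (hf : f s₀ = bar (.inl j)) : ζ f = 0 := by
  have hcount : ∀ (F : S → Idx n) (s : S) (x y : Idx n), F s = x →
      ∑ t, (if F t = x then ζ (Function.update F t y) else 0) =
        (Finset.univ.filter fun t => F t = x).card * ζ (Function.update F s y) := by
    intro F s x y hs
    rw [← Finset.sum_filter, Finset.sum_congr rfl (g := fun _ => ζ (Function.update F s y)),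
      Finset.sum_const, nsmul_eq_mul]
    intro t ht
    rw [Finset.mem_filter] at ht
    by_cases hst : t = s
    · rw [hst]
    · rw [update_eq_update_comp_swap (ht.2.trans hs.symm), hsym _ _ hst]
  by_cases hj : ∃ s, f s = .inl j
  · obtain ⟨s₁, hs₁⟩ := hj
    have h01 : s₁ ≠ s₀ := fun h => by rw [h, hf] at hs₁; simp [bar] at hs₁
    set A : Fin n → Finset S := fun i =>
      Finset.univ.filter fun s => s ≠ s₀ ∧ s ≠ s₁ ∧ f s = .inl i with hA
    have hA0 : ∀ i, s₀ ∉ A i := fun i => by simp [hA]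
    have hA1 : ∀ i, s₁ ∉ A i := fun i => by simp [hA]
    set Z : Fin n → ℂ := fun i =>
      ζ (Function.update (Function.update f s₁ (.inl i)) s₀ (bar (.inl i))) with hZ
    have hZj : Z j = ζ f := by
      simp only [hZ, ← hs₁, Function.update_eq_self]
      rw [hs₁, ← hf, Function.update_eq_self]
    -- Apply `hC` to the index with `i` at `s₁` and `j` at `s₀`: the `i`s are `s₁` and `A i`, the
    -- `j`s are `s₀` and `A j`, and by symmetry each contributes the same amount. Summing over `i`
    -- and using tracelessness leaves a positive integer times `Z j = 0`.
    have key : ∀ i, (((A i).card : ℂ) + 1) * Z j = ((A j).card + 1) * Z i := by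
      intro i
      by_cases hij : i = j
      · rw [hij]
      have h := hC (Function.update (Function.update f s₁ (.inl i)) s₀ (.inl j)) i j
      rw [hcount _ s₁ _ _ (by rw [Function.update_of_ne h01, Function.update_self]),
        hcount _ s₀ _ _ (by rw [Function.update_self])] at h
      have e1 : (Finset.univ.filter fun t => Function.update (Function.update f s₁ (.inl i)) s₀
          (.inl j) t = .inl i) = insert s₁ (A i) := by
        ext t
        simp only [Finset.mem_filter, Finset.mem_univ, true_and, Function.update_apply,
          Finset.mem_insert, hA]
        by_cases h0 : t = s₀
        · simp [h0, h01.symm, Ne.symm hij]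
        · by_cases h1 : t = s₁ <;> simp [h0, h1, h01]
      have e2 : (Finset.univ.filter fun t => Function.update (Function.update f s₁ (.inl i)) s₀
          (.inl j) t = .inl j) = insert s₀ (A j) := by
        ext t
        simp only [Finset.mem_filter, Finset.mem_univ, true_and, Function.update_apply,
          Finset.mem_insert, hA]
        by_cases h0 : t = s₀
        · simp [h0]
        · by_cases h1 : t = s₁ <;> simp [h0, h1, h01, hij]
      have e3 : Function.update (Function.update (Function.update f s₁ (.inl i)) s₀ (.inl j)) s₁
          (bar (.inl j)) = Function.update (Function.update f s₁ (.inl j)) s₀ (bar (.inl j)) ∘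
            Equiv.swap s₁ s₀ := by
        rw [Function.update_comm h01.symm, Function.update_idem,
          update_update_comp_swap f h01]
      rw [e1, e2, Finset.card_insert_of_notMem (hA1 i), Finset.card_insert_of_notMem (hA0 j),
        Function.update_idem, e3, hsym _ _ h01] at h
      push_cast at h
      exact h
    have hsum := hT s₁ s₀ h01 f
    have h2 : (∑ i, (((A i).card : ℂ) + 1)) * Z j = 0 := by
      rw [Finset.sum_mul, Finset.sum_congr rfl fun i _ => key i, ← Finset.mul_sum]
      rw [show ∑ i, Z i = 0 from hsum, mul_zero]
    rw [← hZj]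
    refine (mul_eq_zero.1 h2).resolve_left ?_
    have : ((∑ i, ((A i).card + 1) : ℕ) : ℂ) ≠ 0 := by
      rw [Nat.cast_ne_zero]
      exact (Finset.sum_pos (fun i _ => Nat.succ_pos _) ⟨j, Finset.mem_univ j⟩).ne'
    push_cast at this
    exact this
  -- No factor carries `j`. Replace `bar j` by some `i ≠ j`, which is where `n ≥ 2` enters: one side
  -- of `hC` is empty and the other is a positive multiple of `ζ f`.
  · push Not at hj
    obtain ⟨i, hij⟩ : ∃ i : Fin n, i ≠ j :=
      haveI : Nontrivial (Fin n) := Fin.nontrivial_iff_two_le.2 hn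
      exists_ne j
    have h := hC (Function.update f s₀ (.inl i)) i j
    rw [hcount _ s₀ _ _ (Function.update_self ..), Function.update_idem, ← hf,
      Function.update_eq_self, Finset.sum_eq_zero] at h
    · refine (mul_eq_zero.1 h).resolve_left (Nat.cast_ne_zero.2 (Finset.card_pos.2 ⟨s₀, ?_⟩).ne')
      simp
    · intro s _
      rw [if_neg]
      by_cases hs : s = s₀
      · rw [hs, Function.update_self]
        simpa using hij
      · rw [Function.update_of_ne hs]
        exact hj s

/-- The antisymmetric analogue of `eq_zero_of_symm`. -/
theorem eq_zero_of_antisymm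
    (hsym : ∀ s t, s ≠ t → ∀ f, ζ (f ∘ Equiv.swap s t) = -ζ f)
    (hC : ∀ f (i j : Fin n), ∑ s, (if f s = .inl i then ζ (Function.update f s (bar (.inl j))) else 0) =
      -∑ s, (if f s = .inl j then ζ (Function.update f s (bar (.inl i))) else 0))
    (hT : ∀ s t, s ≠ t → ∀ f, ∑ i : Fin n,
      ζ (Function.update (Function.update f s (.inl i)) t (bar (.inl i))) = 0)
    (f : S → Idx n) (s₀ : S) (j : Fin n) (hf : f s₀ = bar (.inl j)) : ζ f = 0 := by
  have hdup : ∀ (F : S → Idx n) (s t : S), s ≠ t → F s = F t → ζ F = 0 := by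
    intro F s t hst h
    have h1 := hsym s t hst F
    have h2 : F ∘ Equiv.swap s t = F := by
      funext x
      simp only [Function.comp_apply, Equiv.swap_apply_def]
      split_ifs <;> simp_all
    rw [h2] at h1
    linear_combination (1 / 2 : ℂ) * h1
  have hone : ∀ (F : S → Idx n) (s : S) (x y : Idx n), F s = x → (∀ t, F t = x → t = s) →
      ∑ t, (if F t = x then ζ (Function.update F t y) else 0) = ζ (Function.update F s y) := by
    intro F s x y hs h
    rw [Finset.sum_eq_single s, if_pos hs]
    · intro t _ hts
      rw [if_neg fun h' => hts (h t h')]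
    · simp
  by_cases hj : ∃ s, f s = .inl j
  · obtain ⟨s₁, hs₁⟩ := hj
    have h01 : s₁ ≠ s₀ := fun h => by rw [h, hf] at hs₁; simp [bar] at hs₁
    by_cases hjf : ∃ s, s ≠ s₁ ∧ f s = .inl j
    · obtain ⟨s, h1, h2⟩ := hjf
      exact hdup f s s₁ h1 (h2.trans hs₁.symm)
    push Not at hjf
    set Z : Fin n → ℂ := fun i =>
      ζ (Function.update (Function.update f s₁ (.inl i)) s₀ (bar (.inl i))) with hZ
    have hZj : Z j = ζ f := by
      simp only [hZ, ← hs₁, Function.update_eq_self]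
      rw [hs₁, ← hf, Function.update_eq_self]
    classical
    -- If `i` occurs elsewhere, antisymmetry kills `Z i`; otherwise `hC` has one term on either
    -- side. The trace is thus a non-negative integer times `Z j`, and this integer is positive
    -- since `i = j` does not occur elsewhere.
    have key : ∀ i, Z i = (if ∃ s, s ≠ s₀ ∧ s ≠ s₁ ∧ f s = .inl i then 0 else 1) * Z j := by
      intro i
      split_ifs with hi
      · obtain ⟨s, h0, h1, h2⟩ := hi
        rw [zero_mul]
        refine hdup _ s s₁ h1 ?_
        rw [Function.update_of_ne h0, Function.update_of_ne h1, Function.update_of_ne h01,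
          Function.update_self, h2]
      · push Not at hi
        rw [one_mul]
        by_cases hij : i = j
        · rw [hij]
        have e3 : Function.update (Function.update (Function.update f s₁ (.inl i)) s₀ (.inl j)) s₁
            (bar (.inl j)) = Function.update (Function.update f s₁ (.inl j)) s₀ (bar (.inl j)) ∘
              Equiv.swap s₁ s₀ := by
          rw [Function.update_comm h01.symm, Function.update_idem,
            update_update_comp_swap f h01]
        have h := hC (Function.update (Function.update f s₁ (.inl i)) s₀ (.inl j)) i j
        rw [hone _ s₁ _ _ (by rw [Function.update_of_ne h01, Function.update_self]),
          hone _ s₀ _ _ (by rw [Function.update_self]), Function.update_idem, e3,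
          hsym _ _ h01, neg_inj] at h
        · exact h.symm
        · intro t ht
          by_contra h0
          rw [Function.update_of_ne h0] at ht
          by_cases h1 : t = s₁
          · rw [h1, Function.update_self] at ht
            exact hij (Sum.inl_injective ht)
          · rw [Function.update_of_ne h1] at ht
            exact hjf t h1 ht
        · intro t ht
          by_contra h1
          by_cases h0 : t = s₀
          · rw [h0, Function.update_self] at ht
            exact hij (Sum.inl_injective ht).symm
          · rw [Function.update_of_ne h0, Function.update_of_ne h1] at ht
            exact hi t h0 h1 ht
    have hsum := hT s₁ s₀ h01 f
    change ∑ i, Z i = 0 at hsum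
    rw [Finset.sum_congr rfl fun i _ => key i, ← Finset.sum_mul] at hsum
    rw [← hZj]
    refine (mul_eq_zero.1 hsum).resolve_left ?_
    have : ((∑ i : Fin n, (if ∃ s, s ≠ s₀ ∧ s ≠ s₁ ∧ f s = .inl i then 0 else 1) : ℕ) : ℂ) ≠ 0 := by
      rw [Nat.cast_ne_zero]
      refine (Finset.sum_pos' (fun i _ => Nat.zero_le _) ⟨j, Finset.mem_univ j, ?_⟩).ne'
      rw [if_neg]
      · exact Nat.one_pos
      · rintro ⟨s, _, h1, h2⟩
        exact hjf s h1 h2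
    push_cast at this
    exact this
  -- Here the relation `hC` with `i = j` already suffices: it says that `ζ f` equals its negative.
  · push Not at hj
    have h := hC (Function.update f s₀ (.inl j)) j j
    rw [hone _ s₀ _ _ (Function.update_self ..), Function.update_idem, ← hf,
      Function.update_eq_self] at h
    · linear_combination (1 / 2 : ℂ) * h
    · intro t ht
      by_contra h0
      rw [Function.update_of_ne h0] at ht
      exact hj t ht

end UpperSupport

/-! ### First-order expansion of the fused Lax operator. -/

section FirstOrder

variable {n : ℕ} (bd : Boundary) {S R : Type*} [Fintype S] [DecidableEq S] [CommRing R]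

theorem exists_prod_one_add {A : Type*} [Ring A] [Algebra R A] (x : R) (l : List A) :
    ∃ Z : A, (l.map fun y => 1 + x • y).prod = 1 + x • l.sum + (x * x) • Z := by
  induction l with
  | nil => exact ⟨0, by simp⟩
  | cons y l ih =>
    obtain ⟨Z, hZ⟩ := ih
    refine ⟨Z + y * l.sum + x • (y * Z), ?_⟩
    rw [List.map_cons, List.prod_cons, List.sum_cons, hZ]
    simp only [add_mul, mul_add, one_mul, mul_one, smul_mul_assoc, mul_smul_comm, smul_smul,
      smul_add, mul_assoc]
    abel

/-- The linear part of `1 - α P + β Q`. -/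
def zamLin (n : ℕ) (s : S) (α β : R) :
    Matrix (Idx n) (Idx n) (Matrix (S → Idx n) (S → Idx n) R) :=
  Matrix.of fun i j => β • (bd.theta n i * bd.theta n j) • siteUnit R s (bar i) (bar j) -
    α • siteUnit R s j i

theorem zamGen_eq_one_add (s : S) (x α β : R) :
    zamGen bd n s (x * α) (x * β) = 1 + x • zamLin bd n s α β := by
  refine Matrix.ext fun i j => ?_
  simp only [zamGen, zamLin, Matrix.of_apply, Matrix.add_apply, Matrix.smul_apply, Matrix.one_apply,
    smul_sub, smul_smul x]
  abel

theorem zamLin_mulVec (s : S) (α β : R) (i j : Idx n) (ζ : (S → Idx n) → R) (f : S → Idx n) :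
    (zamLin bd n s α β i j).mulVec ζ f =
      β * ((bd.theta n i * bd.theta n j : ℤ) *
        (if f s = bar i then ζ (Function.update f s (bar j)) else 0)) -
      α * (if f s = j then ζ (Function.update f s i) else 0) := by
  simp only [zamLin, Matrix.of_apply, Matrix.sub_mulVec, Matrix.smul_mulVec, Pi.sub_apply,
    Pi.smul_apply, siteUnit_mulVec, smul_eq_mul]
  rw [zsmul_eq_mul]

theorem map_zamGen {R' : Type*} [CommRing R'] (φ : R →+* R') (s : S) (α β : R) :
    (φ.mapMatrix : Matrix (S → Idx n) (S → Idx n) R →+* _).mapMatrix (zamGen bd n s α β) =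
      zamGen bd n s (φ α) (φ β) := by
  ext i j f g
  simp only [RingHom.mapMatrix_apply, Matrix.map_apply, zamGen, Matrix.of_apply, Matrix.add_apply,
    Matrix.sub_apply, Matrix.smul_apply, map_add, map_sub, smul_eq_mul, map_mul, map_zsmul,
    siteUnit_apply, apply_ite φ, map_one, map_zero]
  congr 2
  split_ifs <;> simp [Matrix.one_apply, apply_ite φ]

theorem map_fusedGen {R' : Type*} [CommRing R'] (φ : R →+* R') (k : ℕ) (e : Fin k → S)
    (α β : Fin k → R) (i j : Idx n) (f g : S → Idx n) :
    φ (fusedGen bd n k e α β i j f g) =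
      fusedGen bd n k e (fun j => φ (α j)) (fun j => φ (β j)) i j f g := by
  have h : (φ.mapMatrix : Matrix (S → Idx n) (S → Idx n) R →+* _).mapMatrix
      (fusedGen bd n k e α β) = fusedGen bd n k e (fun j => φ (α j)) (fun j => φ (β j)) := by
    rw [fusedGen, fusedGen, map_list_prod, List.map_ofFn]
    congr 2
    funext j
    exact map_zamGen bd φ _ _ _
  rw [← h]
  rfl

end FirstOrder

/-! ### The vacuum space of one bulk factor. -/

section Vacuum

open PowerSeries

variable {n : ℕ} {bd : Boundary} {k : ℕ}

/-- Here `x` stands for `v⁻¹` and `χ` for evaluation at infinity. The zeroth-order term of a lower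
left entry is absent, so one may divide by `x`; at infinity there remains the sum over the factors
of the `Q - P` entries, that is, a lower left Lie algebra generator. -/
theorem first_order_of_fusedGen {R : Type*} [CommRing R] [IsDomain R] {x : R} (hx : x ≠ 0)
    (χ : R →+* ℂ) (hχ : χ x = 0) (φ : ℂ →+* R) (hφ : ∀ a, χ (φ a) = a) (α β : Fin k → R)
    (hα : ∀ j, χ (α j) = 1) (hβ : ∀ j, χ (β j) = 1) {ζ : (Fin k → Idx n) → ℂ} {p l : Fin n}
    {f : Fin k → Idx n} (h : ∑ g, fusedGen bd n k id (fun j => x * α j) (fun j => x * β j)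
      (Sum.inr p) (Sum.inl l) f g * φ (ζ g) = 0) :
    ∑ s, (if f s = .inl l then ζ (Function.update f s (.inr p)) else 0) =
      bd.eps * ∑ s, (if f s = .inl p.rev then ζ (Function.update f s (bar (.inl l))) else 0) := by
  obtain ⟨Z, hZ⟩ := exists_prod_one_add x
    (List.ofFn fun j : Fin k => zamLin bd n (id j) (α j) (β j))
  have e4 : fusedGen bd n k id (fun j => x * α j) (fun j => x * β j) =
      1 + x • ∑ j, zamLin bd n j (α j) (β j) + (x * x) • Z := by
    rw [List.sum_ofFn] at hZ
    rw [fusedGen]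
    simp only [zamGen_eq_one_add]
    rw [List.map_ofFn] at hZ
    exact hZ
  have e5 : x * (∑ s, (zamLin bd n s (α s) (β s) (.inr p) (.inl l)).mulVec
      (fun g => φ (ζ g)) f + x * (Z (.inr p) (.inl l)).mulVec (fun g => φ (ζ g)) f) = 0 := by
    refine Eq.trans ?_ h
    rw [e4]
    simp only [Matrix.add_apply, Matrix.smul_apply, Matrix.sum_apply, ne_eq, reduceCtorEq,
      not_false_eq_true, Matrix.one_apply_ne, zero_add, add_mul,
      Finset.sum_add_distrib, smul_eq_mul, Matrix.mulVec, dotProduct, mul_add, Finset.mul_sum,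
      Finset.sum_mul, mul_assoc]
    congr 1
    exact Finset.sum_comm
  have e6 := congrArg χ ((mul_eq_zero.1 e5).resolve_left hx)
  simp only [map_add, map_mul, hχ, zero_mul, add_zero, map_sum, map_zero,
    zamLin_mulVec, map_sub, hα, hβ, one_mul, apply_ite χ, hφ,
    Finset.sum_sub_distrib, ← Finset.mul_sum, map_intCast] at e6
  have e7 : ((bd.theta n (.inr p) * bd.theta n (.inl l) : ℤ) : ℂ) = bd.eps := by
    simp only [Boundary.theta, Boundary.eps]; split_ifs <;> norm_num
  rw [e7] at e6
  exact (sub_eq_zero.1 e6).symm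

/-- The first coefficient of the equations defining the vacuum space. -/
theorem first_order_of_fusedLax {c : ℂ} {ζ : (Fin k → Idx n) → ℂ} {p l : Fin n}
    (h : (fusedLax n bd k id (vv - cst c) (Sum.inr p) (Sum.inl l)).mulVec
      (fun f => cst (ζ f)) = 0) (f : Fin k → Idx n) :
    ∑ s, (if f s = .inl l then ζ (Function.update f s (.inr p)) else 0) =
      bd.eps * ∑ s, (if f s = .inl p.rev then ζ (Function.update f s (bar (.inl l))) else 0) := by
  have h0 : ∀ a : ℂ, constantCoeff (mk fun s => a ^ s) = 1 := fun a => by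
    simp [← coeff_zero_eq_constantCoeff_apply]
  refine first_order_of_fusedGen (bd := bd) (x := (X : ℂ⟦X⟧)) X_ne_zero constantCoeff constantCoeff_X
    C (fun a => constantCoeff_C a) (fun j => mk fun s => (c + bd.eps * ((j : ℕ) : ℂ)) ^ s)
    (fun j => mk fun s => (c + bd.eps * ((j : ℕ) : ℂ) + bd.kappa n) ^ s) (fun j => h0 _)
    (fun j => h0 _) ?_
  apply toSer_injective
  refine (map_sum toSer _ _).trans ((Finset.sum_congr rfl fun g _ => ?_).trans
    ((congrFun h f).trans (map_zero toSer).symm))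
  rw [map_mul toSer, map_fusedGen bd toSer, toSer_C, fusedLax_eq]
  have e1 : (fun j : Fin k => toSer (X * mk fun s => (c + bd.eps * ((j : ℕ) : ℂ)) ^ s)) =
      fun j : Fin k => (vv - cst c - cst (bd.eps * ((j : ℕ) : ℂ)))⁻¹ := by
    funext j
    change toSer (geo _) = _
    rw [toSer_geo, map_add, sub_sub]
  have e2 : (fun j : Fin k => toSer (X * mk fun s => (c + bd.eps * ((j : ℕ) : ℂ) + bd.kappa n) ^ s)) =
      fun j : Fin k => (vv - cst c - cst (bd.eps * ((j : ℕ) : ℂ)) - cst (bd.kappa n))⁻¹ := by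
    funext j
    change toSer (geo _) = _
    rw [toSer_geo, map_add, map_add, sub_sub, sub_sub, add_assoc]
  rw [e1, e2]

/-- The symmetric group is transitive on ordered pairs of distinct factors, so one contraction
controls all of them. -/
theorem contr_eq_zero {ζ : (Fin k → Idx n) → ℂ}
    (hsym : ∀ (σ : Equiv.Perm (Fin k)) f, ζ (f ∘ σ) = symSign bd _ σ * ζ f)
    (h : ∀ (h : 1 < k) f, contr bd ⟨0, by omega⟩ ⟨1, h⟩ ζ f = 0) {s t : Fin k} (hst : s ≠ t)
    (f : Fin k → Idx n) : contr bd s t ζ f = 0 := by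
  have hk : 1 < k := by
    by_contra hk
    have := s.2
    have := t.2
    exact hst (Fin.ext (by omega))
  obtain ⟨σ, hσ0, hσ1⟩ : ∃ σ : Equiv.Perm (Fin k), σ ⟨0, by omega⟩ = s ∧ σ ⟨1, hk⟩ = t := by
    set z : Fin k := ⟨0, by omega⟩ with hz
    set o : Fin k := ⟨1, hk⟩ with ho
    have hzo : z ≠ o := by simp [hz, ho]
    refine ⟨Equiv.swap z s * Equiv.swap o (Equiv.swap z s t), ?_, ?_⟩
    · rw [Equiv.Perm.mul_apply, Equiv.swap_apply_of_ne_of_ne hzo, Equiv.swap_apply_left]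
      intro h'
      have := congrArg (Equiv.swap z s) h'
      rw [Equiv.swap_apply_left, Equiv.swap_apply_self] at this
      exact hst this
    · rw [Equiv.Perm.mul_apply, Equiv.swap_apply_left, Equiv.swap_apply_self]
  have h1 : contr bd ⟨0, by omega⟩ ⟨1, hk⟩ ζ (f ∘ σ) = symSign bd _ σ * contr bd s t ζ f := by
    simp only [contr, Finset.mul_sum, zsmul_eq_mul]
    refine Finset.sum_congr rfl fun j _ => ?_
    rw [mul_left_comm, ← hsym]
    congr 2
    funext x
    simp only [Function.comp_apply, Function.update_apply, ← hσ0, ← hσ1, Equiv.apply_eq_iff_eq]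
  rw [h hk] at h1
  exact (mul_eq_zero.1 h1.symm).resolve_left (left_ne_zero_of_mul_eq_one (symSign_mul_self bd σ))

/-- The upper terms carry `θ = ε`, and the lower terms become upper ones at the cost of a swap,
which is again `ε`. The contraction is therefore `2ε` times the half trace. -/
theorem trace_of_contr {ζ : (Fin k → Idx n) → ℂ} {s t : Fin k} (hst : s ≠ t)
    (hsym : ∀ f, ζ (f ∘ Equiv.swap s t) = bd.eps * ζ f) {f : Fin k → Idx n}
    (h : contr bd s t ζ f = 0) :
    ∑ i : Fin n, ζ (Function.update (Function.update f s (.inl i)) t (bar (.inl i))) = 0 := by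
  rw [contr, Fintype.sum_sum_type] at h
  have e1 : ∀ i : Fin n, ζ (Function.update (Function.update f s (.inr i)) t (bar (.inr i))) =
      bd.eps * ζ (Function.update (Function.update f s (.inl i.rev)) t (bar (.inl i.rev))) := by
    intro i
    rw [← hsym, update_update_comp_swap f hst]
    simp [bar]
  have e2 : ∀ i : Fin n, ((bd.theta n (.inl i) : ℤ) : ℂ) = bd.eps := fun i => by
    simp only [Boundary.theta, Boundary.eps]; split_ifs <;> norm_num
  have e3 : ∀ i : Fin n, ((bd.theta n (.inr i) : ℤ) : ℂ) = 1 := fun i => by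
    simp only [Boundary.theta]; norm_num
  simp only [e1, zsmul_eq_mul, e2, e3, one_mul, ← Finset.mul_sum] at h
  have e4 := Equiv.sum_comp Fin.revPerm fun i : Fin n =>
    ζ (Function.update (Function.update f s (.inl i)) t (bar (.inl i)))
  simp only [Fin.revPerm_apply] at e4
  rw [e4, ← two_mul] at h
  have he : bd.eps ≠ 0 := left_ne_zero_of_mul_eq_one (eps_mul_self bd)
  simpa [he] using h

/-- Contractions kill tensors on the upper half, and transpositions act by `ε`, so the matrix at `-ε
d` acts by the scalar `1 + 1/d`. For fixed `b` these scalars telescope to `b + 1`, and the product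
over `b` is `k!`, which cancels the normalisation. -/
theorem fusion_fixes {ζ : (Fin k → Idx n) → ℂ}
    (hsym : ∀ (σ : Equiv.Perm (Fin k)) f, ζ (f ∘ σ) = symSign bd _ σ * ζ f)
    (hsupp : ∀ f s a, f s = .inr a → ζ f = 0) : (fusion n bd k).mulVec ζ = ζ := by
  have he : bd.eps ≠ 0 := left_ne_zero_of_mul_eq_one (eps_mul_self bd)
  have h1 : ∀ (a b : Fin k), a ≠ b → ∀ z, (zamR n bd a b z).mulVec ζ = (1 - z⁻¹ * bd.eps) • ζ := by
    intro a b hab z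
    have hP : (permOp n a b).mulVec ζ = bd.eps • ζ := by
      funext f
      rw [permOp_mulVec hab, hsym, symSign_swap bd hab]
      rfl
    have hQ : (contrOp bd n a b).mulVec ζ = 0 := by
      funext f
      rw [contrOp_mulVec bd hab]
      have : contr bd a b ζ f = 0 := Finset.sum_eq_zero fun j _ => by
        cases j with
        | inl j => rw [hsupp _ b j.rev (by simp [bar]), smul_zero]
        | inr j => rw [hsupp _ a j (by simp [Function.update_of_ne hab]), smul_zero]
      rw [this, smul_zero, ite_self]
      rfl
    rw [zamR_eq, Matrix.add_mulVec, Matrix.sub_mulVec, Matrix.one_mulVec, Matrix.smul_mulVec,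
      Matrix.smul_mulVec, hP, hQ, smul_zero, add_zero, sub_smul, one_smul, smul_smul]
  have h2 : ∀ {r : ℕ} (M : Fin r → Matrix (Fin k → Idx n) (Fin k → Idx n) ℂ) (c : Fin r → ℂ),
      (∀ i, (M i).mulVec ζ = c i • ζ) → (List.ofFn M).prod.mulVec ζ = (∏ i, c i) • ζ := by
    intro r
    induction r with
    | zero => intro M c _; simp
    | succ r ih =>
      intro M c h
      rw [List.ofFn_succ, List.prod_cons, ← Matrix.mulVec_mulVec,
        ih _ (fun i => c i.succ) fun i => h i.succ, Matrix.mulVec_smul, h 0, smul_smul,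
        Fin.prod_univ_succ, mul_comm]
  have h3 : ∀ b : ℕ, ∏ a : Fin b, (1 - (-bd.eps * ((b : ℂ) - (a : ℂ)))⁻¹ * bd.eps) = (b : ℂ) + 1 := by
    intro b
    have h4 : ∀ a : Fin b, (1 - (-bd.eps * ((b : ℂ) - (a : ℂ)))⁻¹ * bd.eps) =
        ((a.rev : ℕ) + 2) / ((a.rev : ℕ) + 1) := by
      intro a
      have : ((a.rev : ℕ) : ℂ) = b - a - 1 := by
        rw [Fin.val_rev, Nat.cast_sub (by omega)]
        push_cast
        ring
      have h5 : (b : ℂ) - (a : ℂ) ≠ 0 := sub_ne_zero.2 fun h => by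
        have := Nat.cast_injective h
        omega
      rw [this]
      have h6 : (b : ℂ) - a - 1 + 1 ≠ 0 := by rwa [sub_add_cancel]
      field_simp
      ring
    rw [Finset.prod_congr rfl fun a _ => h4 a]
    refine (Equiv.prod_comp Fin.revPerm fun a : Fin b => (((a : ℕ) : ℂ) + 2) / ((a : ℕ) + 1)).trans ?_
    rw [Fin.prod_univ_eq_prod_range fun a : ℕ => ((a : ℂ) + 2) / (a + 1)]
    clear h4
    induction b with
    | zero => simp
    | succ b ih =>
      rw [Finset.prod_range_succ, ih]
      have : (b : ℂ) + 1 ≠ 0 := by exact_mod_cast Nat.succ_ne_zero b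
      push_cast
      field_simp
      ring
  have h5 := h2 (fun b : Fin k => (List.ofFn fun a : Fin (b : ℕ) =>
        zamR n bd (Fin.castLE b.isLt.le a) b (-bd.eps * ((b : ℂ) - (a : ℂ)))).prod)
        (fun b => (b : ℂ) + 1) fun b => by
      rw [h2 _ _ fun a => h1 _ b (fun h => by
        have := congrArg Fin.val h
        simp only [Fin.val_castLE] at this
        omega) _, h3]
  have h6 : ∏ b : Fin k, ((b : ℂ) + 1) = k.factorial := by
    rw [Fin.prod_univ_eq_prod_range fun b : ℕ => (b : ℂ) + 1, ← Finset.prod_range_add_one_eq_factorial]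
    push_cast
    rfl
  rw [fusion, Matrix.smul_mulVec, h5, h6, smul_smul,
    inv_mul_cancel₀ (Nat.cast_ne_zero.2 k.factorial_ne_zero), one_smul]

theorem isUpperEmbedding_id {S R : Type*} [Fintype S] [DecidableEq S] [CommRing R] :
    IsUpperEmbedding (n := n) (R := R) (S := S) (AlgHom.id R _) id
      (Matrix.of fun q g => if q = Sum.inl ∘ g then 1 else 0) := by
  have h1 : ∀ (M : Matrix (S → Idx n) (S → Idx n) R) (q : S → Idx n) (g : S → Fin n),
      (M * (Matrix.of fun (q : S → Idx n) (g : S → Fin n) => if q = Sum.inl ∘ g then (1 : R) else 0)) q g =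
        M q (Sum.inl ∘ g) := by
    intro M q g
    simp [Matrix.mul_apply]
  constructor
  · intro s a b
    ext q g
    rw [AlgHom.id_apply, h1, siteUnit_apply']
    simp only [Matrix.mul_apply, siteUnit_apply', Matrix.of_apply, ite_and, mul_ite,
      mul_one, mul_zero, id, Function.comp_apply, Sum.inl.injEq]
    by_cases h : g s = b
    · simp [h, Function.comp_update]
    · simp [h]
  · intro s x b
    ext q g
    rw [AlgHom.id_apply, h1, siteUnit_apply']
    simp

theorem fusedLax_lower_eq_zero {ζ : (Fin k → Idx n) → ℂ}
    (hsupp : ∀ f s a, f s = .inr a → ζ f = 0) (z : Ser) (p l : Fin n) :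
    (fusedLax n bd k id z (Sum.inr p) (Sum.inl l)).mulVec (fun f => cst (ζ f)) = 0 := by
  have h := ((isUpperEmbedding_id (n := n) (S := Fin k) (R := Ser)).fusedGen (bd := bd) id
    (fun j => (z - cst (bd.eps * (j : ℂ)))⁻¹)
    (fun j => (z - cst (bd.eps * (j : ℂ)) - cst (bd.kappa n))⁻¹) p l).2
  have h2 : (fun f => cst (ζ f)) = (Matrix.of fun (q : Fin k → Idx n) (g : Fin k → Fin n) =>
      if q = Sum.inl ∘ g then (1 : Ser) else 0).mulVec fun g => cst (ζ (Sum.inl ∘ g)) := by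
    funext f
    simp only [Matrix.mulVec, dotProduct, Matrix.of_apply, ite_mul, one_mul, zero_mul]
    by_cases hf : ∃ g : Fin k → Fin n, f = Sum.inl ∘ g
    · obtain ⟨g, rfl⟩ := hf
      rw [Finset.sum_eq_single g]
      · rw [if_pos rfl]
      · intro g' _ hg'
        rw [if_neg fun h => hg' (Sum.inl_injective.comp_left h.symm)]
      · simp
    · rw [Finset.sum_eq_zero fun g _ => if_neg fun h => hf ⟨g, h⟩]
      have : ∃ s a, f s = .inr a := by
        by_contra hne
        push Not at hne
        refine hf ⟨fun s => (f s).elim id id, ?_⟩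
        funext s
        rcases h : f s with a | a
        · simp [h]
        · exact absurd h (hne s a)
      obtain ⟨s, a, hs⟩ := this
      rw [hsupp f s a hs, map_zero]
  rw [h2, Matrix.mulVec_mulVec, fusedLax_eq]
  exact (congrArg (fun M => Matrix.mulVec M _) h).trans (Matrix.zero_mulVec _)

/-- The vacuum space consists of the symmetric tensors (the antisymmetric ones for `𝔰𝔭₂ₙ`) over the
upper half of the basis. -/
theorem mem_vacuum_iff (hn : 1 ≤ n) (hn' : bd.orth = true → 2 ≤ n) (hk : bd.orth = false → k ≤ n)
    {c : ℂ} {ζ : (Fin k → Idx n) → ℂ} :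
    ζ ∈ vacuum n bd k c ↔
      (∀ (σ : Equiv.Perm (Fin k)) f, ζ (f ∘ σ) = symSign bd _ σ * ζ f) ∧
        ∀ f s a, f s = .inr a → ζ f = 0 := by
  constructor
  · rintro ⟨⟨η, hη⟩, hC⟩
    have hadj : ∀ (t : ℕ) (ht : t + 1 < k), (permOp n ⟨t, by omega⟩ ⟨t + 1, ht⟩).mulVec ζ =
        bd.eps • ζ ∧ (contrOp bd n ⟨t, by omega⟩ ⟨t + 1, ht⟩).mulVec ζ = 0 := by
      intro t ht
      rw [← hη]
      exact fusion_adjacent hn hk ht η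
    have hne : ∀ (t : ℕ) (ht : t + 1 < k), (⟨t, by omega⟩ : Fin k) ≠ ⟨t + 1, ht⟩ := fun t ht h => by
      simp at h
    have hsym := symm_of_adjacent bd (ζ := ζ) fun t ht f => by
      exact (permOp_mulVec (hne t ht) ζ f).symm.trans (congrFun (hadj t ht).1 f)
    refine ⟨hsym, ?_⟩
    have hsw : ∀ s t : Fin k, s ≠ t → ∀ f, ζ (f ∘ Equiv.swap s t) = bd.eps * ζ f := by
      intro s t hst f
      rw [hsym, symSign_swap bd hst]
    have hcon : ∀ (h : 1 < k) f, contr bd ⟨0, by omega⟩ ⟨1, h⟩ ζ f = 0 := by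
      intro h f
      -- At an index whose first two entries form a conjugate pair starting with a lower index, the
      -- operator returns the contraction itself, the sign in front being `1`.
      have h1 := congrFun (hadj 0 h).2 (Function.update (Function.update f ⟨0, by omega⟩
        (.inr ⟨0, hn⟩)) ⟨1, h⟩ (bar (.inr ⟨0, hn⟩)))
      rw [contrOp_mulVec bd (hne 0 h), if_pos, Function.update_of_ne (hne 0 h),
        Function.update_self] at h1
      · simp only [Boundary.theta, one_smul] at h1
        refine Eq.trans ?_ h1
        simp only [contr]
        congr 1
        funext j
        congr 2
        funext x
        simp only [Function.update_apply]
        split_ifs <;> rfl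
      · rw [Function.update_self, Function.update_of_ne (hne 0 h), Function.update_self]
    have hT : ∀ s t : Fin k, s ≠ t → ∀ f, ∑ i : Fin n,
        ζ (Function.update (Function.update f s (.inl i)) t (bar (.inl i))) = 0 := fun s t hst f =>
      trace_of_contr hst (hsw s t hst) (contr_eq_zero hsym hcon hst f)
    have hC' : ∀ f (i j : Fin n),
        ∑ s, (if f s = .inl i then ζ (Function.update f s (bar (.inl j))) else 0) =
        bd.eps * ∑ s, (if f s = .inl j then ζ (Function.update f s (bar (.inl i))) else 0) := by
      intro f i j
      have := first_order_of_fusedLax (hC j.rev i) f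
      rw [Fin.rev_rev] at this
      exact this
    intro f s a hs
    have hs' : f s = bar (.inl a.rev) := by simp [hs, bar]
    rcases eps_eq_or bd with ⟨h, e⟩ | ⟨h, e⟩
    · simp only [e, one_mul] at hsw hC'
      exact eq_zero_of_symm (hn' h) hsw hC' hT f s _ hs'
    · simp only [e, neg_one_mul] at hsw hC'
      exact eq_zero_of_antisymm hsw hC' hT f s _ hs'
  · rintro ⟨hsym, hsupp⟩
    exact ⟨⟨ζ, fusion_fixes hsym hsupp⟩, fun p l => fusedLax_lower_eq_zero hsupp _ p l⟩

end Vacuum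

/-! ### Block-symmetric tensors and their generation by `𝔤𝔩ₙ`. -/

section SymmetricTensors

variable {n : ℕ} (bd : Boundary) {ℓ : ℕ} {k : Fin ℓ → ℕ} {m : ℕ}

/-- The permutations of the tensor factors inside the bulk spaces. -/
abbrev BlockPerm (k : Fin ℓ → ℕ) : Type := ∀ i, Equiv.Perm (Fin (k i))

/-- The action of the block permutations on the tensor factors. -/
def permSite (m : ℕ) : BlockPerm k →* Equiv.Perm (Site k m) where
  toFun σ := Equiv.sumCongr (Equiv.refl _) (Equiv.sigmaCongrRight σ)
  map_one' := by ext s; rcases s with s | ⟨i, j⟩ <;> rfl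
  map_mul' σ τ := by ext s; rcases s with s | ⟨i, j⟩ <;> rfl

/-- The product of the characters of the blocks. -/
def blockSign (k : Fin ℓ → ℕ) : BlockPerm k →* ℂ :=
  ∏ i, (symSign bd (Fin (k i))).comp (Pi.evalMonoidHom _ i)

theorem blockSign_apply (σ : BlockPerm k) : blockSign bd k σ = ∏ i, symSign bd _ (σ i) := by
  simp [blockSign, MonoidHom.finsetProd_apply]

theorem blockSign_mul_self (σ : BlockPerm k) : blockSign bd k σ * blockSign bd k σ = 1 := by
  rw [blockSign_apply, ← Finset.prod_mul_distrib]
  exact Finset.prod_eq_one fun i _ => symSign_mul_self bd _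

/-- The tensors which are symmetric up to a sign inside every block. -/
def symTensors (n : ℕ) (k : Fin ℓ → ℕ) (m : ℕ) : Submodule ℂ ((Site k m → Fin n) → ℂ) where
  carrier := {ζ | ∀ σ f, ζ (f ∘ permSite m σ) = blockSign bd k σ * ζ f}
  add_mem' h h' σ f := by simp only [Pi.add_apply, h σ f, h' σ f, mul_add]
  zero_mem' σ f := by simp
  smul_mem' c ζ h σ f := by simp only [Pi.smul_apply, h σ f, smul_eq_mul, mul_left_comm]

/-- The symmetrization of a basis vector. -/
def symVec (g : Site k m → Fin n) (f : Site k m → Fin n) : ℂ :=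
  ∑ σ, blockSign bd k σ * if f ∘ permSite m σ = g then 1 else 0

theorem symVec_comp (g : Site k m → Fin n) (τ : BlockPerm k) :
    symVec bd (g ∘ permSite m τ) = blockSign bd k τ • symVec bd g := by
  funext f
  rw [Pi.smul_apply, symVec, symVec, smul_eq_mul, Finset.mul_sum,
    ← Equiv.sum_comp (Equiv.mulRight τ)]
  refine Finset.sum_congr rfl fun σ _ => ?_
  rw [Equiv.coe_mulRight, map_mul, map_mul, Equiv.Perm.coe_mul, ← Function.comp_assoc, mul_comm _ (blockSign bd k τ),
    mul_assoc]
  have : (f ∘ permSite m σ) ∘ permSite m τ = g ∘ permSite m τ ↔ f ∘ permSite m σ = g :=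
    ((permSite m τ).surjective.injective_comp_right).eq_iff
  simp only [this]

theorem symVec_mem (g : Site k m → Fin n) : symVec bd g ∈ symTensors bd n k m := by
  intro τ f
  rw [symVec, symVec, Finset.mul_sum, ← Equiv.sum_comp (Equiv.mulLeft τ⁻¹)]
  refine Finset.sum_congr rfl fun σ _ => ?_
  have e : blockSign bd k τ⁻¹ = blockSign bd k τ := by
    have h1 := blockSign_mul_self bd τ
    have h2 : blockSign bd k τ⁻¹ * blockSign bd k τ = 1 := by rw [← map_mul, inv_mul_cancel, map_one]
    exact mul_right_cancel₀ (right_ne_zero_of_mul_eq_one h1) (h2.trans h1.symm)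
  rw [Equiv.coe_mulLeft, map_mul, e, mul_assoc, Function.comp_assoc, ← Equiv.Perm.coe_mul,
    ← map_mul, mul_inv_cancel_left]

/-- Averaging over the block permutations shows that symmetrised basis vectors span. -/
theorem sum_symVec {ζ : (Site k m → Fin n) → ℂ} (hζ : ζ ∈ symTensors bd n k m) :
    (Fintype.card (BlockPerm k) : ℂ) • ζ = ∑ g, ζ g • symVec bd g := by
  funext f
  simp only [Finset.sum_apply, Pi.smul_apply, smul_eq_mul, symVec, Finset.mul_sum]
  rw [Finset.sum_comm]
  have : ∀ σ : BlockPerm k, ∑ g, ζ g * (blockSign bd k σ * if f ∘ permSite m σ = g then 1 else 0) =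
      ζ f := by
    intro σ
    simp only [mul_ite, mul_one, mul_zero, Finset.sum_ite_eq, Finset.mem_univ, if_true]
    rw [hζ σ f, mul_right_comm, blockSign_mul_self, one_mul]
  simp only [this, Finset.sum_const, Finset.card_univ, nsmul_eq_mul]

theorem symTensors_le_of_symVec {N : Submodule ℂ ((Site k m → Fin n) → ℂ)}
    (h : ∀ g, symVec bd g ∈ N) : symTensors bd n k m ≤ N := by
  intro ζ hζ
  have hc : (Fintype.card (BlockPerm k) : ℂ) ≠ 0 := Nat.cast_ne_zero.2 Fintype.card_ne_zero
  rw [← Submodule.smul_mem_iff N hc, sum_symVec bd hζ]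
  exact Submodule.sum_mem _ fun g _ => N.smul_mem _ (h g)

/-- The block to which a tensor factor belongs. -/
def block : Site k m → ModIdx ℓ m
  | .inl s => .inr s
  | .inr t => .inl t.1

theorem block_permSite (σ : BlockPerm k) (s : Site k m) : block (permSite m σ s) = block s := by
  rcases s with s | ⟨i, j⟩ <;> rfl

theorem exists_swap {s t : Site k m} (h : block s = block t) (hst : s ≠ t) :
    ∃ τ : BlockPerm k, (permSite m τ : Site k m → Site k m) = Equiv.swap s t ∧
      blockSign bd k τ = bd.eps := by
  rcases s with s | ⟨i, j⟩
  · rcases t with t | ⟨i', j'⟩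
    · simp only [block, Sum.inr.injEq] at h
      exact absurd (congrArg _ h) hst
    · simp [block] at h
  · rcases t with t | ⟨i', j'⟩
    · simp [block] at h
    · simp only [block, Sum.inl.injEq] at h
      subst h
      have hj : j ≠ j' := fun h => hst (by rw [h])
      refine ⟨Function.update 1 i (Equiv.swap j j'), ?_, ?_⟩
      · funext x
        rcases x with x | ⟨i', x⟩
        · rw [Equiv.swap_apply_of_ne_of_ne (by simp) (by simp)]
          rfl
        · change (Sum.inr ⟨i', Function.update (1 : BlockPerm k) i (Equiv.swap j j') i' x⟩ : Site k m) = _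
          by_cases hi : i' = i
          · subst hi
            rw [Function.update_self]
            simp only [Equiv.swap_apply_def, Sum.inr.injEq, Sigma.mk.injEq, heq_eq_eq, true_and]
            split_ifs <;> rfl
          · rw [Function.update_of_ne hi, Equiv.swap_apply_of_ne_of_ne]
            · rfl
            · simp [hi]
            · simp [hi]
      · rw [blockSign_apply, Finset.prod_eq_single i]
        · rw [Function.update_self, symSign_swap bd hj]
        · intro i' _ hi'
          rw [Function.update_of_ne hi', Pi.one_apply, map_one]
        · simp

theorem symVec_swap {s t : Site k m} (h : block s = block t) (hst : s ≠ t) (g : Site k m → Fin n) :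
    symVec bd (g ∘ Equiv.swap s t) = bd.eps • symVec bd g := by
  obtain ⟨τ, hτ, hs⟩ := exists_swap bd h hst
  rw [← hτ, symVec_comp, hs]

theorem symVec_eq_zero (ho : bd.orth = false) {g : Site k m → Fin n} {s t : Site k m}
    (h : block s = block t) (hst : s ≠ t) (hg : g s = g t) : symVec bd g = 0 := by
  have h1 := symVec_swap bd h hst g
  have h2 : g ∘ Equiv.swap s t = g := by
    funext x
    simp only [Function.comp_apply, Equiv.swap_apply_def]
    split_ifs <;> simp_all
  have he : bd.eps = -1 := by simp [Boundary.eps, ho]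
  rw [h2, he, neg_one_smul] at h1
  exact self_eq_neg.1 h1

/-- The sum of the matrix units over a block. -/
def blockUnit (R : Type*) [CommRing R] (c : ModIdx ℓ m) (b a : Fin n) :
    Matrix (Site k m → Fin n) (Site k m → Fin n) R :=
  ∑ s ∈ Finset.univ.filter fun s : Site k m => block s = c, siteUnit R s b a

/-- Summed over a whole block, the matrix units commute with the block permutations, so they act on
the unsymmetrised index one factor at a time. -/
theorem blockUnit_symVec (c : ModIdx ℓ m) (b a : Fin n) (g : Site k m → Fin n) :
    (blockUnit ℂ c b a).mulVec (symVec bd g) =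
      ∑ s ∈ Finset.univ.filter fun s : Site k m => block s = c ∧ g s = a,
        symVec bd (Function.update g s b) := by
  funext f
  have key : ∀ σ : BlockPerm k,
      (∑ s ∈ Finset.univ.filter fun s : Site k m => block s = c,
        if f s = b ∧ Function.update f s a ∘ permSite m σ = g then (1 : ℂ) else 0) =
      ∑ s ∈ Finset.univ.filter fun s : Site k m => block s = c,
        if g s = a ∧ f ∘ permSite m σ = Function.update g s b then (1 : ℂ) else 0 := by
    intro σ
    rw [Finset.sum_filter, Finset.sum_filter, ← Equiv.sum_comp (permSite m σ)]
    refine Finset.sum_congr rfl fun s _ => ?_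
    rw [block_permSite]
    have e : Function.update f (permSite m σ s) a ∘ permSite m σ =
        Function.update (f ∘ permSite m σ) s a := by
      funext x
      simp only [Function.comp_apply, Function.update_apply, Equiv.apply_eq_iff_eq]
    rw [e]
    congr 1
    refine if_congr ?_ rfl rfl
    constructor
    · rintro ⟨h1, rfl⟩
      refine ⟨Function.update_self .., ?_⟩
      rw [Function.update_idem, ← h1]
      exact (Function.update_eq_self s (f ∘ permSite m σ)).symm
    · rintro ⟨rfl, h2⟩
      refine ⟨?_, ?_⟩
      · have := congrFun h2 s
        rwa [Function.update_self] at this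
      · rw [h2, Function.update_idem, Function.update_eq_self]
  have hite : ∀ (p : Prop) [Decidable p] (q : BlockPerm k → Prop) [∀ σ, Decidable (q σ)],
      (if p then ∑ σ, blockSign bd k σ * (if q σ then 1 else 0) else 0) =
        ∑ σ, blockSign bd k σ * (if p ∧ q σ then 1 else 0) := by
    intro p _ q _
    by_cases hp : p <;> simp [hp]
  simp only [blockUnit, Matrix.sum_mulVec, Finset.sum_apply, siteUnit_mulVec, symVec]
  rw [← Finset.filter_filter, Finset.sum_filter (fun s => g s = a)]
  simp only [hite]
  rw [Finset.sum_comm, Finset.sum_comm (s := Finset.univ.filter fun s : Site k m => block s = c)]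
  simp only [← Finset.mul_sum, key]

/-- A basis index which does not vanish under symmetrization. -/
def Admissible (g : Site k m → Fin n) : Prop :=
  bd.orth = false → ∀ s t, block s = block t → s ≠ t → g s ≠ g t

variable {bd}

/-- Apply the unit that replaces `g s` by `b`. In the orthogonal case all resulting terms coincide
and their number is positive; in the symplectic case admissibility leaves only the term at `s`. -/
theorem symVec_update_mem {N : Submodule ℂ ((Site k m → Fin n) → ℂ)}
    (hN : ∀ c b a, ∀ x ∈ N, (blockUnit ℂ c b a).mulVec x ∈ N) {g : Site k m → Fin n}
    (hg : Admissible bd g) (h : symVec bd g ∈ N) (s : Site k m) (b : Fin n) :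
    symVec bd (Function.update g s b) ∈ N := by
  have h1 := hN (block s) b (g s) _ h
  rw [blockUnit_symVec] at h1
  rcases eps_eq_or bd with ⟨ho, he⟩ | ⟨ho, he⟩
  · have h2 : ∀ t ∈ Finset.univ.filter fun t : Site k m => block t = block s ∧ g t = g s,
        symVec bd (Function.update g t b) = symVec bd (Function.update g s b) := by
      intro t ht
      rw [Finset.mem_filter] at ht
      by_cases hts : t = s
      · rw [hts]
      · rw [update_eq_update_comp_swap ht.2.2, symVec_swap bd ht.2.1 hts, he, one_smul]
    rw [Finset.sum_congr rfl h2, Finset.sum_const, ← Nat.cast_smul_eq_nsmul ℂ] at h1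
    refine (Submodule.smul_mem_iff N (Nat.cast_ne_zero.2 (Finset.card_pos.2 ⟨s, ?_⟩).ne')).1 h1
    simp
  · rwa [Finset.sum_eq_single s] at h1
    · intro t ht hts
      rw [Finset.mem_filter] at ht
      exact absurd ht.2.2 (hg ho t s ht.2.1 hts)
    · simp

/-- Induction on the number of factors where the two indices differ: each step corrects one factor
without spoiling a correct one. -/
theorem symVec_mem_of_admissible {N : Submodule ℂ ((Site k m → Fin n) → ℂ)}
    (hN : ∀ c b a, ∀ x ∈ N, (blockUnit ℂ c b a).mulVec x ∈ N) {g : Site k m → Fin n}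
    (hg : Admissible bd g) (d : ℕ) (g' : Site k m → Fin n) (hg' : Admissible bd g')
    (hd : (Finset.univ.filter fun s => g' s ≠ g s).card = d) (h : symVec bd g' ∈ N) :
    symVec bd g ∈ N := by
  induction d using Nat.strong_induction_on generalizing g' with
  | _ d ih =>
    by_cases heq : g' = g
    · rwa [← heq]
    obtain ⟨s, hs⟩ : ∃ s, g' s ≠ g s := by
      by_contra hne
      push Not at hne
      exact heq (funext hne)
    -- If the wanted value already sits at another factor `t` of an antisymmetric block, writing it
    -- at `s` would give zero. Swapping `s` and `t` is used instead; the entry at `t` was wrong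
    -- anyway because `g` is admissible.
    by_cases hsw : bd.orth = false ∧ ∃ t, block t = block s ∧ t ≠ s ∧ g' t = g s
    · obtain ⟨ho, t, hts, hne, ht⟩ := hsw
      have hval : ∀ x, (g' ∘ Equiv.swap s t) x ≠ g x → g' x ≠ g x := by
        intro x hx
        by_cases hxs : x = s
        · rw [hxs]; exact hs
        · by_cases hxt : x = t
          · rw [hxt, ht]
            exact hg ho s t hts.symm hne.symm
          · rwa [Function.comp_apply, Equiv.swap_apply_of_ne_of_ne hxs hxt] at hx
      refine ih _ ?_ (g' ∘ Equiv.swap s t) ?_ rfl ?_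
      · rw [← hd]
        refine Finset.card_lt_card ⟨fun x hx => ?_, fun hsub => ?_⟩
        · rw [Finset.mem_filter] at hx ⊢
          exact ⟨hx.1, hval x hx.2⟩
        · have := hsub (Finset.mem_filter.2 ⟨Finset.mem_univ s, hs⟩)
          rw [Finset.mem_filter, Function.comp_apply, Equiv.swap_apply_left] at this
          exact this.2 ht
      · intro _ x y hxy hne'
        have hb : ∀ z, block (Equiv.swap s t z) = block z := by
          intro z
          rw [Equiv.swap_apply_def]
          split_ifs with h1 h2
          · rw [h1, hts]
          · rw [h2, hts]
          · rfl
        exact hg' ho _ _ (by rw [hb, hb, hxy]) fun h' => hne' ((Equiv.swap s t).injective h')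
      · rw [symVec_swap bd hts.symm hne.symm]
        exact N.smul_mem _ h
    · refine ih _ ?_ (Function.update g' s (g s)) ?_ rfl (symVec_update_mem hN hg' h s (g s))
      · rw [← hd]
        refine Finset.card_lt_card ⟨fun x hx => ?_, fun hsub => ?_⟩
        · rw [Finset.mem_filter] at hx ⊢
          refine ⟨hx.1, ?_⟩
          by_cases hxs : x = s
          · rw [hxs]; exact hs
          · have := hx.2
            rwa [Function.update_of_ne hxs] at this
        · have := hsub (Finset.mem_filter.2 ⟨Finset.mem_univ s, hs⟩)
          rw [Finset.mem_filter, Function.update_self] at this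
          exact this.2 rfl
      · intro ho x y hxy hne
        have h1 : ∀ t, block t = block s → t ≠ s → g' t ≠ g s := fun t h1 h2 h3 =>
          hsw ⟨ho, t, h1, h2, h3⟩
        by_cases hx : x = s
        · subst hx
          rw [Function.update_self, Function.update_of_ne hne.symm]
          exact (h1 y hxy.symm hne.symm).symm
        · by_cases hy : y = s
          · subst hy
            rw [Function.update_self, Function.update_of_ne hne]
            exact h1 x hxy hne
          · rw [Function.update_of_ne hx, Function.update_of_ne hy]
            exact hg' ho x y hxy hne

/-- The symmetric tensors are generated by any symmetrized basis vector. -/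
theorem symTensors_le_of_stable {N : Submodule ℂ ((Site k m → Fin n) → ℂ)}
    (hN : ∀ c b a, ∀ x ∈ N, (blockUnit ℂ c b a).mulVec x ∈ N) {g : Site k m → Fin n}
    (hg : Admissible bd g) (h : symVec bd g ∈ N) : symTensors bd n k m ≤ N := by
  refine symTensors_le_of_symVec bd fun g' => ?_
  by_cases hg' : Admissible bd g'
  · exact symVec_mem_of_admissible hN hg' _ g hg rfl h
  · simp only [Admissible] at hg'
    push Not at hg'
    obtain ⟨ho, s, t, h1, h2, h3⟩ := hg'
    rw [symVec_eq_zero bd ho h1 h2 h3]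
    exact N.zero_mem

end SymmetricTensors

/-! ### The lowest tensor and its weights. -/

section LowestTensor

variable {n : ℕ} {bd : Boundary} {ℓ : ℕ} {k : Fin ℓ → ℕ} {m : ℕ}

theorem modGen_inl {R : Type*} [CommRing R] (i : Fin ℓ) (a b : Fin n) :
    modGen n k m R (.inl i) a b = blockUnit R (.inl i) b a := by
  rw [blockUnit, Finset.sum_filter, Fintype.sum_sum_type, Fintype.sum_sigma, modGen]
  simp only [block, reduceCtorEq, if_false, Finset.sum_const_zero, zero_add, Sum.inl.injEq,
    Matrix.sum_apply, siteGen_apply]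
  rw [Finset.sum_eq_single i]
  · simp
  · intro i' _ hi'
    simp [hi']
  · simp

theorem modGen_inr {R : Type*} [CommRing R] (s : Fin m ⊕ Fin m) (a b : Fin n) :
    modGen n k m R (.inr s) a b = -blockUnit R (.inr s) a.rev b.rev := by
  rw [blockUnit, Finset.sum_filter, Fintype.sum_sum_type]
  simp only [block, reduceCtorEq, if_false, Finset.sum_const_zero, add_zero, Sum.inr.injEq,
    Finset.sum_ite_eq', Finset.mem_univ, if_true]
  rfl

/-- The index of the lowest tensor. -/
def lowestIdx (hn : 1 ≤ n) (hk : ∀ i, bd.orth = false → k i ≤ n) : Site k m → Fin n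
  | .inl _ => ⟨0, hn⟩
  | .inr t => if h : bd.orth = false then ⟨t.2, t.2.isLt.trans_le (hk t.1 h)⟩ else ⟨0, hn⟩

variable (hn : 1 ≤ n) (hk : ∀ i, bd.orth = false → k i ≤ n)

theorem admissible_lowestIdx : Admissible bd (lowestIdx (m := m) hn hk) := by
  intro ho s t hst hne
  rcases s with s | ⟨i, j⟩
  · rcases t with t | ⟨i', j'⟩
    · simp only [block, Sum.inr.injEq] at hst
      exact absurd (congrArg _ hst) hne
    · simp [block] at hst
  · rcases t with t | ⟨i', j'⟩
    · simp [block] at hst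
    · simp only [block, Sum.inl.injEq] at hst
      subst hst
      simp only [lowestIdx, ho, dif_pos, ne_eq, Fin.mk.injEq]
      intro h
      exact hne (by rw [Fin.ext h])

/-- Look at the coefficient at the index itself. In the orthogonal case each permutation contributes
`1`; in the symplectic case the entries in a block are distinct and only the identity contributes.
-/
theorem symVec_lowestIdx_ne_zero : symVec bd (lowestIdx (m := m) hn hk) ≠ 0 := by
  intro h0
  have h1 := congrFun h0 (lowestIdx hn hk)
  rw [symVec, Pi.zero_apply] at h1
  by_cases ho : bd.orth = true
  · have h2 : ∀ σ : BlockPerm k, lowestIdx (m := m) hn hk ∘ permSite m σ = lowestIdx hn hk := by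
      intro σ
      funext s
      rcases s with s | ⟨i, j⟩
      · rfl
      · change lowestIdx hn hk (.inr ⟨i, σ i j⟩) = _
        simp [lowestIdx, ho]
    have h3 : ∀ σ : BlockPerm k, blockSign bd k σ = 1 := by
      intro σ
      rw [blockSign_apply]
      exact Finset.prod_eq_one fun i _ => by simp [symSign, ho]
    simp only [h2, h3, if_true, mul_one, Finset.sum_const, Finset.card_univ, nsmul_eq_mul] at h1
    exact Nat.cast_ne_zero.2 Fintype.card_ne_zero h1
  · have ho' : bd.orth = false := by simpa using ho
    rw [Finset.sum_eq_single 1] at h1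
    · simp at h1
    · intro σ _ hσ
      rw [if_neg, mul_zero]
      intro h
      refine hσ (funext fun i => Equiv.ext fun j => ?_)
      have h2 := congrFun h (.inr ⟨i, j⟩)
      change lowestIdx hn hk (.inr ⟨i, σ i j⟩) = _ at h2
      simp only [lowestIdx, ho', dif_pos, Fin.mk.injEq] at h2
      exact Fin.ext h2
    · simp

/-- The weights of the lowest tensor. -/
def modWt (bd : Boundary) (n : ℕ) (k : Fin ℓ → ℕ) : ModIdx ℓ m → Fin n → ℂ
  | .inl i, a => bulkWt bd (k i) a
  | .inr _, a => if (a : ℕ) + 1 = n then -1 else 0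

/-- The generator replaces `a` by the smaller `b`. A symmetric block contains only the minimal
index; an antisymmetric block containing `a` contains `b` as well, so a repetition arises. On a
factor of `W` it acts from `b.rev`, which is not `0` because `b` is not maximal. -/
theorem modGen_lower (s : ModIdx ℓ m) {a b : Fin n} (hab : b < a) :
    (modGen n k m ℂ s a b).mulVec (symVec bd (lowestIdx hn hk)) = 0 := by
  rcases s with i | s
  · rw [modGen_inl, blockUnit_symVec]
    refine Finset.sum_eq_zero fun t ht => ?_
    rw [Finset.mem_filter] at ht
    obtain ⟨_, ht1, ht2⟩ := ht
    rcases t with t | ⟨i', j⟩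
    · simp [block] at ht1
    by_cases ho : bd.orth = false
    · have hb : (b : ℕ) < k i' := by
        simp only [lowestIdx, ho, dif_pos] at ht2
        have hja : (j : ℕ) = a := congrArg Fin.val ht2
        have h3 : (b : ℕ) < a := hab
        have := j.isLt
        omega
      have hj : (j : ℕ) = a := by
        simp only [lowestIdx, ho, dif_pos] at ht2
        exact congrArg Fin.val ht2
      have hne : (Sum.inr ⟨i', ⟨b, hb⟩⟩ : Site k m) ≠ .inr ⟨i', j⟩ := by
        intro h
        simp only [Sum.inr.injEq, Sigma.mk.injEq, heq_eq_eq, true_and] at h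
        have hbj : (b : ℕ) = j := congrArg Fin.val h
        have h3 : (b : ℕ) < a := hab
        omega
      refine symVec_eq_zero bd ho (s := .inr ⟨i', ⟨b, hb⟩⟩) (t := .inr ⟨i', j⟩) rfl hne ?_
      rw [Function.update_self, Function.update_of_ne hne]
      simp [lowestIdx, ho]
    · simp only [lowestIdx, ho] at ht2
      have := congrArg Fin.val ht2
      rw [dif_neg (by simp)] at this
      change (0 : ℕ) = a at this
      have h3 : (b : ℕ) < a := hab
      omega
  · rw [modGen_inr, Matrix.neg_mulVec, blockUnit_symVec, Finset.sum_eq_zero, neg_zero]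
    intro t ht
    rw [Finset.mem_filter] at ht
    obtain ⟨_, ht1, ht2⟩ := ht
    rcases t with t | ⟨i', j⟩
    · have h1 : (0 : ℕ) = b.rev := congrArg Fin.val ht2
      have h2 : a.rev < b.rev := Fin.rev_lt_rev.2 hab
      have h3 : (a.rev : ℕ) < b.rev := h2
      omega
    · simp [block] at ht1

theorem modGen_diag (s : ModIdx ℓ m) (a : Fin n) :
    (modGen n k m ℂ s a a).mulVec (symVec bd (lowestIdx hn hk)) =
      modWt bd n k s a • symVec bd (lowestIdx hn hk) := by
  have h1 : ∀ (c : ModIdx ℓ m) (a : Fin n), (blockUnit ℂ c a a).mulVec (symVec bd (lowestIdx hn hk)) =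
      ((Finset.univ.filter fun s : Site k m => block s = c ∧ lowestIdx (bd := bd) hn hk s = a).card : ℂ) •
        symVec bd (lowestIdx hn hk) := by
    intro c a
    rw [blockUnit_symVec, Nat.cast_smul_eq_nsmul, ← Finset.sum_const]
    refine Finset.sum_congr rfl fun s hs => ?_
    rw [Finset.mem_filter] at hs
    nth_rewrite 1 [← hs.2.2]
    rw [Function.update_eq_self]
  rcases s with i | s
  · rw [modGen_inl, h1]
    congr 1
    have e : (Finset.univ.filter fun s : Site k m =>
        block s = .inl i ∧ lowestIdx (bd := bd) hn hk s = a) =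
        (Finset.univ.filter fun j : Fin (k i) =>
          lowestIdx (bd := bd) (m := m) hn hk (.inr ⟨i, j⟩) = a).map
          ⟨fun j => .inr ⟨i, j⟩, fun j j' h => by simpa using h⟩ := by
      ext s
      simp only [Finset.mem_filter, Finset.mem_univ, true_and, Finset.mem_map]
      constructor
      · rintro ⟨h1, h2⟩
        rcases s with s | ⟨i', j⟩
        · simp [block] at h1
        · simp only [block, Sum.inl.injEq] at h1
          subst h1
          exact ⟨j, h2, rfl⟩
      · rintro ⟨j, h2, rfl⟩
        exact ⟨rfl, h2⟩
    rw [e, Finset.card_map, modWt, bulkWt]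
    by_cases ho : bd.orth = true
    · simp only [lowestIdx, ho, if_true, Bool.true_eq_false, dite_false]
      by_cases ha : (a : ℕ) = 0
      · have : (⟨0, hn⟩ : Fin n) = a := Fin.ext ha.symm
        simp [this, ha]
      · have : (⟨0, hn⟩ : Fin n) ≠ a := fun h => ha (congrArg Fin.val h).symm
        simp [this, ha]
    · have ho' : bd.orth = false := by simpa using ho
      simp only [lowestIdx, ho', dif_pos, Bool.false_eq_true, if_false]
      by_cases ha : (a : ℕ) < k i
      · have : (Finset.univ.filter fun j : Fin (k i) =>
            (⟨j, j.isLt.trans_le (hk i ho')⟩ : Fin n) = a) = {⟨a, ha⟩} := by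
          ext j
          simp [Fin.ext_iff]
        rw [this, if_pos ha]
        simp
      · rw [if_neg ha, Finset.card_eq_zero.2, Nat.cast_zero]
        refine Finset.filter_eq_empty_iff.2 fun j _ h => ha ?_
        rw [← h]
        exact j.isLt
  · rw [modGen_inr, Matrix.neg_mulVec, h1, ← neg_smul]
    congr 1
    rw [modWt]
    by_cases ha : (a : ℕ) + 1 = n
    · have h2 : (Finset.univ.filter fun t : Site k m =>
          block t = .inr s ∧ lowestIdx (bd := bd) hn hk t = a.rev) = {.inl s} := by
        ext t
        simp only [Finset.mem_filter, Finset.mem_univ, true_and, Finset.mem_singleton]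
        constructor
        · rintro ⟨h, -⟩
          rcases t with t | t
          · simp only [block, Sum.inr.injEq] at h
            rw [h]
          · simp [block] at h
        · rintro rfl
          refine ⟨rfl, Fin.ext ?_⟩
          rw [Fin.val_rev]
          simp only [lowestIdx]
          omega
      rw [h2, if_pos ha]
      simp
    · rw [if_neg ha, Finset.card_eq_zero.2, Nat.cast_zero, neg_zero]
      refine Finset.filter_eq_empty_iff.2 fun t _ h => ha ?_
      obtain ⟨h3, h4⟩ := h
      rcases t with t | t
      · have := congrArg Fin.val h4
        rw [Fin.val_rev] at this
        simp only [lowestIdx] at this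
        have := a.isLt
        omega
      · simp [block] at h3

end LowestTensor

/-! ### Commutation relations and quadratic equations of the site generators. -/

section Relations

variable {n : ℕ} (bd : Boundary) {ℓ : ℕ} {k : Fin ℓ → ℕ} {m : ℕ}

theorem blockUnit_commute {R : Type*} [CommRing R] {c c' : ModIdx ℓ m} (h : c ≠ c') (a b a' b' : Fin n) :
    Commute (blockUnit (k := k) R c a b) (blockUnit R c' a' b') := by
  refine Commute.sum_left _ _ _ fun s hs => Commute.sum_right _ _ _ fun t ht => ?_
  rw [Finset.mem_filter] at hs ht
  exact siteUnit_commute (fun e => h (by rw [← hs.2, ← ht.2, e])) _ _ _ _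

theorem blockUnit_bracket {R : Type*} [CommRing R] (c : ModIdx ℓ m) (a b a' b' : Fin n) :
    blockUnit (k := k) R c a b * blockUnit R c a' b' =
      blockUnit R c a' b' * blockUnit R c a b +
        ((if b = a' then blockUnit R c a b' else 0) - if b' = a then blockUnit R c a' b else 0) := by
  simp only [blockUnit, Finset.sum_mul, Finset.mul_sum]
  rw [Finset.sum_comm (f := fun t s => siteUnit R s a' b' * siteUnit R t a b)]
  have e : ∀ (p : Prop) [Decidable p] (F : Site k m → Matrix (Site k m → Fin n) (Site k m → Fin n) R)
      (A : Finset (Site k m)), (if p then ∑ s ∈ A, F s else 0) = ∑ s ∈ A, if p then F s else 0 := by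
    intro p _ F A
    split_ifs <;> simp
  rw [e, e, ← Finset.sum_sub_distrib, ← Finset.sum_add_distrib]
  refine Finset.sum_congr rfl fun s hs => ?_
  rw [← Finset.add_sum_erase _ _ hs, ← Finset.add_sum_erase _ _ hs, siteUnit_mul_siteUnit,
    siteUnit_mul_siteUnit]
  have h2 : ∀ t ∈ (Finset.univ.filter fun s : Site k m => block s = c).erase s,
      siteUnit R t a b * siteUnit R s a' b' = siteUnit R s a' b' * siteUnit R t a b := fun t ht =>
    siteUnit_commute (Finset.ne_of_mem_erase ht) _ _ _ _
  rw [Finset.sum_congr rfl h2]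
  abel

theorem modGen_entryComm {R : Type*} [CommRing R] {s t : ModIdx ℓ m} (h : s ≠ t) :
    EntryComm (modGen n k m R s) (modGen n k m R t) := by
  intro a b a' b'
  have hc : ∀ b a b' a', Commute (blockUnit (n := n) (k := k) R s b a) (blockUnit R t b' a') :=
    blockUnit_commute h
  rcases s with i | s <;> rcases t with i' | t <;> simp only [modGen_inl, modGen_inr]
  · exact hc _ _ _ _
  · exact Commute.neg_right (hc _ _ _ _)
  · exact Commute.neg_left (hc _ _ _ _)
  · exact Commute.neg_left (Commute.neg_right (hc _ _ _ _))

/-- For the factors of `W` the sign and the index reversal realise the dual of the vector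
representation with its basis reversed, so the same brackets hold. -/
theorem modGen_comm {R : Type*} [CommRing R] (s : ModIdx ℓ m) (i j a b : Fin n) :
    modGen n k m R s a b * modGen n k m R s i j = modGen n k m R s i j * modGen n k m R s a b +
      ((if a = j then modGen n k m R s i b else 0) - if i = b then modGen n k m R s a j else 0) := by
  rcases s with c | s
  · simp only [modGen_inl]
    rw [blockUnit_bracket]
  · simp only [modGen_inr, neg_mul_neg]
    rw [blockUnit_bracket]
    simp only [Fin.rev_inj, eq_comm (a := j), eq_comm (a := b)]
    split_ifs <;> abel

/-- The coefficients of the quadratic equations. -/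
def modLin (bd : Boundary) (n : ℕ) (k : Fin ℓ → ℕ) : ModIdx ℓ m → ℂ
  | .inl i => bd.eps * ((k i : ℂ) - 1)
  | .inr _ => -n

/-- The constant terms of the quadratic equations. -/
def modConst (k : Fin ℓ → ℕ) : ModIdx ℓ m → ℂ
  | .inl i => k i
  | .inr _ => 0

/-- In a bulk block the `k` diagonal terms of the square are identities, and the terms at two
different factors reduce by symmetry to `ε` times a generator, each generator occurring `k - 1`
times. On a factor of `W` it is the relation `Q² = n Q` for `x = -Q`. -/
theorem modGen_quad {D : Type*} (J : Matrix (Site k m → Fin n) D ℂ)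
    (hJ : ∀ i (j j' : Fin (k i)), j ≠ j' → ∀ f d,
      J (f ∘ Equiv.swap (.inr ⟨i, j⟩) (.inr ⟨i, j'⟩)) d = bd.eps * J f d)
    (s : ModIdx ℓ m) (a b : Fin n) :
    (modGen n k m ℂ s * modGen n k m ℂ s) a b * J =
      (modLin bd n k s • modGen n k m ℂ s + modConst k s • 1 : Matrix (Fin n) (Fin n) _) a b * J := by
  rcases s with i | s
  · have h1 : ∀ j j' : Fin (k i), (siteGen ℂ (Sum.inr ⟨i, j⟩ : Site k m) *
        siteGen ℂ (Sum.inr ⟨i, j'⟩) : Matrix (Fin n) (Fin n) _) a b * J =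
        if j = j' then (1 : Matrix (Fin n) (Fin n) (Matrix _ _ ℂ)) a b * J else
          bd.eps • (siteGen ℂ (Sum.inr ⟨i, j'⟩ : Site k m) a b * J) := by
      intro j j'
      split_ifs with h
      · rw [← h, Matrix.mul_apply]
        simp only [siteGen_apply, siteUnit_mul_siteUnit, Matrix.one_apply]
        congr 1
        split_ifs with hab
        · exact sum_siteUnit_diag _
        · simp
      · rw [siteGen_apply, ← sum_siteUnit_mul_of_symm (fun e => h (by simpa using e)) bd.eps J
          (hJ i j j' h), Matrix.mul_apply]
        rfl
    have h2 : (modGen n k m ℂ (.inl i) * modGen n k m ℂ (.inl i)) a b * J =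
        ∑ j' : Fin (k i), ∑ j : Fin (k i), (siteGen ℂ (Sum.inr ⟨i, j⟩ : Site k m) *
        siteGen ℂ (Sum.inr ⟨i, j'⟩) : Matrix (Fin n) (Fin n) _) a b * J := by
      rw [modGen, Finset.sum_mul_sum, Matrix.sum_apply, Matrix.sum_mul, Finset.sum_comm]
      refine Finset.sum_congr rfl fun j _ => ?_
      rw [Matrix.sum_apply, Matrix.sum_mul]
    have h3 : ∀ j' : Fin (k i), ∑ j : Fin (k i), (siteGen ℂ (Sum.inr ⟨i, j⟩ : Site k m) *
        siteGen ℂ (Sum.inr ⟨i, j'⟩) : Matrix (Fin n) (Fin n) _) a b * J =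
        (1 : Matrix (Fin n) (Fin n) (Matrix _ _ ℂ)) a b * J +
          (bd.eps * ((k i : ℂ) - 1)) • (siteGen ℂ (Sum.inr ⟨i, j'⟩ : Site k m) a b * J) := by
      intro j'
      simp only [h1]
      rw [← Finset.add_sum_erase _ _ (Finset.mem_univ j'), if_pos rfl,
        Finset.sum_congr rfl fun j hj => if_neg (Finset.ne_of_mem_erase hj), Finset.sum_const,
        Finset.card_erase_of_mem (Finset.mem_univ j'), Finset.card_univ, Fintype.card_fin,
        ← Nat.cast_smul_eq_nsmul ℂ, smul_smul, Nat.cast_sub (by have := j'.isLt; omega)]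
      congr 2
      push_cast
      ring
    rw [h2, Finset.sum_congr rfl fun j' _ => h3 j', Finset.sum_add_distrib, Finset.sum_const,
      Finset.card_univ, Fintype.card_fin, ← Nat.cast_smul_eq_nsmul ℂ, ← Finset.smul_sum]
    simp only [modLin, modConst, modGen, Matrix.add_apply, Matrix.smul_apply, Matrix.add_mul,
      Matrix.smul_mul, Matrix.sum_apply, Matrix.sum_mul]
    rw [add_comm]
    rfl
  · congr 1
    rw [Matrix.mul_apply]
    simp only [modGen, Matrix.of_apply, neg_mul_neg, siteUnit_mul_siteUnit, if_true,
      Finset.sum_const, Finset.card_univ, Fintype.card_fin, modLin, modConst, zero_smul, add_zero,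
      ← Nat.cast_smul_eq_nsmul ℂ]
    change _ = -(n : ℂ) • -siteUnit ℂ (Sum.inl s : Site k m) a.rev b.rev
    rw [neg_smul_neg]

theorem modGen_map {R R' : Type*} [CommRing R] [CommRing R'] (φ : R →+* R') (s : ModIdx ℓ m)
    (a b : Fin n) : (modGen n k m R s a b).map φ = modGen n k m R' s a b := by
  have h : ∀ c b a, (blockUnit (n := n) (k := k) (m := m) R c b a).map φ = blockUnit R' c b a := by
    intro c b a
    have := map_sum (φ.mapMatrix : Matrix (Site k m → Fin n) (Site k m → Fin n) R →+* _)
      (fun s => siteUnit R s b a) (Finset.univ.filter fun s : Site k m => block s = c)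
    refine this.trans (Finset.sum_congr rfl fun s _ => siteUnit_map φ s b a)
  rcases s with i | s
  · rw [modGen_inl, modGen_inl, h]
  · rw [modGen_inr, modGen_inr, ← h]
    ext f g
    simp

end Relations

/-! ### The site generators in coordinates on the symmetric tensors. -/

section SymmetricBasis

variable (bd : Boundary) (n : ℕ) {ℓ : ℕ} (k : Fin ℓ → ℕ) (m : ℕ)

/-- The index set of a basis of the symmetric tensors. -/
abbrev SymIdx : Type := Fin (Module.finrank ℂ (symTensors bd n k m))

/-- A basis of the symmetric tensors. -/
def symBasis : Module.Basis (SymIdx bd n k m) ℂ (symTensors bd n k m) :=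
  Module.finBasis ℂ (symTensors bd n k m)

/-- The matrix of the inclusion of the symmetric tensors. -/
def symMat : Matrix (Site k m → Fin n) (SymIdx bd n k m) ℂ :=
  Matrix.of fun f d => (symBasis bd n k m d).1 f

variable {bd n k m}

theorem symMat_mulVec (v : SymIdx bd n k m → ℂ) :
    (symMat bd n k m).mulVec v = ((symBasis bd n k m).equivFun.symm v).1 := by
  rw [Module.Basis.equivFun_symm_apply]
  funext f
  simp [Matrix.mulVec, dotProduct, symMat, mul_comm]

theorem symMat_mulVec_mem (v : SymIdx bd n k m → ℂ) :
    (symMat bd n k m).mulVec v ∈ symTensors bd n k m := by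
  rw [symMat_mulVec]
  exact Subtype.prop _

theorem exists_symMat_mulVec {ζ : (Site k m → Fin n) → ℂ} (hζ : ζ ∈ symTensors bd n k m) :
    ∃ v, (symMat bd n k m).mulVec v = ζ :=
  ⟨(symBasis bd n k m).equivFun ⟨ζ, hζ⟩, by rw [symMat_mulVec, LinearEquiv.symm_apply_apply]⟩

theorem symMat_mulVec_injective : Function.Injective (symMat bd n k m).mulVec := by
  intro v v' h
  rw [symMat_mulVec, symMat_mulVec] at h
  exact (symBasis bd n k m).equivFun.symm.injective (Subtype.ext h)

/-- This transfers relations to coordinates. It matters for the quadratic equations of the bulk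
blocks, which are proved only on symmetric columns. -/
theorem symMat_mul_injective {X Y : Matrix (SymIdx bd n k m) (SymIdx bd n k m) ℂ}
    (h : symMat bd n k m * X = symMat bd n k m * Y) : X = Y := by
  refine Matrix.toLin'.injective (LinearMap.ext fun v => symMat_mulVec_injective ?_)
  rw [Matrix.toLin'_apply, Matrix.toLin'_apply, Matrix.mulVec_mulVec, Matrix.mulVec_mulVec, h]

theorem symMat_swap (i : Fin ℓ) {j j' : Fin (k i)} (h : j ≠ j') (f : Site k m → Fin n)
    (d : SymIdx bd n k m) :
    symMat bd n k m (f ∘ Equiv.swap (.inr ⟨i, j⟩) (.inr ⟨i, j'⟩)) d =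
      bd.eps * symMat bd n k m f d := by
  obtain ⟨τ, hτ, hs⟩ := exists_swap bd (s := (.inr ⟨i, j⟩ : Site k m)) (t := .inr ⟨i, j'⟩) rfl
    (by simpa using h)
  rw [← hτ, ← hs]
  exact (symBasis bd n k m d).2 τ f

theorem blockUnit_mulVec_mem (c : ModIdx ℓ m) (b a : Fin n) {ζ : (Site k m → Fin n) → ℂ}
    (hζ : ζ ∈ symTensors bd n k m) : (blockUnit ℂ c b a).mulVec ζ ∈ symTensors bd n k m := by
  have : symTensors bd n k m ≤ (symTensors bd n k m).comap (blockUnit ℂ c b a).mulVecLin := by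
    refine symTensors_le_of_symVec bd fun g => ?_
    rw [Submodule.mem_comap, Matrix.mulVecLin_apply, blockUnit_symVec]
    exact Submodule.sum_mem _ fun s _ => symVec_mem bd _
  exact this hζ

theorem modGen_mulVec_mem (s : ModIdx ℓ m) (a b : Fin n) {ζ : (Site k m → Fin n) → ℂ}
    (hζ : ζ ∈ symTensors bd n k m) : (modGen n k m ℂ s a b).mulVec ζ ∈ symTensors bd n k m := by
  rcases s with i | s
  · rw [modGen_inl]
    exact blockUnit_mulVec_mem _ _ _ hζ
  · rw [modGen_inr, Matrix.neg_mulVec]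
    exact Submodule.neg_mem _ (blockUnit_mulVec_mem _ _ _ hζ)

theorem exists_mul_symMat_eq {M : Matrix (Site k m → Fin n) (Site k m → Fin n) ℂ}
    (hM : ∀ ζ ∈ symTensors bd n k m, M.mulVec ζ ∈ symTensors bd n k m) :
    ∃ X, M * symMat bd n k m = symMat bd n k m * X := by
  choose v hv using fun d => exists_symMat_mulVec (hM _ (symBasis bd n k m d).2)
  refine ⟨Matrix.of fun e d => v d e, ?_⟩
  ext f d
  exact (congrFun (hv d) f).symm

variable (bd n k m) in
theorem exists_symGen : ∃ x : ModIdx ℓ m → Matrix (Fin n) (Fin n)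
    (Matrix (SymIdx bd n k m) (SymIdx bd n k m) ℂ),
    ∀ s, Intertwines (symMat bd n k m) (modGen n k m ℂ s) (x s) := by
  choose x hx using fun (s : ModIdx ℓ m) (a b : Fin n) =>
    exists_mul_symMat_eq fun ζ hζ => modGen_mulVec_mem (bd := bd) (k := k) s a b hζ
  exact ⟨fun s => Matrix.of (x s), hx⟩

variable {x : ModIdx ℓ m → Matrix (Fin n) (Fin n) (Matrix (SymIdx bd n k m) (SymIdx bd n k m) ℂ)}

theorem isSite_symGen (hx : ∀ s, Intertwines (symMat bd n k m) (modGen n k m ℂ s) (x s))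
    (s : ModIdx ℓ m) : IsSite (x s) (modLin bd n k s) (modConst k s) where
  comm i j a b := by
    refine symMat_mul_injective ?_
    have h1 := congrArg (· * symMat bd n k m) (modGen_comm (k := k) (R := ℂ) s i j a b)
    have h2 : ∀ (p : Prop) [Decidable p] (a b : Fin n),
        (if p then modGen n k m ℂ s a b else 0) * symMat bd n k m =
          symMat bd n k m * (if p then x s a b else 0) := by
      intro p _ a b
      split_ifs
      · exact hx s a b
      · simp
    simp only [Matrix.add_mul, Matrix.sub_mul, h2] at h1
    rw [Matrix.mul_assoc, Matrix.mul_assoc, hx, hx, ← Matrix.mul_assoc, ← Matrix.mul_assoc, hx, hx] at h1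
    rw [Matrix.mul_add, Matrix.mul_sub, ← Matrix.mul_assoc, ← Matrix.mul_assoc]
    exact h1
  quad := by
    ext1 a b
    refine symMat_mul_injective ?_
    have h1 := modGen_quad bd (symMat bd n k m) (fun i j j' h f d => symMat_swap i h f d) s a b
    rw [((hx s).mul (hx s)) a b] at h1
    rw [h1]
    have h2 := ((hx s).smul (modLin bd n k s)) a b
    have h3 := ((Intertwines.one (J := symMat bd n k m) (n := n)).smul (modConst k s)) a b
    rw [Matrix.add_apply, Matrix.add_apply, Matrix.add_mul, Matrix.mul_add, h2, h3]

theorem entryComm_symGen (hx : ∀ s, Intertwines (symMat bd n k m) (modGen n k m ℂ s) (x s))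
    {s t : ModIdx ℓ m} (h : s ≠ t) : EntryComm (x s) (x t) := by
  intro a b a' b'
  refine symMat_mul_injective ?_
  have h1 := congrArg (· * symMat bd n k m) (modGen_entryComm (k := k) (R := ℂ) h a b a' b').eq
  simp only [Matrix.mul_assoc] at h1
  rw [hx, hx, ← Matrix.mul_assoc, ← Matrix.mul_assoc, hx, hx] at h1
  rw [← Matrix.mul_assoc, ← Matrix.mul_assoc]
  exact h1

theorem symMat_mulVec_symGen (hx : ∀ s, Intertwines (symMat bd n k m) (modGen n k m ℂ s) (x s))
    (s : ModIdx ℓ m) (a b : Fin n) (v : SymIdx bd n k m → ℂ) :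
    (symMat bd n k m).mulVec ((x s a b).mulVec v) =
      (modGen n k m ℂ s a b).mulVec ((symMat bd n k m).mulVec v) := by
  rw [Matrix.mulVec_mulVec, Matrix.mulVec_mulVec, hx]

theorem cyclicFam_symGen (hx : ∀ s, Intertwines (symMat bd n k m) (modGen n k m ℂ s) (x s))
    {ξ : SymIdx bd n k m → ℂ} {g : Site k m → Fin n} (hg : Admissible bd g)
    (hξ : (symMat bd n k m).mulVec ξ = symVec bd g) :
    CyclicFam (fun t : ModIdx ℓ m × Fin n × Fin n => x t.1 t.2.1 t.2.2) ξ := by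
  intro N hN hstab
  set N' := N.map (symMat bd n k m).mulVecLin with hN'
  have hmod : ∀ (s : ModIdx ℓ m) a b, ∀ z ∈ N', (modGen n k m ℂ s a b).mulVec z ∈ N' := by
    rintro s a b _ ⟨v, hv, rfl⟩
    refine ⟨_, hstab (s, a, b) v hv, ?_⟩
    rw [Matrix.mulVecLin_apply, Matrix.mulVecLin_apply, symMat_mulVec_symGen hx]
  have hle : symTensors bd n k m ≤ N' := by
    refine symTensors_le_of_stable (fun c b a z hz => ?_) hg ⟨ξ, hN, hξ⟩
    rcases c with i | s
    · have := hmod (.inl i) a b z hz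
      rwa [modGen_inl] at this
    · have := hmod (.inr s) b.rev a.rev z hz
      rwa [modGen_inr, Fin.rev_rev, Fin.rev_rev, Matrix.neg_mulVec, Submodule.neg_mem_iff] at this
  refine eq_top_iff.2 fun v _ => ?_
  obtain ⟨v', hv', h⟩ := hle (symMat_mulVec_mem v)
  rwa [← symMat_mulVec_injective h]

end SymmetricBasis

/-! ### The nested vacuum sector as the space of symmetric upper tensors. -/

section Vacuum

variable {n : ℕ} {bd : Boundary} {ℓ : ℕ} {k : Fin ℓ → ℕ} {m : ℕ}

theorem upperMat_mulVec_upperIdx {R : Type*} [CommRing R] (z : (Site k m → Fin n) → R)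
    (g : Site k m → Fin n) : (upperMat n k m R).mulVec z (upperIdx g) = z g := by
  simp [Matrix.mulVec, dotProduct, upperMat, upperIdx_injective.eq_iff]

theorem upperMat_mulVec_eq_zero {R : Type*} [CommRing R] (z : (Site k m → Fin n) → R)
    {q : TotIdx n k m} {t : Σ i : Fin ℓ, Fin (k i)} {a : Fin n} (h : q.2 t = .inr a) :
    (upperMat n k m R).mulVec z q = 0 := by
  rw [Matrix.mulVec, dotProduct]
  refine Finset.sum_eq_zero fun g _ => ?_
  rw [upperMat, Matrix.of_apply, if_neg, zero_mul]
  rintro rfl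
  simp [upperIdx] at h

theorem eq_upperIdx_or (q : TotIdx n k m) :
    (∃ g : Site k m → Fin n, q = upperIdx g) ∨ ∃ t a, q.2 t = .inr a := by
  by_cases h : ∃ t a, q.2 t = .inr a
  · exact .inr h
  · left
    have h' : ∀ t, ∃ a, q.2 t = .inl a := by
      intro t
      rcases hq : q.2 t with a | a
      · exact ⟨a, rfl⟩
      · exact absurd ⟨t, a, hq⟩ h
    choose b hb using h'
    exact ⟨Sum.elim q.1 b, Prod.ext rfl (funext hb)⟩

theorem upperMat_mulVec_injective :
    Function.Injective (upperMat n k m ℂ).mulVec := fun z z' h => funext fun g => by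
  rw [← upperMat_mulVec_upperIdx z, h, upperMat_mulVec_upperIdx]

theorem nestedVacuum_le (hn : 1 ≤ n) (hn' : bd.orth = true → 2 ≤ n)
    (hk : ∀ i, bd.orth = false → k i ≤ n) (c : Fin ℓ → ℂ) :
    nestedVacuum n bd k c m ≤ (symTensors bd n k m).map (upperMat n k m ℂ).mulVecLin := by
  rw [nestedVacuum, Submodule.span_le]
  rintro _ ⟨ω, ζ, hζ, rfl⟩
  have hζ' := fun i => (mem_vacuum_iff hn hn' (hk i)).1 (hζ i)
  refine ⟨fun g => ω (fun s => g (.inl s)) * ∏ i, ζ i (fun j => .inl (g (.inr ⟨i, j⟩))), ?_, ?_⟩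
  · intro σ g
    rw [blockSign_apply, mul_left_comm, ← Finset.prod_mul_distrib]
    refine congrArg₂ (· * ·) rfl (Finset.prod_congr rfl fun i _ => ?_)
    exact (hζ' i).1 (σ i) (fun j => .inl (g (.inr ⟨i, j⟩)))
  · funext q
    rw [Matrix.mulVecLin_apply]
    rcases eq_upperIdx_or q with ⟨g, rfl⟩ | ⟨⟨i, j⟩, a, h⟩
    · rw [upperMat_mulVec_upperIdx]
      rfl
    · rw [upperMat_mulVec_eq_zero _ h, Finset.prod_eq_zero (Finset.mem_univ i), mul_zero]
      exact (hζ' i).2 _ j a h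

/-- A symmetrised basis vector is decomposable: the sum over block permutations factors into
symmetrisations of the individual blocks. -/
theorem le_nestedVacuum (hn : 1 ≤ n) (hn' : bd.orth = true → 2 ≤ n)
    (hk : ∀ i, bd.orth = false → k i ≤ n) (c : Fin ℓ → ℂ) :
    (symTensors bd n k m).map (upperMat n k m ℂ).mulVecLin ≤ nestedVacuum n bd k c m := by
  rw [Submodule.map_le_iff_le_comap]
  refine symTensors_le_of_symVec bd fun g => Submodule.subset_span
    ⟨fun p => if p = fun s => g (.inl s) then 1 else 0, fun i f => ∑ τ : Equiv.Perm (Fin (k i)),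
      symSign bd _ τ * if f ∘ τ = fun j => .inl (g (.inr ⟨i, j⟩)) then 1 else 0, fun i => ?_, ?_⟩
  · refine (mem_vacuum_iff hn hn' (hk i)).2 ⟨fun σ f => ?_, fun f j a h => ?_⟩
    · rw [Finset.mul_sum]
      refine Eq.trans (Finset.sum_congr rfl fun τ _ => ?_) (Equiv.sum_comp (Equiv.mulLeft σ) _)
      rw [Equiv.coe_mulLeft, map_mul, ← mul_assoc, ← mul_assoc, symSign_mul_self, one_mul,
        Function.comp_assoc, ← Equiv.Perm.coe_mul]
    · refine Finset.sum_eq_zero fun τ _ => ?_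
      rw [if_neg, mul_zero]
      intro h'
      have := congrFun h' (τ.symm j)
      rw [Function.comp_apply, Equiv.apply_symm_apply, h] at this
      simp at this
  · funext q
    rw [Matrix.mulVecLin_apply]
    rcases eq_upperIdx_or q with ⟨f, rfl⟩ | ⟨⟨i, j⟩, a, h⟩
    · rw [upperMat_mulVec_upperIdx, Finset.prod_univ_sum, Fintype.piFinset_univ, Finset.mul_sum]
      refine Finset.sum_congr rfl fun σ _ => ?_
      rw [Finset.prod_mul_distrib, blockSign_apply, mul_left_comm, Finset.prod_boole]
      refine congrArg₂ (· * ·) rfl ?_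
      have e : f ∘ permSite m σ = g ↔ ((upperIdx f).1 = fun s => g (.inl s)) ∧
          ∀ i ∈ Finset.univ, (fun j => (upperIdx f).2 ⟨i, j⟩) ∘ σ i =
            fun j => .inl (g (.inr ⟨i, j⟩)) := by
        constructor
        · rintro rfl
          exact ⟨rfl, fun i _ => rfl⟩
        · rintro ⟨h1, h2⟩
          funext s
          rcases s with s | ⟨i, j⟩
          · exact congrFun h1 s
          · exact Sum.inl_injective (congrFun (h2 i (Finset.mem_univ i)) j)
      beta_reduce
      by_cases h1 : (upperIdx f).1 = fun s => g (.inl s)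
      · rw [if_pos h1, one_mul]
        by_cases h2 : f ∘ permSite m σ = g
        · rw [if_pos h2, if_pos (e.1 h2).2]
        · rw [if_neg h2, if_neg fun h => h2 (e.2 ⟨h1, h⟩)]
      · rw [if_neg h1, zero_mul, if_neg fun h => h1 (e.1 h).1]
    · rw [upperMat_mulVec_eq_zero _ h, Finset.prod_eq_zero (Finset.mem_univ i), mul_zero]
      refine Finset.sum_eq_zero fun τ _ => ?_
      rw [if_neg, mul_zero]
      intro h'
      have := congrFun h' (τ.symm j)
      rw [Function.comp_apply, Equiv.apply_symm_apply] at this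
      exact absurd (h.symm.trans this) (by simp)

/-- Coordinates on the nested vacuum sector. -/
theorem exists_nestedVacuum_equiv (hn : 1 ≤ n) (hn' : bd.orth = true → 2 ≤ n)
    (hk : ∀ i, bd.orth = false → k i ≤ n) (c : Fin ℓ → ℂ) :
    ∃ E : (SymIdx bd n k m → ℂ) ≃ₗ[ℂ] nestedVacuum n bd k c m,
      ∀ v, (E v).1 = (upperMat n k m ℂ * symMat bd n k m).mulVec v := by
  have hmem : ∀ v, (upperMat n k m ℂ * symMat bd n k m).mulVec v ∈ nestedVacuum n bd k c m := by
    intro v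
    rw [← Matrix.mulVec_mulVec]
    exact le_nestedVacuum hn hn' hk c ⟨_, symMat_mulVec_mem v, rfl⟩
  refine ⟨LinearEquiv.ofBijective
    ((upperMat n k m ℂ * symMat bd n k m).mulVecLin.codRestrict _ hmem) ⟨?_, ?_⟩, fun v => rfl⟩
  · intro v v' h
    have h1 := congrArg Subtype.val h
    change (upperMat n k m ℂ * symMat bd n k m).mulVec v =
      (upperMat n k m ℂ * symMat bd n k m).mulVec v' at h1
    rw [← Matrix.mulVec_mulVec, ← Matrix.mulVec_mulVec] at h1
    exact symMat_mulVec_injective (upperMat_mulVec_injective h1)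
  · rintro ⟨x, hx⟩
    obtain ⟨ζ, hζ, rfl⟩ := nestedVacuum_le hn hn' hk c hx
    obtain ⟨v, rfl⟩ := exists_symMat_mulVec hζ
    refine ⟨v, Subtype.ext ?_⟩
    change (upperMat n k m ℂ * symMat bd n k m).mulVec v = _
    rw [← Matrix.mulVec_mulVec]
    rfl

end Vacuum

/-! ### The nested monodromy matrix acting on coordinates. -/

section NestedAction

variable {n : ℕ} {bd : Boundary} {ℓ : ℕ} {k : Fin ℓ → ℕ} {m : ℕ}
  {x : ModIdx ℓ m → Matrix (Fin n) (Fin n) (Matrix (SymIdx bd n k m) (SymIdx bd n k m) ℂ)}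

theorem intertwines_extScal {R : Type*} [CommRing R] (φ : ℂ →+* R)
    (hx : ∀ s, Intertwines (symMat bd n k m) (modGen n k m ℂ s) (x s)) (s : ModIdx ℓ m) :
    Intertwines ((symMat bd n k m).map φ) (modGen n k m R s) (extScal φ (x s)) := by
  intro a b
  have h := congrArg (fun M => M.map φ) (hx s a b)
  simp only [Matrix.map_mul, modGen_map] at h
  exact h

theorem nestedGen_mulVec {R : Type*} [CommRing R] (φ : ℂ →+* R)
    (hx : ∀ s, Intertwines (symMat bd n k m) (modGen n k m ℂ s) (x s))
    (g : R) (K : Idx n → R) (α β α' β' : ∀ i : Fin ℓ, Fin (k i) → R) (δ δ' : Fin ℓ → ℕ → R)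
    (hδ : ∀ i j, δ i j = δ i (j + 1) * (1 - φ bd.eps * δ i j))
    (hδ' : ∀ i j, δ' i j = δ' i (j + 1) * (1 - φ bd.eps * δ' i j))
    (hα : ∀ i j, α i j = δ i j) (hβ : ∀ i (j : Fin (k i)), -β' i j.rev = δ' i j)
    (η η' : Fin m ⊕ Fin m → R) (a b : Fin n) (v : SymIdx bd n k m → ℂ) (q : TotIdx n k m) :
    (nestedGen k m η η' (monodromyGen bd n k g K α β α' β') a b).mulVec
      (fun q => φ ((upperMat n k m ℂ * symMat bd n k m).mulVec v q)) q =
      g * ((upperMat n k m ℂ * symMat bd n k m).map φ).mulVec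
        ((laxProd (modList ℓ m) (fun s => extScal φ (x s))
        (Sum.elim (fun i => δ i 0) fun s => -η s) (Sum.elim (fun i => δ' i 0) fun s => -η' s)
        (fun i => K (.inl i)) a b).mulVec (fun d => φ (v d))) q := by
  have e : (upperMat n k m ℂ * symMat bd n k m).map φ =
      upperMat n k m R * (symMat bd n k m).map φ := by
    rw [Matrix.map_mul]
    congr 1
    ext q g
    simp [upperMat, apply_ite φ]
  have e1 : (fun q => φ ((upperMat n k m ℂ * symMat bd n k m).mulVec v q)) =
      (upperMat n k m R * (symMat bd n k m).map φ).mulVec (fun d => φ (v d)) := by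
    rw [← e]
    funext q
    exact RingHom.map_mulVec φ _ v q
  have h := nestedGen_mul bd ((symMat bd n k m).map φ) (intertwines_extScal φ hx) (φ bd.eps)
    (fun i j j' h f d => by
      rw [Matrix.map_apply, Matrix.map_apply, symMat_swap i h, map_mul]) g K α β α' β' δ δ' hδ hδ'
    hα hβ η η' a b
  rw [e1, e, Matrix.mulVec_mulVec, h, ← Matrix.mulVec_mulVec, Matrix.smul_apply, Matrix.smul_mulVec,
    Matrix.mulVec_smul, Pi.smul_apply, smul_eq_mul]

open PowerSeries in
theorem map_mulVec_extScal {T D R : Type*} [Fintype D] [DecidableEq D] [CommRing R]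
    (f : ℂ⟦X⟧ →+* R) (J : Matrix T D ℂ) (B : Matrix (Fin n) (Fin n) (Matrix D D ℂ⟦X⟧))
    (i j : Fin n) (v : D → ℂ) (q : T) :
    (J.map (f.comp C)).mulVec ((extScal f B i j).mulVec (fun d => f (C (v d)))) q =
      f (mk fun s => J.mulVec ((coeffMat B i j s).mulVec v) q) := by
  have h : (mk fun s => J.mulVec ((coeffMat B i j s).mulVec v) q) =
      ∑ d, C (J q d) * ∑ d', B i j d d' * C (v d') := by
    ext s
    simp only [coeff_mk, Matrix.mulVec, dotProduct, map_sum, coeff_C_mul, coeff_mul_C, coeffMat,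
      Matrix.of_apply]
  rw [h]
  simp only [Matrix.mulVec, dotProduct, map_sum, map_mul, Matrix.map_apply, RingHom.comp_apply,
    extScal_apply]

end NestedAction

/-! ### Matching the spectral parameters. -/

section SeriesAction

open PowerSeries

variable {n : ℕ} {bd : Boundary} {ℓ : ℕ} {k : Fin ℓ → ℕ} {m : ℕ}

/-- The shift of the spectral parameter in the one-site modules. -/
def modShift (n : ℕ) (bd : Boundary) (ℓ m : ℕ) : ModIdx ℓ m → ℂ :=
  Sum.elim (fun _ => bd.kappa n / 2) (fun _ => 0)

/-- The evaluation parameters of the one-site modules. -/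
def modParam (n : ℕ) (bd : Boundary) (c : Fin ℓ → ℂ) (u w : Fin m → ℂ) : ModIdx ℓ m → ℂ :=
  Sum.elim c (Sum.elim u w) + modShift n bd ℓ m

theorem inv_shift {F : Type*} [Field F] {y e : F} (h : y ≠ 0) (h' : y - e ≠ 0) :
    y⁻¹ = (y - e)⁻¹ * (1 - e * y⁻¹) := by
  field_simp

theorem inv_eq_neg_inv {F : Type*} [Field F] {y z : F} (h : y = -z) : y⁻¹ = -z⁻¹ := by
  rw [h, inv_neg]

theorem vv_sub_cst_inv (a : ℂ) : (cst a - vv)⁻¹ = -(vv - cst a)⁻¹ :=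
  inv_eq_neg_inv (neg_sub _ _).symm

/-- The crossing shift is automatic. For a bulk space with `a = c + κ/2` the transposed factor gives
`v + ρ + a + ε (k - 1)`, and `ε (k - 1)` is its quadratic coefficient. For a factor of `W` with
parameter `u` it gives `v + ρ + u - n`, by `κ + ε = n`, and `-n` is its quadratic coefficient. -/
theorem nestedMonodromy_mulVec (ρ : ℂ) (c : Fin ℓ → ℂ) (u w : Fin m → ℂ)
    {x : ModIdx ℓ m → Matrix (Fin n) (Fin n) (Matrix (SymIdx bd n k m) (SymIdx bd n k m) ℂ)}
    (hx : ∀ s, Intertwines (symMat bd n k m) (modGen n k m ℂ s) (x s)) {K : Fin n → ℂ⟦X⟧}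
    (hK : ∀ i, bd.kDiag n ρ (.inl i) = toSer (K i)) (a b : Fin n) (v : SymIdx bd n k m → ℂ)
    (q : TotIdx n k m) :
    (nestedMonodromy n bd ρ k c u w a b).mulVec
      (fun q => cst ((upperMat n k m ℂ * symMat bd n k m).mulVec v q)) q =
      bd.gScal n ρ * toSer (mk fun s => (upperMat n k m ℂ * symMat bd n k m).mulVec
        ((coeffMat (laxChain (modList ℓ m) x (modParam n bd c u w)
          (fun s => ρ + modParam n bd c u w s + modLin bd n k s) K) a b s).mulVec v) q) := by
  have hc : toSer.comp C = cst := RingHom.ext toSer_C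
  rw [nestedMonodromy_eq, monodromy_eq]
  refine (nestedGen_mulVec cst hx (bd.gScal n ρ) (bd.kDiag n ρ) _ _ _ _
    (fun i j => (vv - cst (c i) - cst (bd.kappa n / 2) - cst (bd.eps * (j : ℂ)))⁻¹)
    (fun i j => (vv + cst (ρ + c i + bd.kappa n / 2 + bd.eps * ((k i : ℂ) - 1) -
      bd.eps * (j : ℂ)))⁻¹) ?_ ?_ (fun i j => rfl) ?_ _ _ a b v q).trans
    (congrArg (bd.gScal n ρ * ·) ?_)
  · intro i j
    have h1 := vv_sub_cst_ne_zero (c i + bd.kappa n / 2 + bd.eps * (j : ℂ))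
    have h2 := vv_sub_cst_ne_zero (c i + bd.kappa n / 2 + bd.eps * ((j + 1 : ℕ) : ℂ))
    have e1 : vv - cst (c i) - cst (bd.kappa n / 2) - cst (bd.eps * (j : ℂ)) =
        vv - cst (c i + bd.kappa n / 2 + bd.eps * (j : ℂ)) := by simp only [map_add]; ring
    have e2 : vv - cst (c i) - cst (bd.kappa n / 2) - cst (bd.eps * ((j + 1 : ℕ) : ℂ)) =
        vv - cst (c i + bd.kappa n / 2 + bd.eps * (j : ℂ)) - cst bd.eps := by
      push_cast; simp only [map_add, mul_add, mul_one]; ring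
    have e3 : vv - cst (c i + bd.kappa n / 2 + bd.eps * ((j + 1 : ℕ) : ℂ)) =
        vv - cst (c i + bd.kappa n / 2 + bd.eps * (j : ℂ)) - cst bd.eps := by
      push_cast; simp only [map_add, mul_add, mul_one]; ring
    rw [e3] at h2
    rw [e1, e2]
    exact inv_shift h1 h2
  · intro i j
    have h1 := vv_add_cst_ne_zero (ρ + c i + bd.kappa n / 2 + bd.eps * ((k i : ℂ) - 1) -
      bd.eps * (j : ℂ))
    have h2 := vv_add_cst_ne_zero (ρ + c i + bd.kappa n / 2 + bd.eps * ((k i : ℂ) - 1) -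
      bd.eps * ((j + 1 : ℕ) : ℂ))
    have e2 : vv + cst (ρ + c i + bd.kappa n / 2 + bd.eps * ((k i : ℂ) - 1) -
      bd.eps * ((j + 1 : ℕ) : ℂ)) = vv + cst (ρ + c i + bd.kappa n / 2 + bd.eps * ((k i : ℂ) - 1) -
      bd.eps * (j : ℂ)) - cst bd.eps := by
      push_cast; simp only [map_add, map_sub, mul_add, mul_one]; ring
    rw [e2] at h2 ⊢
    exact inv_shift h1 h2
  -- The identity is `ṽ - c - κ/2 - ε (k - 1 - j) - κ = -(v + ρ + c + κ/2 + ε (k - 1) - ε j)`.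
  · intro i j
    have hj : ((j.rev : ℕ) : ℂ) = (k i : ℂ) - 1 - j := by
      rw [Fin.val_rev, Nat.cast_sub (by omega)]
      push_cast
      ring
    rw [hj]
    refine (inv_eq_neg_inv ?_).symm
    simp only [Boundary.vTilde, map_add, map_sub, mul_sub, map_mul, mul_one]
    have : cst (bd.kappa n) = cst (bd.kappa n / 2) + cst (bd.kappa n / 2) := by
      rw [← map_add, add_halves]
    ring
  · refine Eq.trans ?_ (map_mulVec_extScal toSer _ _ a b v q)
    rw [hc]
    have hv : (fun d => toSer (C (v d))) = fun d => cst (v d) := funext fun d => toSer_C (v d)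
    rw [hv]
    have hL : extScal toSer (laxChain (modList ℓ m) x (modParam n bd c u w)
          (fun s => ρ + modParam n bd c u w s + modLin bd n k s) K) =
        laxProd (modList ℓ m) (fun s => extScal cst (x s))
          (Sum.elim (fun i => (vv - cst (c i) - cst (bd.kappa n / 2) - cst (bd.eps * ((0 : ℕ) : ℂ)))⁻¹)
            fun s => -Sum.elim (fun i => (cst (u i) - vv)⁻¹) (fun i => (cst (w i) - vv)⁻¹) s)
          (Sum.elim (fun i => (vv + cst (ρ + c i + bd.kappa n / 2 + bd.eps * ((k i : ℂ) - 1) -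
            bd.eps * ((0 : ℕ) : ℂ)))⁻¹)
            fun s => -Sum.elim (fun i => (cst (bd.kappa n - u i - ρ) - vv + cst bd.eps)⁻¹)
              (fun i => (cst (bd.kappa n - w i - ρ) - vv + cst bd.eps)⁻¹) s)
          (fun i => bd.kDiag n ρ (.inl i)) := by
      refine (extScal_laxProd toSer _ _ _ _ _).trans ?_
      have h1 : ∀ s, extScal toSer (extScal C (x s)) = extScal cst (x s) := fun s => by
        rw [extScal_extScal, hc]
      have h2 : (fun s => toSer (geo (modParam n bd c u w s))) =
          Sum.elim (fun i => (vv - cst (c i) - cst (bd.kappa n / 2) - cst (bd.eps * ((0 : ℕ) : ℂ)))⁻¹)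
            fun s => -Sum.elim (fun i => (cst (u i) - vv)⁻¹) (fun i => (cst (w i) - vv)⁻¹) s := by
        funext s
        rw [toSer_geo]
        rcases s with i | i | i
        · simp [modParam, modShift, sub_sub]
        · simp [modParam, modShift, vv_sub_cst_inv]
        · simp [modParam, modShift, vv_sub_cst_inv]
      have h3 : (fun s => toSer (geo (-(ρ + modParam n bd c u w s + modLin bd n k s)))) =
          Sum.elim (fun i => (vv + cst (ρ + c i + bd.kappa n / 2 + bd.eps * ((k i : ℂ) - 1) -
            bd.eps * ((0 : ℕ) : ℂ)))⁻¹)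
            fun s => -Sum.elim (fun i => (cst (bd.kappa n - u i - ρ) - vv + cst bd.eps)⁻¹)
              (fun i => (cst (bd.kappa n - w i - ρ) - vv + cst bd.eps)⁻¹) s := by
        funext s
        rw [toSer_geo]
        rcases s with i | i | i
        · simp only [modParam, modShift, modLin, Pi.add_apply, Sum.elim_inl, Nat.cast_zero, mul_zero,
            sub_zero]
          congr 1
          simp only [map_neg, map_add]
          ring
        · simp only [modParam, modShift, modLin, Pi.add_apply, Sum.elim_inl, Sum.elim_inr, add_zero]
          refine inv_eq_neg_inv ?_
          simp only [Boundary.kappa, map_neg, map_add, map_sub]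
          ring
        · simp only [modParam, modShift, modLin, Pi.add_apply, Sum.elim_inr, add_zero]
          refine inv_eq_neg_inv ?_
          simp only [Boundary.kappa, map_neg, map_add, map_sub]
          ring
      simp only [h1, h2, h3, hK]
    rw [hL]

end SeriesAction

/-! ### Identification of the weight. -/

section Weight

open PowerSeries

variable {n : ℕ} {bd : Boundary} {ℓ : ℕ} {k : Fin ℓ → ℕ} {m : ℕ}

theorem bulkFactor_eq (ρ : ℂ) (c : Fin ℓ → ℂ) (u w : Fin m → ℂ) (i : Fin ℓ) (j : Fin n) :
    toSer ((1 - geo (modParam n bd c u w (.inl i)) * C (modWt bd n k (.inl i : ModIdx ℓ m) j)) *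
      (1 - geo (-(ρ + modParam n bd c u w (.inl i) + modLin bd n k (.inl i : ModIdx ℓ m))) *
        C (modWt bd n k (.inl i : ModIdx ℓ m) j))) =
      bulkFactor n bd (k i) (c i) j (vv - cst (bd.kappa n / 2))
        (bd.vTilde n ρ - cst (bd.kappa n / 2)) := by
  simp only [map_mul, map_sub, map_one, toSer_geo, toSer_C, bulkFactor, modWt, modLin]
  have e1 : vv - cst (modParam n bd c u w (.inl i)) = vv - cst (bd.kappa n / 2) - cst (c i) := by
    simp only [modParam, modShift, Pi.add_apply, Sum.elim_inl, map_add]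
    ring
  have e2 : vv - cst (-(ρ + modParam n bd c u w (.inl i) + bd.eps * ((k i : ℂ) - 1))) =
      -(bd.vTilde n ρ - cst (bd.kappa n / 2) - cst (c i) - cst bd.eps * (cst (k i) - 1) -
        cst (bd.kappa n)) := by
    simp only [modParam, modShift, Pi.add_apply, Sum.elim_inl, map_add, map_neg, map_mul, map_sub,
      map_one, Boundary.vTilde]
    ring
  have h : ∀ {F : Type} [Field F] (y y' z z' t : F), y = y' → z = -z' →
      (1 - y⁻¹ * t) * (1 - z⁻¹ * t) = (1 - t / y') * (1 + t / z') := by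
    rintro F _ y y' z z' t rfl rfl
    rw [inv_neg]
    ring
  exact h _ _ _ _ _ e1 e2

theorem auxFactor_eq (z : ℂ) : (1 - (vv - cst z)⁻¹ * cst (-1)) = auxFactor z := by
  have h : ∀ {F : Type} [Field F] (y t : F), y ≠ 0 → t = -1 → 1 - y⁻¹ * t = (y + 1) / y := by
    rintro F _ y t hy rfl
    field_simp
    ring
  exact h _ _ (vv_sub_cst_ne_zero z) (by rw [map_neg, map_one])

theorem auxFactors_eq (ρ : ℂ) (c : Fin ℓ → ℂ) (u w : Fin m → ℂ) (s : Fin m ⊕ Fin m) (j : Fin n) :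
    toSer ((1 - geo (modParam n bd c u w (.inr s)) * C (modWt bd n k (.inr s : ModIdx ℓ m) j)) *
      (1 - geo (-(ρ + modParam n bd c u w (.inr s) + modLin bd n k (.inr s : ModIdx ℓ m))) *
        C (modWt bd n k (.inr s : ModIdx ℓ m) j))) =
      if (j : ℕ) + 1 = n then auxFactor (Sum.elim u w s) *
        auxFactor (bd.kappa n - Sum.elim u w s - ρ + bd.eps) else 1 := by
  simp only [map_mul, map_sub, map_one, toSer_geo, toSer_C, modWt, modLin]
  split_ifs
  · rw [← auxFactor_eq, ← auxFactor_eq]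
    have e1 : modParam n bd c u w (.inr s) = Sum.elim u w s := by
      simp [modParam, modShift]
    have e2 : -(ρ + Sum.elim u w s + -(n : ℂ)) = bd.kappa n - Sum.elim u w s - ρ + bd.eps := by
      rw [Boundary.kappa]; ring
    rw [e1, e2]
  · simp

theorem tildeW_eq_nestedWeight (ρ : ℂ) (c : Fin ℓ → ℂ) (u w : Fin m → ℂ) {K γ : Fin n → ℂ⟦X⟧}
    (hK : ∀ i, bd.kDiag n ρ (.inl i) = toSer (K i)) (j : Fin n)
    (h : tildeGen (2 + C ρ * X) X γ j = tildeGen (2 + C ρ * X) X K j *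
      ((modList ℓ m).map fun s => (1 - geo (modParam n bd c u w s) * C (modWt bd n k s j)) *
        (1 - geo (-(ρ + modParam n bd c u w s + modLin bd n k s)) * C (modWt bd n k s j))).prod) :
    tildeW ρ (fun i => bd.gScal n ρ * toSer (γ i)) j = nestedWeight n bd ρ k c u w j := by
  have hprod : ∀ {r : ℕ} (f : Fin r → Ser), ((List.finRange r).map f).prod = ∏ i, f i :=
    fun f => (Fin.prod_univ_def f).symm
  rw [tildeW_mul, tildeW_toSer, h, map_mul, ← mul_assoc vv, ← tildeW_toSer, nestedWeight,
    map_list_prod, List.map_map]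
  simp only [hK, modList, List.map_append, List.map_map, List.prod_append, Function.comp_def,
    bulkFactor_eq, auxFactors_eq, hprod, Sum.elim_inl, Sum.elim_inr]
  split_ifs
  · simp only [Finset.prod_mul_distrib]
    ring
  · simp only [Finset.prod_const_one]
    ring

end Weight

theorem Boundary.Valid.two_le {n : ℕ} {bd : Boundary} (h : bd.Valid n) :
    1 ≤ n ∧ (bd.orth = true → 2 ≤ n) := by
  cases bd <;> simp only [Boundary.Valid, Boundary.orth, Bool.false_eq_true, false_implies,
    and_true] at h ⊢ <;> omega

theorem exists_algHom_conj {A V D : Type*} [Ring A] [Algebra ℂ A] [AddCommGroup V] [Module ℂ V]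
    [Fintype D] [DecidableEq D] (E : (D → ℂ) ≃ₗ[ℂ] V) (Φ : A →ₐ[ℂ] Matrix D D ℂ) :
    ∃ Ψ : A →ₐ[ℂ] Module.End ℂ V, ∀ a v, Ψ a (E v) = E ((Φ a).mulVec v) := by
  refine ⟨(E.conjAlgEquiv ℂ).toAlgHom.comp (Matrix.toLinAlgEquiv'.toAlgHom.comp Φ), fun a v => ?_⟩
  simp [LinearEquiv.conjAlgEquiv_apply, Matrix.toLinAlgEquiv'_apply]

end NestedChain

end

/-! ### The main theorem. -/

open NestedChain in
theorem propositionP (n : ℕ) (bd : Boundary) (hbd : bd.Valid n) (ρ : ℂ)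
    (ℓ : ℕ) (k : Fin ℓ → ℕ) (hk : ∀ i, 1 ≤ k i ∧ (bd.orth = false → k i ≤ n)) (m : ℕ) :
    ∃ F : MvPolynomial (Fin ℓ ⊕ (Fin m ⊕ Fin m)) ℂ, F ≠ 0 ∧
      ∀ (c : Fin ℓ → ℂ) (u w : Fin m → ℂ),
        ∃ Φ : ExtReflAlg n bd.r ρ →ₐ[ℂ] Module.End ℂ (nestedVacuum n bd k c m),
          IsNestedAction n bd ρ k c u w Φ ∧
          ∃ (ξ : nestedVacuum n bd k c m) (γ : Fin n → PowerSeries ℂ),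
            IsLowestVector Φ ξ γ ∧
            (∀ j : Fin n,
              tildeW ρ (fun i => bd.gScal n ρ * HahnSeries.ofPowerSeries ℤ ℂ (γ i)) j =
                nestedWeight n bd ρ k c u w j) ∧
            (MvPolynomial.eval (Sum.elim c (Sum.elim u w)) F ≠ 0 → IsCyclicVector Φ ξ) := by
  obtain ⟨hn, hn'⟩ := hbd.two_le
  have hk' := fun i => (hk i).2
  obtain ⟨x, hx⟩ := exists_symGen bd n k m
  obtain ⟨α, ψ, hψ, hK⟩ := bd.exists_kDiag_eq n ρ
  obtain ⟨ξ, hξ⟩ := exists_symMat_mulVec (symVec_mem bd (lowestIdx (m := m) hn hk'))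
  have hξ0 : ξ ≠ 0 := by
    rintro rfl
    rw [Matrix.mulVec_zero] at hξ
    exact symVec_lowestIdx_ne_zero hn hk' hξ.symm
  -- The coordinate space and the site generators do not involve `c`, `u`, `w`, so a single
  -- polynomial serves all parameters. The constant shift `κ/2` of the bulk parameters is built in
  -- through `modShift`.
  obtain ⟨F, hF, h⟩ := exists_siteModule (modList_nodup ℓ m) mem_modList x (modLin bd n k)
    (modConst k) (modShift n bd ℓ m) bd.r ρ (isSite_symGen hx) (fun s t => entryComm_symGen hx) hξ0
    (wt := modWt bd n k)
    (fun s i j hij => symMat_mulVec_injective (by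
      rw [symMat_mulVec_symGen hx, hξ, modGen_lower hn hk' s hij, Matrix.mulVec_zero]))
    (fun s j => symMat_mulVec_injective (by
      rw [symMat_mulVec_symGen hx, hξ, modGen_diag hn hk' s j, Matrix.mulVec_smul, hξ]))
    (cyclicFam_symGen hx (admissible_lowestIdx hn hk') hξ) α ψ hψ
  refine ⟨F, hF, fun c u w => ?_⟩
  obtain ⟨Φ₀, hΦ₀, γ, hlow, hdiag, hconst, hwt, hcyc⟩ := h (Sum.elim c (Sum.elim u w))
  obtain ⟨E, hE⟩ := exists_nestedVacuum_equiv hn hn' hk' (m := m) c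
  obtain ⟨Φ, hΦ⟩ := exists_algHom_conj E Φ₀
  refine ⟨Φ, fun i j v => ?_, E ξ, γ, ⟨?_, fun i j hij s => ?_, fun i s => ?_, hconst⟩, fun j => ?_,
    fun hp => ?_⟩
  · obtain ⟨v, rfl⟩ := E.surjective v
    funext q
    simp only [hΦ, hE, hΦ₀]
    exact nestedMonodromy_mulVec ρ c u w hx hK i j v q
  · simpa using hξ0
  · rw [hΦ, hlow i j hij, map_zero]
  · rw [hΦ, hdiag, map_smul]
  · exact tildeW_eq_nestedWeight ρ c u w hK j (hwt j)
  · intro y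
    obtain ⟨v, rfl⟩ := E.surjective y
    -- The orbit of `ξ` under the whole algebra is a subspace containing `ξ` and stable under the
    -- generators, hence everything.
    have htop := hcyc hp
      { carrier := {v | ∃ a, (Φ₀ a).mulVec ξ = v}
        add_mem' := by
          rintro _ _ ⟨a, rfl⟩ ⟨b, rfl⟩
          exact ⟨a + b, by rw [map_add, Matrix.add_mulVec]⟩
        zero_mem' := ⟨0, by rw [map_zero, Matrix.zero_mulVec]⟩
        smul_mem' := by
          rintro z _ ⟨a, rfl⟩
          exact ⟨z • a, by rw [map_smul, Matrix.smul_mulVec]⟩ }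
      ⟨1, by rw [map_one, Matrix.one_mulVec]⟩
      (by
        rintro t _ ⟨a, rfl⟩
        exact ⟨bGen n bd.r ρ t.1 t.2.1 t.2.2 * a, by rw [map_mul, Matrix.mulVec_mulVec]⟩)
    obtain ⟨a, ha⟩ : v ∈ _ := htop ▸ Submodule.mem_top
    exact ⟨a, by rw [hΦ, ha]⟩
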